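/- Let $m\ge 2$, let $N$ be a closed connected oriented smooth manifold of dimension $m-1$, and let $M$ be a connected oriented smooth manifold of dimension $m$, possibly non-compact and possibly with boundary. Fix a point $p\in M$ and a connected component $\mathcal N$ of the space $C^\infty(N,M)$ with the $C^\infty$ topology, and let $\Sigma=\{f\in\mathcal N : p\in \operatorname{Im} f\}$. A smooth map $F:N\times[0,1]\to M$ is called *good* if $p\notin F(N\times\{0,1\})$ and $p$ is a regular value of $F$; it is then called a good homotopy from $F|_{N\times 0}$ to $F|_{N\times 1}$. For a good $F$ the set $F^{-1}(p)$ is finite, and $\Delta(F)\in\mathbb Z$ denotes the sum over $z\in F^{-1}(p)$ of the signs $\pm1$, where the sign is $+1$ if $F$ preserves orientation near $z$ (with the product orientation on $N\times[0,1]$) and $-1$ otherwise. A smooth map $\mu:N\times S^1\to M$ is called *special* if $\mu|_{N\times s}\in\mathcal N$ for some $s\in S^1$. The degree of $\mu$ is the sum of the signs of the preimages of any regular value if $M$ is closed (compact without boundary), and $0$ if $M$ is not closed. The degrees of all special maps form a subgroup $\mathbf A$ of $\mathbb Z$; put $\mathcal A(M,\mathcal N)=\mathbb Z/\mathbf A$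 and let $q:\mathbb Z\to\mathcal A(M,\mathcal N)$ be the quotient homomorphism. For $\varepsilon,f\in\mathcal N\setminus\Sigma$ put $\operatorname{awin}_{p,\varepsilon}(f)=q(\Delta(F))$, where $F$ is a good homotopy from $\varepsilon$ to $f$. Then the following holds. 1. For all $\varepsilon,f\in\mathcal N\setminus\Sigma$ a good homotopy from $\varepsilon$ to $f$ exists, and $q(\Delta(F))$ is the same for all good homotopies $F$ from $\varepsilon$ to $f$. Thus $\operatorname{awin}_{p,\varepsilon}:\mathcal N\setminus\Sigma\to\mathcal A(M,\mathcal N)$ is well defined. 2. If $\varepsilon,f_0,f_1\in\mathcal N\setminus\Sigma$ and $H$ is a good homotopy from $f_0$ to $f_1$, then $\operatorname{awin}_{p,\varepsilon}(f_1)-\operatorname{awin}_{p,\varepsilon}(f_0)=q(\Delta(H))$. Moreover, the function $\operatorname{awin}_{p,\varepsilon}$ is locally constant on $\mathcal N\setminus\Sigma$. 3. If $\varepsilon,\varepsilon'\in\mathcal N\setminus\Sigma$, then $\operatorname{awin}_{p,\varepsilon'}(f)-\operatorname{awin}_{p,\varepsilon}(f)=\operatorname{awin}_{p,\varepsilon'}(\varepsilon)$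 for all $f\in\mathcal N\setminus\Sigma$; hence $\operatorname{awin}_{p,\varepsilon'}$ and $\operatorname{awin}_{p,\varepsilon}$ differ by an additive constant. -/

import Mathlib

open scoped Manifold ContDiff Topology

noncomputable section

namespace AffineWinding

/-- The model of a smooth manifold with (possibly empty) boundary: the image of the model space in
`ℝᵈ` is either all of `ℝᵈ` or a closed half-space. -/
def IsBoundaryModel {d : ℕ} {H : Type*} [TopologicalSpace H]
    (I : ModelWithCorners ℝ (EuclideanSpace ℝ (Fin d)) H) : Prop :=
  Set.range I = Set.univ ∨
    ∃ φ : EuclideanSpace ℝ (Fin d) →L[ℝ] ℝ, φ ≠ 0 ∧ Set.range I = {v | 0 ≤ φ v}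

/-- An orientation of a `d`-dimensional manifold: an orientation of every tangent space which is
locally constant when read in the local trivializations of the tangent bundle. -/
structure MfdOrientation {d : ℕ} {H : Type*} [TopologicalSpace H]
    (I : ModelWithCorners ℝ (EuclideanSpace ℝ (Fin d)) H)
    (M : Type*) [TopologicalSpace M] [ChartedSpace H M] [IsManifold I ∞ M] where
  /-- the orientation of the tangent space at a point -/
  orient : ∀ x : M, Orientation ℝ (TangentSpace I x) (Fin d)
  locally_constant : ∀ x₀ : M, ∃ o₀ : Orientation ℝ (EuclideanSpace ℝ (Fin d)) (Fin d),
    ∀ᶠ x in 𝓝 x₀,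
      ∀ hx : x ∈ (trivializationAt (EuclideanSpace ℝ (Fin d)) (TangentSpace I) x₀).baseSet,
        Orientation.map (Fin d)
          ((trivializationAt (EuclideanSpace ℝ (Fin d)) (TangentSpace I) x₀).continuousLinearEquivAt
            ℝ x hx).toLinearEquiv (orient x) = o₀

section Topology

variable {n d : ℕ} {N : Type*} [TopologicalSpace N] [ChartedSpace (EuclideanSpace ℝ (Fin n)) N]
  {H : Type*} [TopologicalSpace H] {I : ModelWithCorners ℝ (EuclideanSpace ℝ (Fin d)) H}
  {M : Type*} [TopologicalSpace M] [ChartedSpace H M]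

/-- The basic neighbourhood of `f` in `C^∞(N, M)`: all `g` which map the compact set `K` into the
domain of the chart `ψ` and whose expression in the charts `φ`, `ψ` is `δ`-close to that of `f`
on `K`, together with all derivatives of order at most `r`. -/
def basicNhd (f : C^∞⟮𝓡 n, N; I, M⟯) (φ : OpenPartialHomeomorph N (EuclideanSpace ℝ (Fin n)))
    (ψ : OpenPartialHomeomorph M H) (K : Set N) (r : ℕ) (δ : ℝ) : Set C^∞⟮𝓡 n, N; I, M⟯ :=
  {g | (∀ x ∈ K, g x ∈ ψ.source) ∧ ∀ x ∈ K, ∀ k ≤ r,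
    ‖iteratedFDeriv ℝ k (fun v => ψ.extend I (g (φ.symm v))) (φ x) -
      iteratedFDeriv ℝ k (fun v => ψ.extend I (f (φ.symm v))) (φ x)‖ < δ}

/-- The `C^∞` topology on the space of smooth maps `N → M` (for compact `N`): uniform convergence
of all derivatives on compact sets, in charts. -/
instance smoothTopology : TopologicalSpace C^∞⟮𝓡 n, N; I, M⟯ :=
  TopologicalSpace.generateFrom
    {U | ∃ (f : C^∞⟮𝓡 n, N; I, M⟯), ∃ φ ∈ IsManifold.maximalAtlas (𝓡 n) ∞ N,
      ∃ ψ ∈ IsManifold.maximalAtlas I ∞ M, ∃ (K : Set N) (r : ℕ) (δ : ℝ),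
        IsCompact K ∧ K ⊆ φ.source ∧ (∀ x ∈ K, f x ∈ ψ.source) ∧ 0 < δ ∧
          U = basicNhd f φ ψ K r δ}

end Topology

section Count

variable {n : ℕ} {N : Type*} [TopologicalSpace N] [ChartedSpace (EuclideanSpace ℝ (Fin n)) N]
  [IsManifold (𝓡 n) ∞ N]
  {H : Type*} [TopologicalSpace H] {I : ModelWithCorners ℝ (EuclideanSpace ℝ (Fin (n + 1))) H}
  {M : Type*} [TopologicalSpace M] [ChartedSpace H M] [IsManifold I ∞ M]
  {G : Type*} [TopologicalSpace G] {J : ModelWithCorners ℝ (EuclideanSpace ℝ (Fin 1)) G}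
  {P : Type*} [TopologicalSpace P] [ChartedSpace G P]

/-- `y` is a regular value of `F : N × P → M`. -/
def IsRegularValue (F : C^∞⟮(𝓡 n).prod J, N × P; I, M⟯) (y : M) : Prop :=
  ∀ z : N × P, F z = y → Function.Surjective (mfderiv ((𝓡 n).prod J) I F z)

/-- Here `P` is a `1`-manifold oriented by the nowhere vanishing vector field `τ`, and `N × P` has
the product orientation: `(v₁, 0), …, (vₙ, 0), (0, τ)` is a positive frame if `v₁, …, vₙ` is.
`F` preserves the orientation at `z` if its differential maps a positive frame to a positive
frame. -/
def PreservesOrientationAt (oN : MfdOrientation (𝓡 n) N) (oM : MfdOrientation I M)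
    (τ : ∀ t : P, TangentSpace J t) (F : C^∞⟮(𝓡 n).prod J, N × P; I, M⟯) (z : N × P) : Prop :=
  ∃ (b : Module.Basis (Fin n) ℝ (TangentSpace (𝓡 n) z.1))
    (c : Module.Basis (Fin (n + 1)) ℝ (TangentSpace I (F z))),
    b.orientation = oN.orient z.1 ∧ c.orientation = oM.orient (F z) ∧
    (∀ i : Fin n, c i.castSucc = mfderiv ((𝓡 n).prod J) I F z (b i, 0)) ∧
    c (Fin.last n) = mfderiv ((𝓡 n).prod J) I F z (0, τ z.2)

open Classical in
/-- The sign of a point: `1` where `F` preserves the orientation, and `-1` otherwise. -/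
def pointSign (oN : MfdOrientation (𝓡 n) N) (oM : MfdOrientation I M)
    (τ : ∀ t : P, TangentSpace J t) (F : C^∞⟮(𝓡 n).prod J, N × P; I, M⟯) (z : N × P) : ℤ :=
  if PreservesOrientationAt oN oM τ F z then 1 else -1

/-- The sum of the signs of the preimages of `y` under `F`. -/
def signedCount (oN : MfdOrientation (𝓡 n) N) (oM : MfdOrientation I M)
    (τ : ∀ t : P, TangentSpace J t) (F : C^∞⟮(𝓡 n).prod J, N × P; I, M⟯) (y : M) : ℤ :=
  ∑ᶠ z ∈ F ⁻¹' {y}, pointSign oN oM τ F z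

end Count

/-- The unit tangent vector of the circle, in the counterclockwise direction. -/
def circleUnitVector (s : Circle) : TangentSpace (𝓡 1) s :=
  mfderiv 𝓘(ℝ, ℝ) (𝓡 1) Circle.exp (Complex.arg (s : ℂ)) (1 : ℝ)

section Winding

variable {n : ℕ} {N : Type*} [TopologicalSpace N] [ChartedSpace (EuclideanSpace ℝ (Fin n)) N]
  [IsManifold (𝓡 n) ∞ N]
  {H : Type*} [TopologicalSpace H] {I : ModelWithCorners ℝ (EuclideanSpace ℝ (Fin (n + 1))) H}
  {M : Type*} [TopologicalSpace M] [ChartedSpace H M] [IsManifold I ∞ M]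

/-- A smooth map `F : N × [0, 1] → M` is good if `p` is a regular value of `F` and
`p ∉ F(N × {0, 1})`. -/
def IsGood (p : M) (F : C^∞⟮(𝓡 n).prod (𝓡∂ 1), N × unitInterval; I, M⟯) : Prop :=
  (∀ x : N, F (x, 0) ≠ p ∧ F (x, 1) ≠ p) ∧ IsRegularValue F p

/-- `F` is a good homotopy from `f₀` to `f₁`. -/
def IsGoodHomotopy (p : M) (F : C^∞⟮(𝓡 n).prod (𝓡∂ 1), N × unitInterval; I, M⟯)
    (f₀ f₁ : C^∞⟮𝓡 n, N; I, M⟯) : Prop :=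
  IsGood p F ∧ (∀ x : N, F (x, 0) = f₀ x) ∧ ∀ x : N, F (x, 1) = f₁ x

/-- The sum `Δ(F)` of the signs of the preimages of `p` under `F : N × [0, 1] → M`, the interval
having its standard orientation. -/
def Delta (oN : MfdOrientation (𝓡 n) N) (oM : MfdOrientation I M) (p : M)
    (F : C^∞⟮(𝓡 n).prod (𝓡∂ 1), N × unitInterval; I, M⟯) : ℤ :=
  signedCount oN oM (fun t : unitInterval => oneTangentSpaceIcc t) F p

open Classical in
/-- `d` is the degree of `μ : N × S¹ → M`: if `M` is closed, the sum of the signs of the preimages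
is `d` for every regular value (and there are regular values); if `M` is not closed, the degree
is zero by definition. -/
def HasDegree (oN : MfdOrientation (𝓡 n) N) (oM : MfdOrientation I M)
    (μ : C^∞⟮(𝓡 n).prod (𝓡 1), N × Circle; I, M⟯) (d : ℤ) : Prop :=
  if CompactSpace M ∧ BoundarylessManifold I M then
    (∃ y : M, IsRegularValue μ y) ∧
      ∀ y : M, IsRegularValue μ y → signedCount oN oM circleUnitVector μ y = d
  else d = 0

/-- `μ : N × S¹ → M` is special if its restriction to some `N × {s}` belongs to `𝒩`. -/
def IsSpecial (𝒩 : Set C^∞⟮𝓡 n, N; I, M⟯)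
    (μ : C^∞⟮(𝓡 n).prod (𝓡 1), N × Circle; I, M⟯) : Prop :=
  ∃ s : Circle, ∃ g ∈ 𝒩, ∀ x : N, g x = μ (x, s)

/-- The set of degrees of special maps. -/
def specialDegrees (oN : MfdOrientation (𝓡 n) N) (oM : MfdOrientation I M)
    (𝒩 : Set C^∞⟮𝓡 n, N; I, M⟯) : Set ℤ :=
  {d | ∃ μ, IsSpecial 𝒩 μ ∧ HasDegree oN oM μ d}

/-- The indeterminacy subgroup `A` of `ℤ`, given by the degrees of special maps. -/
def indeterminacy (oN : MfdOrientation (𝓡 n) N) (oM : MfdOrientation I M)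
    (𝒩 : Set C^∞⟮𝓡 n, N; I, M⟯) : AddSubgroup ℤ :=
  AddSubgroup.closure (specialDegrees oN oM 𝒩)

/-- The quotient homomorphism `q : ℤ → ℤ / A`. -/
def quot (oN : MfdOrientation (𝓡 n) N) (oM : MfdOrientation I M)
    (𝒩 : Set C^∞⟮𝓡 n, N; I, M⟯) : ℤ →+ ℤ ⧸ indeterminacy oN oM 𝒩 :=
  QuotientAddGroup.mk' (indeterminacy oN oM 𝒩)

/-- The set `𝒩 ∖ Σ` of all maps in `𝒩` whose image does not contain `p`. -/
def offDiscriminant (𝒩 : Set C^∞⟮𝓡 n, N; I, M⟯) (p : M) : Set C^∞⟮𝓡 n, N; I, M⟯ :=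
  {f ∈ 𝒩 | p ∉ Set.range f}

open Classical in
/-- The affine winding number of `f` around `p` with respect to `ε`: the class of `Δ(F)` in `ℤ / A`
for some good homotopy `F` from `ε` to `f`. -/
def awin (oN : MfdOrientation (𝓡 n) N) (oM : MfdOrientation I M)
    (𝒩 : Set C^∞⟮𝓡 n, N; I, M⟯) (p : M) (ε f : C^∞⟮𝓡 n, N; I, M⟯) :
    ℤ ⧸ indeterminacy oN oM 𝒩 :=
  if h : ∃ F, IsGoodHomotopy p F ε f then quot oN oM 𝒩 (Delta oN oM p h.choose) else 0

end Winding

end AffineWinding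

end

noncomputable section

namespace AffineWinding

/-! ### Jacobian determinants with one compactly supported component integrate to zero -/

section NullLagrangian

open MeasureTheory

variable {E : Type*} [NormedAddCommGroup E] [NormedSpace ℝ E]
  {ι : Type*} [Fintype ι] [DecidableEq ι]

/-! Two good homotopies from `ε` to `f` can be glued, one followed by the reverse of the other, into
a map on `N × S¹` whose signed count at `p` is the difference of the two values of `Δ`. This map is
special, so everything rests on one fact: for a map on `N × S¹` the signed count is the same at all
regular values and vanishes when `M` is not closed (`exists_degree`). The difference then lies in
the subgroup of degrees. The same gluing with three homotopies gives additivity along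
concatenations, hence the difference formula and the effect of changing `ε`.

The degree is built by hand. In coordinates, adding `u • v` to a map, with `u` compactly supported,
does not change the sum of the signs of the Jacobian over a fibre
(`finsum_sign_det_eq_of_add_smul`). By change of variables that sum is an integral of `h ∘ g` times
the Jacobian, where `h` is a bump near the value. Taking `h` to be a directional derivative `∂ᵥH`
makes the difference of the two integrals the integral of a Jacobian determinant with one compactly
supported row, and this is zero by integration by parts and the symmetry of second derivatives. A
partition of unity turns the local statement into invariance under a displacement of the target in a
chart (`signedCount_eq_of_isPushOf`). Displacing one value onto a nearby one shows that the count is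
locally constant near interior points. Displacing inwards at a boundary point empties the nearby
fibres, so the count is zero there. If `M` is not compact, some value is omitted. Sard's theorem in
equal dimensions supplies the regular values needed throughout.

Homotopies are handled as strips: maps on `N × ℝ` that are stationary outside the unit interval, so
that concatenation is smooth. `IsReparam` transports regularity and signs between the interval, the
line and the circle.

A good homotopy exists because maps close to `f` are smoothly homotopic to `f` by straight segments
in charts, so smooth homotopy classes are open and closed
(`exists_isStrip_of_mem_connectedComponent`); a displacement supported away from the images of the
ends then makes `p` regular (`IsStrip.exists_isStripRegular`). Local constancy holds because a map
near `f` is homotopic to `f` inside the complement of `p`, which makes `Δ` zero. The degrees form a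
subgroup because closed strips can be conjugated to a common base map, concatenated and reversed
(`coe_indeterminacy`). -/

theorem sum_perm_sign_second_derivative_eq_zero (c : ι → E) (f : ι → E → ℝ)
    (hf : ∀ i, ContDiff ℝ 2 (f i)) (k l : ι) (hkl : l ≠ k) (x : E) :
    ∑ σ : Equiv.Perm ι, (Equiv.Perm.sign σ : ℝ) *
      ((∏ i ∈ (Finset.univ.erase k).erase l, fderiv ℝ (f i) x (c (σ i))) *
        fderiv ℝ (fderiv ℝ (f l)) x (c (σ k)) (c (σ l))) = 0 := by
  -- Composing `σ` with the transposition of `k` and `l` flips the sign, fixes the product over the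
  -- other indices and exchanges the two arguments of the symmetric second derivative, so the terms
  -- cancel in pairs.
  refine Finset.sum_involution (fun σ _ => σ * Equiv.swap k l) ?_ ?_ (fun _ _ => Finset.mem_univ _) ?_
  · intro σ _
    have h1 : ∏ i ∈ (Finset.univ.erase k).erase l,
        fderiv ℝ (f i) x (c ((σ * Equiv.swap k l) i)) =
        ∏ i ∈ (Finset.univ.erase k).erase l, fderiv ℝ (f i) x (c (σ i)) := by
      refine Finset.prod_congr rfl fun i hi => ?_
      simp only [Finset.mem_erase, Finset.mem_univ, and_true] at hi
      rw [Equiv.Perm.mul_apply, Equiv.swap_apply_of_ne_of_ne hi.2 hi.1]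
    rw [h1, Equiv.Perm.sign_mul, Equiv.Perm.sign_swap hkl.symm]
    simp only [Equiv.Perm.mul_apply, Equiv.swap_apply_left, Equiv.swap_apply_right]
    have hs : IsSymmSndFDerivAt ℝ (f l) x :=
      (hf l).contDiffAt.isSymmSndFDerivAt (by simp)
    rw [hs (c (σ l)) (c (σ k))]
    push_cast
    ring
  · intro σ _ _ h
    have := congrArg (fun τ : Equiv.Perm ι => τ k) h
    simp only [Equiv.Perm.mul_apply, Equiv.swap_apply_left] at this
    exact hkl (σ.injective this)
  · intro σ _
    simp [mul_assoc]

/-- By the chain rule the new `k`-th row is the combination of the rows of the Jacobian matrix with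
coefficients the partial derivatives of `H`; the determinant keeps only the multiple of the old
`k`-th row. A pulled-back density `∂H` thus becomes a Jacobian determinant. -/
theorem fderiv_mul_det_eq_det_updateRow [FiniteDimensional ℝ E] (c : Module.Basis ι ℝ E) {g : E → E} {H : E → ℝ} {x : E}
    (hg : DifferentiableAt ℝ g x) (hH : DifferentiableAt ℝ H (g x)) (k : ι) :
    fderiv ℝ H (g x) (c k) * (fderiv ℝ g x).det =
      (Matrix.of fun i j => fderiv ℝ
        (Function.update (fun i y => c.coord i (g y)) k (H ∘ g) i) x (c j)).det := by
  have hcoord : ∀ i j, fderiv ℝ (fun y => c.coord i (g y)) x (c j) =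
      c.repr (fderiv ℝ g x (c j)) i := by
    intro i j
    have : HasFDerivAt (fun y => c.coord i (g y))
        ((LinearMap.toContinuousLinearMap (c.coord i)).comp (fderiv ℝ g x)) x :=
      (LinearMap.toContinuousLinearMap (c.coord i)).hasFDerivAt.comp x hg.hasFDerivAt
    rw [this.fderiv]
    simp
  have h1 : (Matrix.of fun i j => fderiv ℝ
        (Function.update (fun i y => c.coord i (g y)) k (H ∘ g) i) x (c j)) =
      (LinearMap.toMatrix c c (fderiv ℝ g x : E →ₗ[ℝ] E)).updateRow k
        (∑ i, fderiv ℝ H (g x) (c i) • LinearMap.toMatrix c c (fderiv ℝ g x : E →ₗ[ℝ] E) i) := by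
    ext i j
    by_cases hi : i = k
    · subst hi
      rw [Matrix.updateRow_self]
      simp only [Matrix.of_apply, Function.update_self, Finset.sum_apply, Pi.smul_apply,
        LinearMap.toMatrix_apply, smul_eq_mul, ContinuousLinearMap.coe_coe]
      rw [fderiv_comp x hH hg, ContinuousLinearMap.comp_apply]
      conv_lhs => rw [← c.sum_repr (fderiv ℝ g x (c j))]
      rw [map_sum]
      refine Finset.sum_congr rfl fun i _ => ?_
      rw [map_smul, smul_eq_mul, mul_comm]
    · rw [Matrix.updateRow_ne hi, LinearMap.toMatrix_apply]
      simp only [Matrix.of_apply, Function.update_of_ne hi]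
      exact hcoord i j
  rw [h1, Matrix.det_updateRow_sum, LinearMap.det_toMatrix, smul_eq_mul]

variable [FiniteDimensional ℝ E] [MeasurableSpace E] [BorelSpace E] (μ : Measure E)
  [μ.IsAddHaarMeasure]

/-- The Jacobian determinant of a family of functions one of which has compact support integrates
to zero. -/
theorem integral_det_fderiv_eq_zero (c : ι → E) (f : ι → E → ℝ)
    (hf : ∀ i, ContDiff ℝ 2 (f i)) (k : ι) (hk : HasCompactSupport (f k)) :
    ∫ x, (Matrix.of fun i j => fderiv ℝ (f i) x (c j)).det ∂μ = 0 := by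
  have hd : ∀ i j, ContDiff ℝ 1 (fun x => fderiv ℝ (f i) x (c j)) := fun i j =>
    ((hf i).fderiv_right (m := 1) (by norm_num)).clm_apply contDiff_const
  let P : Equiv.Perm ι → E → ℝ := fun σ x => ∏ i ∈ Finset.univ.erase k, fderiv ℝ (f i) x (c (σ i))
  have hP : ∀ σ, ContDiff ℝ 1 (P σ) := fun σ => contDiff_prod fun i _ => hd i (σ i)
  have hdet : ∀ x, (Matrix.of fun i j => fderiv ℝ (f i) x (c j)).det =
      ∑ σ : Equiv.Perm ι, (Equiv.Perm.sign σ : ℝ) * (P σ x * fderiv ℝ (f k) x (c (σ k))) := by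
    intro x
    rw [← Matrix.det_transpose, Matrix.det_apply']
    refine Finset.sum_congr rfl fun σ _ => ?_
    rw [← Finset.prod_erase_mul Finset.univ _ (Finset.mem_univ k)]
    rfl
  have hdP : ∀ σ, Continuous fun x => fderiv ℝ (P σ) x (c (σ k)) := fun σ =>
    ((hP σ).continuous_fderiv one_ne_zero).clm_apply continuous_const
  have hkc : Continuous (f k) := (hf k).continuous
  have hdk : ∀ j, HasCompactSupport fun x => fderiv ℝ (f k) x (c j) := fun j =>
    hk.fderiv_apply ℝ (c j)
  have hint1 : ∀ σ, Integrable (fun x => P σ x * fderiv ℝ (f k) x (c (σ k))) μ := fun σ =>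
    ((hP σ).continuous.mul (hd k (σ k)).continuous).integrable_of_hasCompactSupport
      ((hdk _).mul_left)
  have hint2 : ∀ σ, Integrable (fun x => fderiv ℝ (P σ) x (c (σ k)) * f k x) μ := fun σ =>
    ((hdP σ).mul hkc).integrable_of_hasCompactSupport hk.mul_left
  -- Integration by parts takes the derivative off the compactly supported factor `f k`. It then
  -- falls on one of the other factors, leaving second derivatives whose alternating sum over `σ`
  -- vanishes.
  have hibp : ∀ σ, ∫ x, P σ x * fderiv ℝ (f k) x (c (σ k)) ∂μ =
      -∫ x, fderiv ℝ (P σ) x (c (σ k)) * f k x ∂μ := by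
    intro σ
    refine integral_mul_fderiv_eq_neg_fderiv_mul_of_integrable (hint2 σ) (hint1 σ)
      (((hP σ).continuous.mul hkc).integrable_of_hasCompactSupport hk.mul_left) ?_ ?_
    · exact fun x _ => (hP σ).differentiable one_ne_zero x
    · exact fun x _ => (hf k).differentiable two_ne_zero x
  simp_rw [hdet]
  rw [integral_finsetSum _ fun σ _ => (hint1 σ).const_mul _]
  simp_rw [integral_const_mul, hibp]
  simp_rw [mul_neg, Finset.sum_neg_distrib, ← integral_const_mul]
  rw [← integral_finsetSum _ fun σ _ => (hint2 σ).const_mul _, neg_eq_zero]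
  refine integral_eq_zero_of_ae (Filter.Eventually.of_forall fun x => ?_)
  have hfd : ∀ σ, fderiv ℝ (P σ) x (c (σ k)) = ∑ l ∈ Finset.univ.erase k,
      (∏ i ∈ (Finset.univ.erase k).erase l, fderiv ℝ (f i) x (c (σ i))) *
        fderiv ℝ (fderiv ℝ (f l)) x (c (σ k)) (c (σ l)) := by
    intro σ
    have : fderiv ℝ (P σ) x = _ :=
      fderiv_finsetProd (𝕜 := ℝ) (u := Finset.univ.erase k)
        (g := fun i x => fderiv ℝ (f i) x (c (σ i)))
        (fun i _ => (hd i (σ i)).differentiable one_ne_zero x)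
    rw [this, sum_apply]
    refine Finset.sum_congr rfl fun l _ => ?_
    rw [smul_apply, smul_eq_mul]
    congr 1
    have h2 : DifferentiableAt ℝ (fderiv ℝ (f l)) x :=
      ((hf l).fderiv_right (m := 1) (by norm_num)).differentiable one_ne_zero x
    rw [fderiv_clm_apply h2 (differentiableAt_const _)]
    simp
  have : ∑ σ : Equiv.Perm ι, (Equiv.Perm.sign σ : ℝ) * (fderiv ℝ (P σ) x (c (σ k)) * f k x) =
      (∑ l ∈ Finset.univ.erase k, ∑ σ : Equiv.Perm ι, (Equiv.Perm.sign σ : ℝ) *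
        ((∏ i ∈ (Finset.univ.erase k).erase l, fderiv ℝ (f i) x (c (σ i))) *
        fderiv ℝ (fderiv ℝ (f l)) x (c (σ k)) (c (σ l)))) * f k x := by
    simp_rw [hfd]
    rw [Finset.sum_comm, Finset.sum_mul]
    refine Finset.sum_congr rfl fun σ _ => ?_
    rw [← Finset.mul_sum, mul_assoc]
  simp only [Pi.zero_apply]
  rw [this, Finset.sum_eq_zero, zero_mul]
  intro l hl
  exact sum_perm_sign_second_derivative_eq_zero c f hf k l (Finset.ne_of_mem_erase hl) x

/-- Changing a map by a compactly supported function in the direction of a basis vector does not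
change the integral of the pull-back of the density `∂H`. -/
theorem integral_fderiv_mul_det_sub_eq_zero (c : Module.Basis ι ℝ E) {g : E → E} {u : E → ℝ} {H : E → ℝ}
    (hg : ContDiff ℝ 2 g) (hu : ContDiff ℝ 2 u) (hH : ContDiff ℝ 2 H) (huc : HasCompactSupport u)
    (k : ι) :
    ∫ x, (fderiv ℝ H (g x + u x • c k) (c k) * (fderiv ℝ (fun y => g y + u y • c k) x).det -
      fderiv ℝ H (g x) (c k) * (fderiv ℝ g x).det) ∂μ = 0 := by
  have hg1 : ContDiff ℝ 2 (fun y => g y + u y • c k) := hg.add (hu.smul contDiff_const)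
  -- This is the difference of the two candidates for the `k`-th component; it vanishes wherever `u`
  -- does, hence has compact support.
  let w : E → ℝ := fun x => H (g x + u x • c k) - H (g x)
  have hw : ContDiff ℝ 2 w := (hH.comp hg1).sub (hH.comp hg)
  have hwc : HasCompactSupport w := huc.mono fun x hx => by
    contrapose! hx
    have hx0 : u x = 0 := by simpa using hx
    simp [w, hx0]
  let f : ι → E → ℝ := Function.update (fun i y => c.coord i (g y)) k w
  have hf : ∀ i, ContDiff ℝ 2 (f i) := by
    intro i
    by_cases hi : i = k
    · subst hi
      simpa only [f, Function.update_self] using hw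
    · simp only [f, Function.update_of_ne hi]
      exact (LinearMap.toContinuousLinearMap (c.coord i)).contDiff.comp hg
  have key := integral_det_fderiv_eq_zero μ c f hf k
    (by simpa only [f, Function.update_self] using hwc)
  rw [← key]
  refine integral_congr_ae (Filter.Eventually.of_forall fun x => ?_)
  have d0 := hg.differentiable two_ne_zero x
  have d1 := hg1.differentiable two_ne_zero x
  beta_reduce
  rw [fderiv_mul_det_eq_det_updateRow c d0 (hH.differentiable two_ne_zero _) k]
  have := fderiv_mul_det_eq_det_updateRow c d1 (hH.differentiable two_ne_zero _) k
  beta_reduce at this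
  rw [this]
  have hrow : ∀ F : E → ℝ, (Matrix.of fun i j => fderiv ℝ
        (Function.update (fun i y => c.coord i (g y)) k F i) x (c j)) =
      (Matrix.of fun i j => fderiv ℝ (c.coord i ∘ g) x (c j)).updateRow k
        (fun j => fderiv ℝ F x (c j)) := by
    intro F
    ext i j
    by_cases hi : i = k
    · subst hi
      simp
    · simp only [Matrix.of_apply, Function.update_of_ne hi, Matrix.updateRow_ne hi]
      rfl
  -- Moving along `c k` changes only the `k`-th coordinate, so the two matrices share all other rows
  -- and their determinants can be subtracted by linearity in row `k`.
  have hrow1 : Function.update (fun i y => c.coord i (g y + u y • c k)) k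
      (H ∘ fun y => g y + u y • c k) =
      Function.update (fun i y => c.coord i (g y)) k (H ∘ fun y => g y + u y • c k) := by
    funext i y
    by_cases hi : i = k
    · subst hi
      simp
    · simp [Function.update_of_ne hi, Finsupp.single_eq_of_ne hi]
  rw [hrow1, hrow, hrow, hrow]
  have hwd : (fun j => fderiv ℝ w x (c j)) = (fun j => fderiv ℝ (H ∘ fun y => g y + u y • c k) x (c j))
      + (-1 : ℝ) • (fun j => fderiv ℝ (H ∘ g) x (c j)) := by
    funext j
    have : w = (H ∘ fun y => g y + u y • c k) - (H ∘ g) := rfl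
    rw [this, fderiv_sub ((hH.comp hg1).differentiable two_ne_zero x)
      ((hH.comp hg).differentiable two_ne_zero x)]
    simp [sub_eq_add_neg]
  rw [hwd, Matrix.det_updateRow_add, Matrix.det_updateRow_smul]
  ring

end NullLagrangian

end AffineWinding

end

noncomputable section

namespace AffineWinding

/-! ### The signed count of a fibre in Euclidean space -/

section LocalDegree

open MeasureTheory

variable {E : Type*} [NormedAddCommGroup E] [NormedSpace ℝ E] [FiniteDimensional ℝ E]

theorem exists_deriv_smoothTransition_ne_zero : ∃ t : ℝ, deriv Real.smoothTransition t ≠ 0 := by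
  by_contra! h
  have hc : ∀ x y, Real.smoothTransition x = Real.smoothTransition y :=
    is_const_of_deriv_eq_zero
      ((Real.smoothTransition.contDiff (n := 1)).differentiable one_ne_zero) h
  simpa using hc 0 1

theorem deriv_smoothTransition_eq_zero {t : ℝ} (ht : t < 0 ∨ 1 < t) :
    deriv Real.smoothTransition t = 0 := by
  rcases ht with ht | ht
  · have : Real.smoothTransition =ᶠ[𝓝 t] fun _ => 0 := by
      filter_upwards [gt_mem_nhds ht] with s hs using Real.smoothTransition.zero_of_nonpos hs.le
    rw [this.deriv_eq, deriv_const]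
  · have : Real.smoothTransition =ᶠ[𝓝 t] fun _ => 1 := by
      filter_upwards [lt_mem_nhds ht] with s hs using Real.smoothTransition.one_of_one_le hs.le
    rw [this.deriv_eq, deriv_const]

/-- A bump function which is a directional derivative. -/
theorem exists_bump_directional_derivative [MeasurableSpace E] [BorelSpace E] (μ : Measure E)
    [μ.IsAddHaarMeasure] {v : E} (hv : v ≠ 0) (y : E) {r : ℝ} (hr : 0 < r) :
    ∃ H : E → ℝ, ContDiff ℝ 2 H ∧ (Function.support fun x => fderiv ℝ H x v) ⊆ Metric.ball y r ∧
      ∫ x, fderiv ℝ H x v ∂μ ≠ 0 := by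
  obtain ⟨l, hl⟩ := SeparatingDual.exists_eq_one (R := ℝ) hv
  have hv0 : 0 < ‖v‖ := norm_pos_iff.2 hv
  obtain ⟨ε, hε, hεr⟩ : ∃ ε : ℝ, 0 < ε ∧ ε * ‖v‖ < r / 2 :=
    ⟨r / (4 * ‖v‖), by positivity, by field_simp; norm_num⟩
  let κ : ContDiffBump (0 : E) := ⟨r / 4, r / 2, by positivity, by linarith⟩
  -- The projection onto `ker l` along `v`: a function of `p x` is constant in the direction `v`.
  let p : E →L[ℝ] E := ContinuousLinearMap.id ℝ E - l.smulRight v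
  have hp : ∀ x, p x = x - l x • v := fun x => rfl
  have hpv : p v = 0 := by simp [hp, hl]
  -- A smooth step in the direction `v` times a transverse bump. `H` itself need not have compact
  -- support, but its derivative along `v` lives where the step rises, in a piece of the tube of
  -- length `ε * ‖v‖` and radius `r / 2`.
  let H : E → ℝ := fun x => Real.smoothTransition (l (x - y) / ε) * κ (p (x - y))
  have hS : ContDiff ℝ 2 Real.smoothTransition := Real.smoothTransition.contDiff
  have hκ : ContDiff ℝ 2 κ := κ.contDiff
  have hH : ContDiff ℝ 2 H := by
    refine ContDiff.mul (hS.comp ?_) (hκ.comp ?_) <;> fun_prop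
  have hder : ∀ x, fderiv ℝ H x v =
      deriv Real.smoothTransition (l (x - y) / ε) / ε * κ (p (x - y)) := by
    intro x
    have h1 : HasDerivAt (fun t : ℝ => l (x + t • v - y) / ε) (1 / ε) 0 := by
      have : HasDerivAt (fun t : ℝ => (l (x - y) + t) / ε) (1 / ε) 0 :=
        ((hasDerivAt_id (0 : ℝ)).const_add _).div_const _
      convert this using 3 with t
      simp only [map_sub, map_add, map_smul, hl, smul_eq_mul]
      ring
    have h2 : HasDerivAt (fun t : ℝ => H (x + t • v))
        (deriv Real.smoothTransition (l (x - y) / ε) * (1 / ε) * κ (p (x - y))) 0 := by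
      have h3 : (fun t : ℝ => H (x + t • v)) =
          fun t => Real.smoothTransition (l (x + t • v - y) / ε) * κ (p (x - y)) := by
        funext t
        simp only [H]
        congr 2
        simp [map_sub, map_add, hpv]
      rw [h3]
      refine HasDerivAt.mul_const ?_ _
      have h4 : HasDerivAt Real.smoothTransition (deriv Real.smoothTransition (l (x - y) / ε))
          (l (x + (0 : ℝ) • v - y) / ε) := by
        rw [zero_smul, add_zero]
        exact (hS.differentiable two_ne_zero _).hasDerivAt
      exact h4.comp (0 : ℝ) h1
    have h5 : HasDerivAt (fun t : ℝ => H (x + t • v)) (fderiv ℝ H x v) 0 := by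
      have h6 : HasFDerivAt H (fderiv ℝ H x) (x + (0 : ℝ) • v) := by
        rw [zero_smul, add_zero]
        exact (hH.differentiable two_ne_zero x).hasFDerivAt
      have h7 : HasDerivAt (fun t : ℝ => x + t • v) v 0 := by
        simpa using ((hasDerivAt_id (0 : ℝ)).smul_const v).const_add x
      exact h6.comp_hasDerivAt (0 : ℝ) h7
    rw [h5.unique h2]
    ring
  have hsupp : (Function.support fun x => fderiv ℝ H x v) ⊆ Metric.ball y r := by
    intro x hx
    rw [Function.mem_support, hder] at hx
    have hx1 : deriv Real.smoothTransition (l (x - y) / ε) ≠ 0 := by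
      intro h; rw [h, zero_div, zero_mul] at hx; exact hx rfl
    have hx2 : p (x - y) ∈ Function.support κ := fun h => hx (by rw [h, mul_zero])
    rw [κ.support_eq, mem_ball_zero_iff] at hx2
    have hx3 : 0 ≤ l (x - y) / ε ∧ l (x - y) / ε ≤ 1 := by
      constructor
      · by_contra! h
        exact hx1 (deriv_smoothTransition_eq_zero (Or.inl h))
      · by_contra! h
        exact hx1 (deriv_smoothTransition_eq_zero (Or.inr h))
    have hx4 : |l (x - y)| ≤ ε := by
      rw [abs_le]
      rw [le_div_iff₀ hε, div_le_iff₀ hε] at hx3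
      constructor <;> linarith [hx3.1, hx3.2]
    rw [mem_ball_iff_norm]
    have : x - y = p (x - y) + l (x - y) • v := by simp [hp]
    rw [this]
    calc ‖p (x - y) + l (x - y) • v‖ ≤ ‖p (x - y)‖ + ‖l (x - y) • v‖ := norm_add_le _ _
      _ ≤ ‖p (x - y)‖ + ε * ‖v‖ := by
        rw [norm_smul, Real.norm_eq_abs]; gcongr
      _ < r / 2 + r / 2 := add_lt_add hx2 hεr
      _ = r := by ring
  refine ⟨H, hH, hsupp, ne_of_gt ?_⟩
  obtain ⟨t, ht⟩ := exists_deriv_smoothTransition_ne_zero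
  have hcont : Continuous fun x => fderiv ℝ H x v :=
    (hH.continuous_fderiv two_ne_zero).clm_apply continuous_const
  refine Continuous.integral_pos_of_hasCompactSupport_nonneg_nonzero (x := y + (ε * t) • v)
    hcont ?_ ?_ ?_
  · exact HasCompactSupport.of_support_subset_isCompact (isCompact_closedBall y r)
      (hsupp.trans Metric.ball_subset_closedBall)
  · intro x
    change 0 ≤ fderiv ℝ H x v
    rw [hder]
    exact mul_nonneg (div_nonneg (Real.smoothTransition.monotone.deriv_nonneg) hε.le) κ.nonneg
  · rw [hder]
    have h1 : l (y + (ε * t) • v - y) / ε = t := by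
      simp [hl]; field_simp
    have h2 : p (y + (ε * t) • v - y) = 0 := by simp [hpv]
    rw [h1, h2]
    have h3 : κ 0 = 1 := κ.one_of_mem_closedBall (by simp; positivity)
    rw [h3, mul_one]
    exact div_ne_zero ht hε.ne'

theorem exists_openPartialHomeomorph_of_det_ne_zero {g : E → E} {z : E} (hg : ContDiffAt ℝ 2 g z)
    (hz : (fderiv ℝ g z).det ≠ 0) :
    ∃ φ : OpenPartialHomeomorph E E, z ∈ φ.source ∧ (φ : E → E) = g := by
  have hstrict : HasStrictFDerivAt g
      ((fderiv ℝ g z).toContinuousLinearEquivOfDetNeZero hz : E →L[ℝ] E) z := by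
    rw [ContinuousLinearMap.coe_toContinuousLinearEquivOfDetNeZero]
    exact hg.hasStrictFDerivAt two_ne_zero
  exact ⟨hstrict.toOpenPartialHomeomorph g, hstrict.mem_toOpenPartialHomeomorph_source, rfl⟩

/-- Change of variables on a neighbourhood where `g` is injective and the Jacobian keeps the sign it
has at `z`; `r` makes the ball around `g z` lie in the image of `U`. Since `r` comes after `U`, the
neighbourhoods can first be shrunk to be disjoint and to suit two maps at once. -/
theorem integral_comp_mul_det_of_regular [MeasurableSpace E] [BorelSpace E] (μ : Measure E)
    [μ.IsAddHaarMeasure] {g : E → E} (hg : ContDiff ℝ 2 g) {z : E}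
    (hz : (fderiv ℝ g z).det ≠ 0) :
    ∃ V ∈ 𝓝 z, ∀ U : Set E, IsOpen U → z ∈ U → U ⊆ V → ∃ r > 0, ∀ h : E → ℝ,
      Function.support h ⊆ Metric.ball (g z) r →
        ∫ x in U, h (g x) * (fderiv ℝ g x).det ∂μ =
          (SignType.sign (fderiv ℝ g z).det : ℝ) * ∫ x, h x ∂μ := by
  obtain ⟨φ, hzφ, hφ⟩ := exists_openPartialHomeomorph_of_det_ne_zero (hg.contDiffAt (x := z)) hz
  have hdetc : Continuous fun x => (fderiv ℝ g x).det :=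
    ContinuousLinearMap.continuous_det.comp (hg.continuous_fderiv two_ne_zero)
  let S : Set E := {x | 0 < (fderiv ℝ g x).det * (fderiv ℝ g z).det}
  have hS : IsOpen S := isOpen_lt continuous_const (hdetc.mul continuous_const)
  have hzS : z ∈ S := by
    exact mul_self_pos.2 hz
  refine ⟨φ.source ∩ S, (φ.open_source.inter hS).mem_nhds ⟨hzφ, hzS⟩, ?_⟩
  intro U hU hzU hUV
  have hUs : U ⊆ φ.source := fun x hx => (hUV hx).1
  have himg : IsOpen (g '' U) := hφ ▸ φ.isOpen_image_of_subset_source hU hUs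
  obtain ⟨r, hr, hball⟩ := Metric.isOpen_iff.1 himg (g z) ⟨z, hzU, rfl⟩
  refine ⟨r, hr, fun h hh => ?_⟩
  have hinj : Set.InjOn g U := hφ ▸ φ.injOn.mono hUs
  have hcv := integral_image_eq_integral_abs_det_fderiv_smul μ hU.measurableSet
    (fun x _ => (hg.differentiable two_ne_zero x).hasFDerivAt.hasFDerivWithinAt) hinj h
  rw [setIntegral_eq_integral_of_forall_compl_eq_zero] at hcv
  · rw [hcv, ← integral_const_mul]
    refine setIntegral_congr_fun hU.measurableSet fun x hx => ?_
    have hxS : 0 < (fderiv ℝ g x).det * (fderiv ℝ g z).det := (hUV hx).2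
    have habs : (fderiv ℝ g x).det = (SignType.sign (fderiv ℝ g z).det : ℝ) * |(fderiv ℝ g x).det| := by
      rcases lt_or_gt_of_ne hz with h0 | h0
      · have : (fderiv ℝ g x).det < 0 := by
          by_contra! hc; nlinarith
        rw [sign_neg h0, abs_of_neg this]; simp
      · have : 0 < (fderiv ℝ g x).det := by
          by_contra! hc; nlinarith
        rw [sign_pos h0, abs_of_pos this]; simp
    simp only [smul_eq_mul]
    conv_lhs => rw [habs]
    ring
  · intro x hx
    by_contra hne
    exact hx (hball (hh hne))

theorem finite_of_isCompact_of_isolated {X : Type*} [TopologicalSpace X] {K S : Set X}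
    (hK : IsCompact K) (h : ∀ x ∈ K, ∃ U ∈ 𝓝 x, U ∩ S ⊆ {x}) : (K ∩ S).Finite := by
  choose! U hU hUS using h
  obtain ⟨t, htK, ht⟩ := hK.elim_nhds_subcover U hU
  refine t.finite_toSet.subset fun x hx => ?_
  obtain ⟨i, hi, hxi⟩ := Set.mem_iUnion₂.1 (ht hx.1)
  rw [show x = i from hUS i (htK i hi) ⟨hxi, hx.2⟩]
  exact hi

theorem finite_preimage_of_regular {g : E → E} (hg : ContDiff ℝ 2 g) {K : Set E} (hK : IsCompact K)
    {y : E} (hy : ∀ z ∈ K, g z = y → (fderiv ℝ g z).det ≠ 0) : (K ∩ g ⁻¹' {y}).Finite := by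
  refine finite_of_isCompact_of_isolated hK fun z hz => ?_
  by_cases hgz : g z = y
  · obtain ⟨φ, hzφ, rfl⟩ := exists_openPartialHomeomorph_of_det_ne_zero
      (hg.contDiffAt (x := z)) (hy z hz hgz)
    refine ⟨φ.source, φ.open_source.mem_nhds hzφ, fun x hx => ?_⟩
    exact φ.injOn hx.1 hzφ (hx.2.trans hgz.symm)
  · refine ⟨g ⁻¹' {y}ᶜ, (hg.continuous.isOpen_preimage _ isOpen_compl_singleton).mem_nhds hgz, ?_⟩
    rintro x ⟨hx, hx'⟩
    exact absurd hx' hx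

/-- The vanishing of the integral is stated for a displacement along a basis vector; this covers
every nonzero direction. -/
theorem exists_basis_apply_eq {v : E} (hv : v ≠ 0) :
    ∃ c : Module.Basis (Fin (Module.finrank ℝ E)) ℝ E, ∃ k, c k = v := by
  have hli : LinearIndepOn ℝ id ({v} : Set E) := LinearIndepOn.singleton hv
  let b := Module.Basis.extend hli
  have : Finite (hli.extend (Set.subset_univ _)) := Module.Finite.finite_basis b
  have : Fintype (hli.extend (Set.subset_univ _)) := Fintype.ofFinite _
  let e : hli.extend (Set.subset_univ _) ≃ Fin (Module.finrank ℝ E) :=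
    Fintype.equivFinOfCardEq (Module.finrank_eq_card_basis b).symm
  let i : hli.extend (Set.subset_univ _) := ⟨v, hli.subset_extend _ rfl⟩
  refine ⟨b.reindex e, e i, ?_⟩
  simp [b, i]

/-- The local count is unchanged by a compactly supported modification in a fixed direction. -/
theorem finsum_sign_det_eq_of_add_smul {g : E → E} {u : E → ℝ} (hg : ContDiff ℝ 2 g)
    (hu : ContDiff ℝ 2 u) (v y : E) {K : Set E} (hK : IsCompact K) (huK : tsupport u ⊆ K)
    (hy₀ : ∀ z ∈ K, g z = y → (fderiv ℝ g z).det ≠ 0)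
    (hy₁ : ∀ z ∈ K, g z + u z • v = y → (fderiv ℝ (fun x => g x + u x • v) z).det ≠ 0) :
    ∑ᶠ z ∈ K ∩ {z | g z = y}, (SignType.sign (fderiv ℝ g z).det : ℤ) =
      ∑ᶠ z ∈ K ∩ {z | g z + u z • v = y},
        (SignType.sign (fderiv ℝ (fun x => g x + u x • v) z).det : ℤ) := by
  classical
  rcases eq_or_ne v 0 with rfl | hv
  · simp only [smul_zero, add_zero]
  borelize E
  let μ : Measure E := Measure.addHaar
  set g₁ : E → E := fun x => g x + u x • v with hg₁def
  have hg₁ : ContDiff ℝ 2 g₁ := hg.add (hu.smul contDiff_const)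
  have huc : HasCompactSupport u := hK.of_isClosed_subset (isClosed_tsupport u) huK
  have hf₀ : (K ∩ {z | g z = y}).Finite := finite_preimage_of_regular hg hK hy₀
  have hf₁ : (K ∩ {z | g₁ z = y}).Finite := finite_preimage_of_regular hg₁ hK hy₁
  -- Both fibres are put into one finite set, so that the same disjoint neighbourhoods localise the
  -- integrals of both maps; a point outside one fibre contributes zero to that map's count.
  let Z : Finset E := hf₀.toFinset ∪ hf₁.toFinset
  have hZK : ∀ z ∈ Z, z ∈ K := by
    intro z hz
    rcases Finset.mem_union.1 hz with h | h
    · exact ((hf₀.mem_toFinset).1 h).1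
    · exact ((hf₁.mem_toFinset).1 h).1
  -- the contribution of one point
  have contrib : ∀ f : E → E, ContDiff ℝ 2 f → (∀ z ∈ K, f z = y → (fderiv ℝ f z).det ≠ 0) →
      ∀ z ∈ K, ∃ V ∈ 𝓝 z, ∀ U : Set E, IsOpen U → z ∈ U → U ⊆ V → ∃ r > 0, ∀ h : E → ℝ,
      Function.support h ⊆ Metric.ball y r →
        ∫ x in U, h (f x) * (fderiv ℝ f x).det ∂μ =
          (if f z = y then (SignType.sign (fderiv ℝ f z).det : ℝ) else 0) * ∫ x, h x ∂μ := by
    intro f hf hfy z hz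
    by_cases hfz : f z = y
    · simp only [if_pos hfz]
      subst hfz
      exact integral_comp_mul_det_of_regular μ hf (hfy z hz rfl)
    · simp only [if_neg hfz, zero_mul]
      have hd : 0 < dist (f z) y := dist_pos.2 hfz
      refine ⟨f ⁻¹' Metric.ball (f z) (dist (f z) y / 2), hf.continuous.continuousAt.preimage_mem_nhds
        (Metric.ball_mem_nhds _ (half_pos hd)), fun U hU _ hUV => ⟨dist (f z) y / 2, half_pos hd,
        fun h hh => ?_⟩⟩
      refine setIntegral_eq_zero_of_forall_eq_zero fun x hx => ?_
      have h1 : h (f x) = 0 := by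
        by_contra hne
        have h2 : dist (f x) y < dist (f z) y / 2 := hh hne
        have h3 : dist (f x) (f z) < dist (f z) y / 2 := hUV hx
        have := dist_triangle_left (f z) y (f x)
        linarith
      rw [h1, zero_mul]
  choose! V₀ hV₀ hV₀' using contrib g hg hy₀
  choose! V₁ hV₁ hV₁' using contrib g₁ hg₁ hy₁
  obtain ⟨D, hD, hdisj⟩ := (Z.finite_toSet).t2_separation
  let U : E → Set E := fun z => interior (V₀ z) ∩ interior (V₁ z) ∩ D z ∩ Metric.ball z 1
  have hUo : ∀ z, IsOpen (U z) := fun z =>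
    ((isOpen_interior.inter isOpen_interior).inter (hD z).2).inter Metric.isOpen_ball
  have hzU : ∀ z ∈ Z, z ∈ U z := fun z hz =>
    ⟨⟨⟨mem_interior_iff_mem_nhds.2 (hV₀ z (hZK z hz)), mem_interior_iff_mem_nhds.2 (hV₁ z (hZK z hz))⟩,
      (hD z).1⟩, Metric.mem_ball_self one_pos⟩
  have hU₀ : ∀ z, U z ⊆ V₀ z := fun z x hx => interior_subset hx.1.1.1
  have hU₁ : ∀ z, U z ⊆ V₁ z := fun z x hx => interior_subset hx.1.1.2
  have hUdisj : Set.PairwiseDisjoint (Z : Set E) U := fun a ha b hb hab =>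
    (hdisj ha hb hab).mono (fun x hx => hx.1.2) (fun x hx => hx.1.2)
  choose! r₀ hr₀ hr₀' using fun z (hz : z ∈ Z) => hV₀' z (hZK z hz) (U z) (hUo z) (hzU z hz) (hU₀ z)
  choose! r₁ hr₁ hr₁' using fun z (hz : z ∈ Z) => hV₁' z (hZK z hz) (U z) (hUo z) (hzU z hz) (hU₁ z)
  -- away from the points
  have away : ∀ f : E → E, Continuous f → (∀ z ∈ K, f z = y → z ∈ Z) →
      ∃ r > 0, ∀ x ∈ K, x ∉ ⋃ z ∈ Z, U z → r ≤ dist (f x) y := by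
    intro f hf hfZ
    have hC : IsCompact (K \ ⋃ z ∈ Z, U z) := hK.diff (isOpen_biUnion fun z _ => hUo z)
    rcases (K \ ⋃ z ∈ Z, U z).eq_empty_or_nonempty with he | hne
    · exact ⟨1, one_pos, fun x hx hx' => absurd (show x ∈ K \ ⋃ z ∈ Z, U z from ⟨hx, hx'⟩)
        (by simp [he])⟩
    · obtain ⟨x₀, hx₀, hmin⟩ := hC.exists_isMinOn hne (hf.dist continuous_const).continuousOn
      refine ⟨dist (f x₀) y, dist_pos.2 fun h => ?_, fun x hx hx' => hmin ⟨hx, hx'⟩⟩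
      have := hfZ x₀ hx₀.1 h
      exact hx₀.2 (Set.mem_biUnion this (hzU x₀ this))
  obtain ⟨s₀, hs₀, hs₀'⟩ := away g hg.continuous fun z hz h =>
    Finset.mem_union_left _ ((hf₀.mem_toFinset).2 ⟨hz, h⟩)
  obtain ⟨s₁, hs₁, hs₁'⟩ := away g₁ hg₁.continuous fun z hz h =>
    Finset.mem_union_right _ ((hf₁.mem_toFinset).2 ⟨hz, h⟩)
  obtain ⟨r, hr, hrs₀, hrs₁, hrr⟩ : ∃ r > 0, r ≤ s₀ ∧ r ≤ s₁ ∧ ∀ z ∈ Z, r ≤ r₀ z ∧ r ≤ r₁ z := by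
    have hev : ∀ᶠ r in 𝓝[>] (0 : ℝ), r ≤ s₀ ∧ r ≤ s₁ ∧ ∀ z ∈ Z, r ≤ r₀ z ∧ r ≤ r₁ z := by
      have hsm : ∀ s : ℝ, 0 < s → ∀ᶠ r in 𝓝[>] (0 : ℝ), r ≤ s := fun s hs =>
        nhdsWithin_le_nhds (ge_mem_nhds hs)
      refine (hsm _ hs₀).and ((hsm _ hs₁).and ?_)
      rw [Filter.eventually_all_finset]
      exact fun z hz => (hsm _ (hr₀ z hz)).and (hsm _ (hr₁ z hz))
    obtain ⟨r, hr1, hr2⟩ := (hev.and self_mem_nhdsWithin).exists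
    exact ⟨r, hr2, hr1⟩
  -- The test density is a derivative in the very direction `v` of the displacement. Its nonzero
  -- integral is the common factor that is cancelled at the end.
  obtain ⟨H, hH, hsupp, hH_int⟩ := exists_bump_directional_derivative μ hv y hr
  let h : E → ℝ := fun x => fderiv ℝ H x v
  have hhc : Continuous h := (hH.continuous_fderiv two_ne_zero).clm_apply continuous_const
  let q : (E → E) → E → ℝ := fun f x => h (f x) * (fderiv ℝ f x).det
  have hqc : ∀ f : E → E, ContDiff ℝ 2 f → Continuous (q f) := fun f hf =>
    (hhc.comp hf.continuous).mul
      (ContinuousLinearMap.continuous_det.comp (hf.continuous_fderiv two_ne_zero))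
  have htotal : ∫ x, (q g₁ x - q g x) ∂μ = 0 := by
    obtain ⟨c, hc⟩ : ∃ c : Module.Basis (Fin (Module.finrank ℝ E)) ℝ E, ∃ k, c k = v :=
      exists_basis_apply_eq hv
    obtain ⟨k, rfl⟩ := hc
    exact integral_fderiv_mul_det_sub_eq_zero μ c hg hu hH huc k
  have hO : MeasurableSet (⋃ z ∈ Z, U z) :=
    (isOpen_biUnion fun z _ => hUo z).measurableSet
  rw [← setIntegral_eq_integral_of_forall_compl_eq_zero (s := ⋃ z ∈ Z, U z)] at htotal
  · have hqi : ∀ f : E → E, ContDiff ℝ 2 f → ∀ z, IntegrableOn (q f) (U z) μ := fun f hf z =>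
      ((hqc f hf).continuousOn.integrableOn_compact (isCompact_closedBall z 1)).mono_set
        fun x hx => Metric.ball_subset_closedBall hx.2
    rw [integral_biUnion_finset (f := fun x => q g₁ x - q g x) Z
      (fun z _ => (hUo z).measurableSet) hUdisj
      (fun z _ => (hqi g₁ hg₁ z).sub (hqi g hg z))] at htotal
    have hterm : ∀ z ∈ Z, ∫ x in U z, (q g₁ x - q g x) ∂μ =
        ((if g₁ z = y then (SignType.sign (fderiv ℝ g₁ z).det : ℝ) else 0) -
        (if g z = y then (SignType.sign (fderiv ℝ g z).det : ℝ) else 0)) * ∫ x, h x ∂μ := by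
      intro z hz
      rw [integral_sub (hqi g₁ hg₁ z) (hqi g hg z), sub_mul]
      congr 1
      · exact hr₁' z hz h (hsupp.trans (Metric.ball_subset_ball (hrr z hz).2))
      · exact hr₀' z hz h (hsupp.trans (Metric.ball_subset_ball (hrr z hz).1))
    rw [Finset.sum_congr rfl hterm, ← Finset.sum_mul, mul_eq_zero, or_iff_left hH_int,
      Finset.sum_sub_distrib, sub_eq_zero] at htotal
    have hcount : ∀ (f : E → E), (∀ z ∈ K, f z = y → z ∈ Z) →
        ((∑ᶠ z ∈ K ∩ {z | f z = y}, (SignType.sign (fderiv ℝ f z).det : ℤ) : ℤ) : ℝ) =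
        ∑ z ∈ Z, (if f z = y then (SignType.sign (fderiv ℝ f z).det : ℝ) else 0) := by
      intro f hfZ
      have : K ∩ {z | f z = y} = ((Z.filter fun z => f z = y : Finset E) : Set E) := by
        ext z
        simp only [Set.mem_inter_iff, Set.mem_ofPred_eq, Finset.coe_filter]
        exact ⟨fun hz => ⟨hfZ z hz.1 hz.2, hz.2⟩, fun hz => ⟨hZK z hz.1, hz.2⟩⟩
      rw [this, finsum_mem_coe_finset, Finset.sum_filter]
      push_cast
      refine Finset.sum_congr rfl fun z _ => ?_
      split_ifs
      · rcases SignType.sign (fderiv ℝ f z).det <;> simp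
      · rfl
    have e₀ := hcount g fun z hz h' => Finset.mem_union_left _ ((hf₀.mem_toFinset).2 ⟨hz, h'⟩)
    have e₁ := hcount g₁ fun z hz h' => Finset.mem_union_right _ ((hf₁.mem_toFinset).2 ⟨hz, h'⟩)
    have := e₀.trans (htotal.symm.trans e₁.symm)
    exact_mod_cast this
  -- Outside the chosen neighbourhoods the integrand is zero: on `K` because both maps stay at
  -- distance at least `r` from `y`, off `K` because they agree near `x`.
  · intro x hx
    by_cases hxK : x ∈ K
    · have hv₀ : h (g x) = 0 := by
        by_contra hne
        have h2 : dist (g x) y < r := hsupp hne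
        linarith [hs₀' x hxK hx]
      have hv₁ : h (g₁ x) = 0 := by
        by_contra hne
        have h2 : dist (g₁ x) y < r := hsupp hne
        linarith [hs₁' x hxK hx]
      simp [q, hv₀, hv₁]
    · have hnear : g₁ =ᶠ[𝓝 x] g := by
        have : u =ᶠ[𝓝 x] 0 := notMem_tsupport_iff_eventuallyEq.1 fun h' => hxK (huK h')
        filter_upwards [this] with a ha
        simp [hg₁def, ha]
      simp only [q, hnear.fderiv_eq, hnear.eq_of_nhds, sub_self]

end LocalDegree

end AffineWinding

end

noncomputable section

namespace AffineWinding

/-! ### Positive frames and determinants -/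

section Frames

variable {n : ℕ} {V U : Type*} [AddCommGroup V] [Module ℝ V] [AddCommGroup U] [Module ℝ U]

/-- The linear map `A` together with the vector `v` takes positive frames to positive frames. -/
def FramePositive (oV : Orientation ℝ V (Fin n)) (oU : Orientation ℝ U (Fin (n + 1)))
    (A : V →ₗ[ℝ] U) (v : U) : Prop :=
  ∃ (b : Module.Basis (Fin n) ℝ V) (c : Module.Basis (Fin (n + 1)) ℝ U),
    b.orientation = oV ∧ c.orientation = oU ∧ (∀ i : Fin n, c i.castSucc = A (b i)) ∧
      c (Fin.last n) = v

/-- The determinant of a frame as an alternating function of all vectors but the last. -/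
def detSnoc (c : Module.Basis (Fin (n + 1)) ℝ U) (A : V →ₗ[ℝ] U) (v : U) : V [⋀^Fin n]→ₗ[ℝ] ℝ where
  toFun m := c.det (Fin.snoc (α := fun _ => U) (fun i => A (m i)) v)
  map_update_add' {inst} m i x y := by
    have h : ∀ w, (fun j => A (Function.update m i w j)) =
        Function.update (fun j => A (m j)) i (A w) := by
      intro w; funext j; by_cases hj : j = i
      · subst hj; simp
      · simp [hj]
    have hi : inst = instDecidableEqFin n := Subsingleton.elim _ _
    subst hi
    simp only [h, map_add, Fin.snoc_update, AlternatingMap.map_update_add]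
  map_update_smul' {inst} m i r x := by
    have h : ∀ w, (fun j => A (Function.update m i w j)) =
        Function.update (fun j => A (m j)) i (A w) := by
      intro w; funext j; by_cases hj : j = i
      · subst hj; simp
      · simp [hj]
    have hi : inst = instDecidableEqFin n := Subsingleton.elim _ _
    subst hi
    simp only [h, map_smul, Fin.snoc_update, AlternatingMap.map_update_smul]
  map_eq_zero_of_eq' m i j hij hne := by
    refine c.det.map_eq_zero_of_eq _ (i := i.castSucc) (j := j.castSucc) ?_ (by simpa using hne)
    simp [hij]

theorem detSnoc_apply (c : Module.Basis (Fin (n + 1)) ℝ U) (A : V →ₗ[ℝ] U) (v : U) (m : Fin n → V) :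
    detSnoc c A v m = c.det (Fin.snoc (α := fun _ => U) (fun i => A (m i)) v) := rfl

/-- `detSnoc` is an alternating form of top degree in the first `n` vectors, so its values on two
bases differ by the factor `b.det b'`, positive for equally oriented bases. Hence the existential
over frames can be tested on one basis. Conversely, a nonzero determinant makes the family a basis.
-/
theorem framePositive_iff (b : Module.Basis (Fin n) ℝ V) (c : Module.Basis (Fin (n + 1)) ℝ U)
    (A : V →ₗ[ℝ] U) (v : U) :
    FramePositive b.orientation c.orientation A v ↔ 0 < detSnoc c A v b := by
  constructor
  · rintro ⟨b', c', hb, hc, hA, hv⟩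
    have h1 : 0 < c.det c' := (c.orientation_eq_iff_det_pos c').1 hc.symm
    have h2 : (c' : Fin (n + 1) → U) = Fin.snoc (α := fun _ => U) (fun i => A (b' i)) v := by
      funext i
      refine Fin.lastCases ?_ (fun i => ?_) i
      · simp [hv]
      · simp [hA]
    rw [h2, ← detSnoc_apply] at h1
    have h3 : 0 < b.det b' := (b.orientation_eq_iff_det_pos b').1 hb.symm
    have h4 := congrArg (fun f => f b') (AlternatingMap.eq_smul_basis_det b (detSnoc c A v))
    simp only [AlternatingMap.smul_apply, smul_eq_mul] at h4
    rw [h4] at h1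
    exact pos_of_mul_pos_left h1 h3.le
  · intro h
    have hu : IsUnit (c.det (Fin.snoc (α := fun _ => U) (fun i => A (b i)) v)) :=
      (ne_of_gt (by rwa [detSnoc_apply] at h)).isUnit
    obtain ⟨hli, hsp⟩ := c.is_basis_iff_det.2 hu
    refine ⟨b, Module.Basis.mk hli hsp.ge, rfl, ?_, ?_, ?_⟩
    · symm
      rw [c.orientation_eq_iff_det_pos, Module.Basis.coe_mk]
      rwa [detSnoc_apply] at h
    · intro i
      simp
    · simp

theorem framePositive_smul {oV : Orientation ℝ V (Fin n)} {oU : Orientation ℝ U (Fin (n + 1))}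
    {A : V →ₗ[ℝ] U} {v : U} {r : ℝ} (hr : 0 < r) (h : FramePositive oV oU A v) :
    FramePositive oV oU A (r • v) := by
  have h0 := h
  obtain ⟨b, c, rfl, rfl, -, -⟩ := h
  rw [framePositive_iff] at h0 ⊢
  have : detSnoc c A (r • v) b = r * detSnoc c A v b := by
    rw [detSnoc_apply, detSnoc_apply]
    have hs : ∀ w, Fin.snoc (α := fun _ => U) (fun i => A (b i)) w =
        Function.update (Fin.snoc (α := fun _ => U) (fun i => A (b i)) v) (Fin.last n) w := by
      intro w; rw [Fin.update_snoc_last]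
    rw [hs (r • v), AlternatingMap.map_update_smul, ← hs v, smul_eq_mul]
  rw [this]
  positivity

theorem framePositive_smul_iff {oV : Orientation ℝ V (Fin n)} {oU : Orientation ℝ U (Fin (n + 1))}
    {A : V →ₗ[ℝ] U} {v : U} {r : ℝ} (hr : 0 < r) :
    FramePositive oV oU A (r • v) ↔ FramePositive oV oU A v := by
  refine ⟨fun h => ?_, framePositive_smul hr⟩
  have := framePositive_smul (inv_pos.2 hr) h
  rwa [smul_smul, inv_mul_cancel₀ hr.ne', one_smul] at this

/-- Reversing the last vector of a frame changes its sign. -/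
theorem framePositive_neg_iff (hn : 1 ≤ n) [FiniteDimensional ℝ V] [FiniteDimensional ℝ U]
    (hV : Module.finrank ℝ V = n) (hU : Module.finrank ℝ U = n + 1)
    {oV : Orientation ℝ V (Fin n)} {oU : Orientation ℝ U (Fin (n + 1))}
    {A : V →ₗ[ℝ] U} {v : U} (hs : Submodule.span ℝ {v} ⊔ A.range = ⊤) :
    FramePositive oV oU A (-v) ↔ ¬ FramePositive oV oU A v := by
  -- Positive dimension matters: on a zero-dimensional space the negative orientation is not the
  -- orientation of any basis.
  have : Nonempty (Fin n) := ⟨⟨0, hn⟩⟩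
  obtain ⟨b, rfl⟩ : ∃ b : Module.Basis (Fin n) ℝ V, b.orientation = oV :=
    ⟨oV.someBasis (by simp [hV]), oV.someBasis_orientation _⟩
  obtain ⟨c, rfl⟩ : ∃ c : Module.Basis (Fin (n + 1)) ℝ U, c.orientation = oU :=
    ⟨oU.someBasis (by simp [hU]), oU.someBasis_orientation _⟩
  rw [framePositive_iff, framePositive_iff]
  have hneg : detSnoc c A (-v) b = - detSnoc c A v b := by
    rw [detSnoc_apply, detSnoc_apply]
    have hs : ∀ w, Fin.snoc (α := fun _ => U) (fun i => A (b i)) w =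
        Function.update (Fin.snoc (α := fun _ => U) (fun i => A (b i)) v) (Fin.last n) w := by
      intro w; rw [Fin.update_snoc_last]
    rw [hs (-v), AlternatingMap.map_update_neg, ← hs v]
  have hne : detSnoc c A v b ≠ 0 := by
    rw [detSnoc_apply]
    refine IsUnit.ne_zero (c.is_basis_iff_det.1 ?_)
    have hspan : Submodule.span ℝ (Set.range (Fin.snoc (α := fun _ => U) (fun i => A (b i)) v)) = ⊤ := by
      rw [eq_top_iff, ← hs]
      refine sup_le ?_ ?_
      · rw [Submodule.span_singleton_le_iff_mem]
        exact Submodule.subset_span ⟨Fin.last n, by simp⟩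
      · rw [LinearMap.range_eq_map, ← b.span_eq, Submodule.map_span, Submodule.span_le]
        rintro _ ⟨_, ⟨i, rfl⟩, rfl⟩
        exact Submodule.subset_span ⟨i.castSucc, by simp⟩
    exact ⟨linearIndependent_of_top_le_span_of_card_eq_finrank hspan.ge (by simp [hU]), hspan⟩
  rw [hneg]
  constructor
  · intro h; linarith
  · intro h
    have : detSnoc c A v b < 0 := lt_of_le_of_ne (not_lt.1 h) hne
    linarith

end Frames

/-! ### Oriented charts of the target and the vector field on the circle -/

section OrientedCharts

variable {d : ℕ} {H : Type*} [TopologicalSpace H]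
  {I : ModelWithCorners ℝ (EuclideanSpace ℝ (Fin d)) H}
  {M : Type*} [TopologicalSpace M] [ChartedSpace H M] [IsManifold I ∞ M]

/-- In the chart at `p`, the frame `c` is positive at all points of the open set `V`. -/
structure IsOrientedNhd (oM : MfdOrientation I M) (p : M) (V : Set M)
    (c : Module.Basis (Fin d) ℝ (EuclideanSpace ℝ (Fin d))) : Prop where
  isOpen : IsOpen V
  subset_source : V ⊆ (chartAt H p).source
  frame : ∀ y ∈ V, ∃ b : Module.Basis (Fin d) ℝ (TangentSpace I y), b.orientation = oM.orient y ∧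
    ∀ i, mfderiv I 𝓘(ℝ, EuclideanSpace ℝ (Fin d)) (extChartAt I p) y (b i) = c i

/-- Read in the trivialization at `p` the orientation is constant near `p`; a fixed positive basis
`c` of the model space pulls back to positive bases, since the trivialization at `y` is the
derivative of the chart at `p`. -/
theorem exists_isOrientedNhd (hd : 1 ≤ d) (oM : MfdOrientation I M) (p : M) :
    ∃ V c, IsOrientedNhd oM p V c ∧ p ∈ V := by
  have : IsManifold I 1 M := IsManifold.of_le (m := 1) (n := ∞) (by norm_num)
  have : Nonempty (Fin d) := ⟨⟨0, hd⟩⟩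
  obtain ⟨o, ho⟩ := oM.locally_constant p
  obtain ⟨V, hV, hVo, hpV⟩ := eventually_nhds_iff.1 ho
  let c := o.someBasis (by simp)
  refine ⟨V ∩ (chartAt H p).source, c, ⟨hVo.inter (chartAt H p).open_source,
    Set.inter_subset_right, fun y hy => ?_⟩, hpV, mem_chart_source H p⟩
  have hyb : y ∈ (trivializationAt (EuclideanSpace ℝ (Fin d)) (TangentSpace I) p).baseSet := by
    rw [TangentBundle.trivializationAt_baseSet]; exact hy.2
  have hmap := hV y hy.1 hyb
  set T := (trivializationAt (EuclideanSpace ℝ (Fin d)) (TangentSpace I) p).continuousLinearEquivAt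
    ℝ y hyb with hT
  refine ⟨c.map T.toLinearEquiv.symm, ?_, fun i => ?_⟩
  · rw [Module.Basis.orientation_map, Orientation.someBasis_orientation, ← hmap,
      ← Orientation.map_symm]
    exact Equiv.symm_apply_apply _ _
  · have h1 := DFunLike.congr_fun (TangentBundle.continuousLinearMapAt_trivializationAt
      (I := I) hy.2) (c.map T.toLinearEquiv.symm i)
    have h2 := congrFun (Bundle.Trivialization.coe_continuousLinearEquivAt_eq (R := ℝ) _ hyb)
      (c.map T.toLinearEquiv.symm i)
    refine h1.symm.trans (h2.symm.trans ?_)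
    rw [Module.Basis.map_apply]
    exact T.apply_symm_apply (c i)

end OrientedCharts

section CircleVector

/-- The definition uses the principal argument, which jumps at `-1`; periodicity of `Circle.exp`
shows that any other lift of the point gives the same vector. -/
theorem circleUnitVector_exp (t : ℝ) :
    circleUnitVector (Circle.exp t) = mfderiv 𝓘(ℝ, ℝ) (𝓡 1) Circle.exp t (1 : ℝ) := by
  obtain ⟨m, hm⟩ := Circle.exp_eq_exp.1 (Circle.exp_arg (Circle.exp t))
  unfold circleUnitVector
  rw [hm]
  have hper : Circle.exp ∘ (fun x : ℝ => x + m * (2 * Real.pi)) = Circle.exp := by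
    funext x
    exact Circle.exp_eq_exp.2 ⟨m, rfl⟩
  have hd : ∀ x, MDifferentiableAt 𝓘(ℝ, ℝ) (𝓡 1) Circle.exp x := fun x =>
    (contMDiff_circleExp (m := 1)).mdifferentiableAt one_ne_zero
  have hadd : HasMFDerivAt 𝓘(ℝ, ℝ) 𝓘(ℝ, ℝ) (fun x : ℝ => x + m * (2 * Real.pi)) t
      (ContinuousLinearMap.id ℝ ℝ) :=
    ((hasFDerivAt_id t).add_const (m * (2 * Real.pi))).hasMFDerivAt
  have h1 := ((hd (t + m * (2 * Real.pi))).hasMFDerivAt).comp t hadd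
  have h2 : mfderiv 𝓘(ℝ, ℝ) (𝓡 1) (Circle.exp ∘ (fun x : ℝ => x + m * (2 * Real.pi))) t (1 : ℝ) =
    mfderiv 𝓘(ℝ, ℝ) (𝓡 1) Circle.exp (t + m * (2 * Real.pi)) (1 : ℝ) := by
    rw [h1.mfderiv]; rfl
  have h3 := congrArg (fun f : ℝ → Circle =>
    (mfderiv 𝓘(ℝ, ℝ) (𝓡 1) f t (1 : ℝ) : EuclideanSpace ℝ (Fin 1))) hper
  exact h2.symm.trans h3

/-- In `ℂ` the vector becomes the derivative of `exp (i t)`, that is `i * exp (i t)`. -/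
theorem circleUnitVector_ne_zero (s : Circle) : circleUnitVector s ≠ 0 := by
  intro h
  unfold circleUnitVector at h
  set t := Complex.arg (s : ℂ)
  have hd : MDifferentiableAt 𝓘(ℝ, ℝ) (𝓡 1) Circle.exp t :=
    (contMDiff_circleExp (m := 1)).mdifferentiableAt one_ne_zero
  have : Fact (Module.finrank ℝ ℂ = 1 + 1) := finrank_real_complex_fact'
  have hc : MDifferentiableAt (𝓡 1) 𝓘(ℝ, ℂ) (fun z : Circle => (z : ℂ)) (Circle.exp t) :=
    (contMDiff_coe_sphere (E := ℂ) (n := 1) (m := 1)).mdifferentiableAt one_ne_zero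
  have h1 := hc.hasMFDerivAt.comp t hd.hasMFDerivAt
  obtain ⟨A, hA, hA1⟩ : ∃ A : ℝ →L[ℝ] ℂ, HasFDerivAt (fun x : ℝ => (Circle.exp x : ℂ)) A t ∧
      A 1 = 0 :=
    ⟨_, h1.hasFDerivAt, (congrArg (mfderiv (𝓡 1) 𝓘(ℝ, ℂ) (fun z : Circle => (z : ℂ))
      (Circle.exp t)) h).trans (map_zero _)⟩
  have h3 : HasDerivAt (fun x : ℝ => (Circle.exp x : ℂ)) 0 t := hA1 ▸ hA.hasDerivAt
  have h4 : HasDerivAt (fun x : ℝ => (Circle.exp x : ℂ)) (Complex.exp (t * Complex.I) * (1 * Complex.I)) t := by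
    simp only [Circle.coe_exp]
    exact ((Complex.ofRealCLM.hasDerivAt (x := t)).mul_const Complex.I).cexp
  have := h3.unique h4
  simp [Complex.exp_ne_zero] at this

end CircleVector

end AffineWinding

end

noncomputable section

namespace AffineWinding

/-! ### Orientation read off from a Jacobian determinant in coordinates -/

section FrameTransfer

variable {n : ℕ} {V T U E : Type*} [AddCommGroup V] [Module ℝ V] [AddCommGroup T] [Module ℝ T]
  [AddCommGroup U] [Module ℝ U] [AddCommGroup E] [Module ℝ E]

theorem bijective_of_basis_apply_eq {ι : Type*} {f : U →ₗ[ℝ] E} (c' : Module.Basis ι ℝ U)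
    (c : Module.Basis ι ℝ E) (h : ∀ i, f (c' i) = c i) : Function.Bijective f := by
  have : f = (c'.equiv c (Equiv.refl ι)).toLinearMap := c'.ext fun i => by simp [h]
  rw [this]
  exact (c'.equiv c (Equiv.refl ι)).bijective

/-- The form `c.det` pulls back along `dψ` to `c'.det`, both being 1 on `c'`; evaluating it on the
image of `B` extracts the determinant of the composite. So the sign of a point is that of the
coordinate Jacobian times the fixed number `c.det B`. -/
theorem detSnoc_eq_det_mul (B : Module.Basis (Fin (n + 1)) ℝ E) (c : Module.Basis (Fin (n + 1)) ℝ E)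
    (b : Module.Basis (Fin n) ℝ V) (c' : Module.Basis (Fin (n + 1)) ℝ U) (τ : T)
    (de : E →ₗ[ℝ] V × T) (dG : V × T →ₗ[ℝ] U) (dψ : U →ₗ[ℝ] E)
    (hB : ∀ i : Fin n, de (B i.castSucc) = (b i, 0)) (hτ : de (B (Fin.last n)) = (0, τ))
    (hc : ∀ i, dψ (c' i) = c i) :
    detSnoc c' (dG ∘ₗ LinearMap.inl ℝ V T) (dG (0, τ)) b =
      LinearMap.det (dψ ∘ₗ dG ∘ₗ de) * c.det B := by
  have h1 : c.det.compLinearMap dψ = c'.det := by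
    rw [AlternatingMap.eq_smul_basis_det c' (c.det.compLinearMap dψ)]
    have : (c.det.compLinearMap dψ) c' = 1 := by
      rw [AlternatingMap.compLinearMap_apply]
      have : (fun i => dψ (c' i)) = c := funext hc
      rw [this, c.det_self]
    rw [this, one_smul]
  rw [detSnoc_apply, ← h1, AlternatingMap.compLinearMap_apply, ← Module.Basis.det_comp]
  congr 1
  funext i
  refine Fin.lastCases ?_ (fun i => ?_) i
  · simp [hτ]
  · simp [hB]

theorem surjective_iff_det_ne_zero [FiniteDimensional ℝ E]
    {X : Type*} [AddCommGroup X] [Module ℝ X]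
    {de : E →ₗ[ℝ] X} {dG : X →ₗ[ℝ] U} {dψ : U →ₗ[ℝ] E}
    (hde : Function.Bijective de) (hdψ : Function.Bijective dψ) :
    Function.Surjective dG ↔ LinearMap.det (dψ ∘ₗ dG ∘ₗ de) ≠ 0 := by
  have h1 : LinearMap.det (dψ ∘ₗ dG ∘ₗ de) ≠ 0 ↔ Function.Surjective (dψ ∘ₗ dG ∘ₗ de) := by
    rw [← isUnit_iff_ne_zero, ← LinearMap.isUnit_iff_isUnit_det, LinearMap.isUnit_iff_range_eq_top,
      LinearMap.range_eq_top]
  rw [h1]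
  constructor
  · intro h
    exact hdψ.surjective.comp (h.comp hde.surjective)
  · intro h u
    obtain ⟨w, hw⟩ := h (dψ u)
    exact ⟨de w, hdψ.injective hw⟩

/-- The range contains `V × 0` and the vector `(0, τ)`, which spans the one-dimensional second
factor; equality of dimensions gives injectivity. -/
theorem bijective_of_frame [FiniteDimensional ℝ E] [FiniteDimensional ℝ V] [FiniteDimensional ℝ T]
    (hT : Module.finrank ℝ T = 1)
    (B : Module.Basis (Fin (n + 1)) ℝ E) (b : Module.Basis (Fin n) ℝ V) {τ : T} (hτ0 : τ ≠ 0)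
    {de : E →ₗ[ℝ] V × T} (hB : ∀ i : Fin n, de (B i.castSucc) = (b i, 0))
    (hτ : de (B (Fin.last n)) = (0, τ)) : Function.Bijective de := by
  have hdim : Module.finrank ℝ E = Module.finrank ℝ (V × T) := by
    rw [Module.finrank_prod, hT, Module.finrank_eq_card_basis B, Module.finrank_eq_card_basis b]
    simp
  have hsurj : Function.Surjective de := by
    rw [← LinearMap.range_eq_top, eq_top_iff]
    rintro ⟨v, t⟩ -
    obtain ⟨r, rfl⟩ := exists_smul_eq_of_finrank_eq_one hT hτ0 t
    have h1 : (v, r • τ) = (LinearMap.inl ℝ V T) v + r • ((0 : V), τ) := by simp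
    rw [h1]
    refine Submodule.add_mem _ ?_ (Submodule.smul_mem _ _ ⟨_, hτ⟩)
    have h2 : Submodule.map (LinearMap.inl ℝ V T) ⊤ ≤ LinearMap.range de := by
      rw [← b.span_eq, Submodule.map_span, Submodule.span_le]
      rintro _ ⟨_, ⟨i, rfl⟩, rfl⟩
      exact ⟨_, hB i⟩
    exact h2 ⟨v, trivial, rfl⟩
  exact ⟨(LinearMap.injective_iff_surjective_of_finrank_eq_finrank hdim).2 hsurj, hsurj⟩

end FrameTransfer

section Param

variable {n : ℕ} {N : Type*} [TopologicalSpace N] [ChartedSpace (EuclideanSpace ℝ (Fin n)) N]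
  [IsManifold (𝓡 n) ∞ N]
  {H : Type*} [TopologicalSpace H] {I : ModelWithCorners ℝ (EuclideanSpace ℝ (Fin (n + 1))) H}
  {M : Type*} [TopologicalSpace M] [ChartedSpace H M] [IsManifold I ∞ M]

/-- A smooth parametrization of an open subset of `N × S¹` which takes a constant frame to
positive product frames. -/
structure IsOrientedParam (oN : MfdOrientation (𝓡 n) N)
    (e : OpenPartialHomeomorph (EuclideanSpace ℝ (Fin (n + 1))) (N × Circle))
    (B : Module.Basis (Fin (n + 1)) ℝ (EuclideanSpace ℝ (Fin (n + 1)))) : Prop where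
  smooth : ContMDiffOn (𝓡 (n + 1)) ((𝓡 n).prod (𝓡 1)) ∞ e e.source
  frame : ∀ w ∈ e.source, ∃ b : Module.Basis (Fin n) ℝ (TangentSpace (𝓡 n) (e w).1),
    b.orientation = oN.orient (e w).1 ∧
    (∀ i : Fin n, mfderiv (𝓡 (n + 1)) ((𝓡 n).prod (𝓡 1)) e w (B i.castSucc) = (b i, 0)) ∧
    mfderiv (𝓡 (n + 1)) ((𝓡 n).prod (𝓡 1)) e w (B (Fin.last n)) = (0, circleUnitVector (e w).2)

theorem mfderiv_chart_symm_apply {x y : N} (hy : y ∈ (chartAt (EuclideanSpace ℝ (Fin n)) x).source)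
    (u : TangentSpace (𝓡 n) y) :
    mfderiv (𝓡 n) (𝓡 n) (chartAt (EuclideanSpace ℝ (Fin n)) x).symm
      (chartAt (EuclideanSpace ℝ (Fin n)) x y)
      (mfderiv (𝓡 n) (𝓡 n) (extChartAt (𝓡 n) x) y u) = u := by
  have : IsManifold (𝓡 n) 1 N := IsManifold.of_le (m := 1) (n := ∞) (by norm_num)
  have h := DFunLike.congr_fun (mfderivWithin_extChartAt_symm_comp_mfderiv_extChartAt'
    (I := 𝓡 n) (x := x) (y := y) (by rwa [extChartAt_source])) u
  refine Eq.trans ?_ h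
  rw [show Set.range (𝓡 n) = Set.univ from Set.range_id, mfderivWithin_univ]
  rfl

/-- The inverse of an oriented chart of `N` times a local branch of `Circle.exp`, after a linear
identification of `ℝⁿ⁺¹` with `ℝⁿ × ℝ`. The constant frame `(b₀ i, 0)`, `(0, 1)` is carried to
positive product frames. -/
theorem exists_isOrientedParam (hn : 1 ≤ n) (oN : MfdOrientation (𝓡 n) N) (z : N × Circle) :
    ∃ e B, IsOrientedParam oN e B ∧ z ∈ e.target := by
  obtain ⟨V, b₀, hV, hzV⟩ := exists_isOrientedNhd hn oN z.1
  obtain ⟨ε, hε, hεexp⟩ := isLocalHomeomorph_circleExp (Complex.arg (z.2 : ℂ))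
  let L : EuclideanSpace ℝ (Fin (n + 1)) ≃L[ℝ] EuclideanSpace ℝ (Fin n) × ℝ :=
    ContinuousLinearEquiv.ofFinrankEq (by simp)
  let φ := chartAt (EuclideanSpace ℝ (Fin n)) z.1
  let φV := φ.restrOpen V hV.isOpen
  let e : OpenPartialHomeomorph (EuclideanSpace ℝ (Fin (n + 1))) (N × Circle) :=
    L.toHomeomorph.toOpenPartialHomeomorph.trans (φV.symm.prod ε)
  let L₁ : EuclideanSpace ℝ (Fin (n + 1)) →L[ℝ] EuclideanSpace ℝ (Fin n) :=
    (ContinuousLinearMap.fst ℝ _ ℝ).comp (L : _ →L[ℝ] _)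
  let L₂ : EuclideanSpace ℝ (Fin (n + 1)) →L[ℝ] ℝ :=
    (ContinuousLinearMap.snd ℝ (EuclideanSpace ℝ (Fin n)) ℝ).comp (L : _ →L[ℝ] _)
  have he : (e : EuclideanSpace ℝ (Fin (n + 1)) → N × Circle) =
      fun w => (φ.symm (L₁ w), Circle.exp (L₂ w)) := by
    rw [hεexp]; rfl
  have hsource : ∀ w ∈ e.source, (L w).1 ∈ φ.target ∧ φ.symm (L w).1 ∈ V := by
    intro w hw
    have h1 : (L w).1 ∈ φV.target := by
      simp only [e, OpenPartialHomeomorph.trans_source, OpenPartialHomeomorph.prod_source] at hw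
      exact hw.2.1
    have h2 := φV.map_target h1
    simp only [φV, OpenPartialHomeomorph.restrOpen_source] at h2
    refine ⟨?_, h2.2⟩
    have h3 := φ.map_source h2.1
    have h4 : φ (φV.symm (L w).1) = (L w).1 := φV.right_inv h1
    rwa [h4] at h3
  let v : Fin (n + 1) → EuclideanSpace ℝ (Fin n) × ℝ :=
    Fin.snoc (α := fun _ => EuclideanSpace ℝ (Fin n) × ℝ) (fun i => (b₀ i, 0)) (0, 1)
  have hvspan : ⊤ ≤ Submodule.span ℝ (Set.range v) := by
    rintro ⟨x, t⟩ -
    have h1 : (x, t) = (LinearMap.inl ℝ _ ℝ) x + t • ((0 : EuclideanSpace ℝ (Fin n)), (1 : ℝ)) := by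
      simp
    rw [h1]
    refine Submodule.add_mem _ ?_ (Submodule.smul_mem _ _ (Submodule.subset_span
      ⟨Fin.last n, by simp [v]⟩))
    have h2 : Submodule.map (LinearMap.inl ℝ (EuclideanSpace ℝ (Fin n)) ℝ) ⊤ ≤
        Submodule.span ℝ (Set.range v) := by
      rw [← b₀.span_eq, Submodule.map_span, Submodule.span_le]
      rintro _ ⟨_, ⟨i, rfl⟩, rfl⟩
      exact Submodule.subset_span ⟨i.castSucc, by simp [v]⟩
    exact h2 ⟨x, trivial, rfl⟩
  have hvli : LinearIndependent ℝ v :=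
    linearIndependent_of_top_le_span_of_card_eq_finrank hvspan (by simp)
  let B := (Module.Basis.mk hvli hvspan).map L.toLinearEquiv.symm
  have hLB : ∀ i, L (B i) = v i := by
    intro i
    simp [B]
  refine ⟨e, B, ⟨?_, fun w hw => ?_⟩, ?_⟩
  · rw [he]
    refine ContMDiffOn.prodMk ?_ ?_
    · exact (contMDiffOn_chart_symm (I := 𝓡 n)).comp L₁.contDiff.contMDiff.contMDiffOn
        fun w hw => (hsource w hw).1
    · exact (contMDiff_circleExp.comp L₂.contDiff.contMDiff).contMDiffOn
  · obtain ⟨hw1, hw2⟩ := hsource w hw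
    have hew : e w = (φ.symm (L₁ w), Circle.exp (L₂ w)) := congrFun he w
    have d1 : HasMFDerivAt (𝓡 n) (𝓡 n) φ.symm (L₁ w) (mfderiv (𝓡 n) (𝓡 n) φ.symm (L₁ w)) :=
      (((contMDiffOn_chart_symm (I := 𝓡 n) (n := ∞) (x := z.1)).contMDiffAt
        (φ.open_target.mem_nhds hw1)).mdifferentiableAt (by simp)).hasMFDerivAt
    have d2 : HasMFDerivAt 𝓘(ℝ, ℝ) (𝓡 1) Circle.exp (L₂ w) (mfderiv 𝓘(ℝ, ℝ) (𝓡 1) Circle.exp (L₂ w)) :=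
      ((contMDiff_circleExp (m := 1)).mdifferentiableAt one_ne_zero).hasMFDerivAt
    have de := (d1.comp w (L₁.hasFDerivAt (x := w)).hasMFDerivAt).prodMk
      (d2.comp w (L₂.hasFDerivAt (x := w)).hasMFDerivAt)
    have hde : ∀ u, mfderiv (𝓡 (n + 1)) ((𝓡 n).prod (𝓡 1)) e w u =
        (mfderiv (𝓡 n) (𝓡 n) φ.symm (L₁ w) (L₁ u),
          mfderiv 𝓘(ℝ, ℝ) (𝓡 1) Circle.exp (L₂ w) (L₂ u)) := by
      intro u
      have h1 : HasMFDerivAt (𝓡 (n + 1)) ((𝓡 n).prod (𝓡 1)) e w _ := he ▸ de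
      rw [h1.mfderiv]
      rfl
    rw [hew]
    obtain ⟨b, hb, hbi⟩ := hV.frame _ hw2
    have hinv : ∀ i, mfderiv (𝓡 n) (𝓡 n) φ.symm (L₁ w) (b₀ i) = b i := by
      intro i
      have h1 := mfderiv_chart_symm_apply (hV.subset_source hw2) (b i)
      rw [hbi] at h1
      refine Eq.trans ?_ h1
      have h2 : L₁ w = φ (φ.symm (L₁ w)) := (φ.right_inv hw1).symm
      exact congrArg (fun a => (mfderiv (𝓡 n) (𝓡 n) φ.symm a :
        EuclideanSpace ℝ (Fin n) →L[ℝ] EuclideanSpace ℝ (Fin n)) (b₀ i)) h2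
    refine ⟨b, hb, fun i => ?_, ?_⟩
    · have h1 : L₁ (B i.castSucc) = b₀ i := by
        change (L (B i.castSucc)).1 = _
        rw [hLB]; simp [v]
      have h2 : L₂ (B i.castSucc) = 0 := by
        change (L (B i.castSucc)).2 = _
        rw [hLB]; simp [v]
      refine (hde _).trans ?_
      rw [h1, h2]
      exact Prod.ext (hinv i) (map_zero _)
    · have h1 : L₁ (B (Fin.last n)) = 0 := by
        change (L (B (Fin.last n))).1 = _
        rw [hLB]; simp [v]
      have h2 : L₂ (B (Fin.last n)) = 1 := by
        change (L (B (Fin.last n))).2 = _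
        rw [hLB]; simp [v]
      refine (hde _).trans ?_
      rw [h1, h2]
      exact Prod.ext (map_zero _) (circleUnitVector_exp (L₂ w)).symm
  · have hz : z = e (L.symm (φ z.1, Complex.arg (z.2 : ℂ))) := by
      rw [he]
      refine Prod.ext ?_ ?_
      · simp only [L₁, ContinuousLinearMap.comp_apply, ContinuousLinearEquiv.coe_coe,
          ContinuousLinearEquiv.apply_symm_apply, ContinuousLinearMap.coe_fst']
        exact (φ.left_inv (mem_chart_source _ z.1)).symm
      · simp [L₂]
    rw [hz]
    refine e.map_source ?_
    simp only [e, OpenPartialHomeomorph.trans_source, OpenPartialHomeomorph.prod_source]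
    refine ⟨trivial, ?_⟩
    change L (L.symm (φ z.1, Complex.arg (z.2 : ℂ))) ∈ φV.target ×ˢ ε.source
    rw [ContinuousLinearEquiv.apply_symm_apply]
    refine ⟨?_, hε⟩
    exact φV.map_source (show z.1 ∈ φV.source from ⟨mem_chart_source _ z.1, hzV⟩)

/-- The orientation behaviour of a map is read off from the Jacobian determinant in an oriented
parametrization and an oriented chart. -/
theorem preservesOrientationAt_iff_det {oN : MfdOrientation (𝓡 n) N} {oM : MfdOrientation I M}
    {e : OpenPartialHomeomorph (EuclideanSpace ℝ (Fin (n + 1))) (N × Circle)}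
    {B : Module.Basis (Fin (n + 1)) ℝ (EuclideanSpace ℝ (Fin (n + 1)))}
    (he : IsOrientedParam oN e B) {p : M} {V : Set M}
    {c : Module.Basis (Fin (n + 1)) ℝ (EuclideanSpace ℝ (Fin (n + 1)))}
    (hV : IsOrientedNhd oM p V c) (G : C^∞⟮(𝓡 n).prod (𝓡 1), N × Circle; I, M⟯)
    {w : EuclideanSpace ℝ (Fin (n + 1))} (hw : w ∈ e.source) (hG : G (e w) ∈ V) :
    (Function.Surjective (mfderiv ((𝓡 n).prod (𝓡 1)) I G (e w)) ↔
      (fderiv ℝ (fun w => extChartAt I p (G (e w))) w).det ≠ 0) ∧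
    (PreservesOrientationAt oN oM circleUnitVector G (e w) ↔
      0 < (fderiv ℝ (fun w => extChartAt I p (G (e w))) w).det * c.det B) := by
  obtain ⟨b, hb, hBb, hBτ⟩ := he.frame w hw
  obtain ⟨c', hc', hc'c⟩ := hV.frame _ hG
  have d1 : MDifferentiableAt (𝓡 (n + 1)) ((𝓡 n).prod (𝓡 1)) e w :=
    (he.smooth.contMDiffAt (e.open_source.mem_nhds hw)).mdifferentiableAt (by simp)
  have d2 : MDifferentiableAt ((𝓡 n).prod (𝓡 1)) I G (e w) :=
    G.contMDiff.mdifferentiableAt (by simp)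
  have d3 : MDifferentiableAt I (𝓡 (n + 1)) (extChartAt I p) (G (e w)) :=
    (contMDiffAt_extChartAt' (n := ∞) (hV.subset_source hG)).mdifferentiableAt (by simp)
  let de : EuclideanSpace ℝ (Fin (n + 1)) →L[ℝ] EuclideanSpace ℝ (Fin n) × EuclideanSpace ℝ (Fin 1) :=
    mfderiv (𝓡 (n + 1)) ((𝓡 n).prod (𝓡 1)) e w
  let dG : EuclideanSpace ℝ (Fin n) × EuclideanSpace ℝ (Fin 1) →L[ℝ] EuclideanSpace ℝ (Fin (n + 1)) :=
    mfderiv ((𝓡 n).prod (𝓡 1)) I G (e w)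
  let dψ : EuclideanSpace ℝ (Fin (n + 1)) →L[ℝ] EuclideanSpace ℝ (Fin (n + 1)) :=
    mfderiv I (𝓡 (n + 1)) (extChartAt I p) (G (e w))
  have hD : HasFDerivAt (fun w => extChartAt I p (G (e w))) (dψ.comp (dG.comp de)) w :=
    (d3.hasMFDerivAt.comp w (d2.hasMFDerivAt.comp w d1.hasMFDerivAt)).hasFDerivAt
  rw [hD.fderiv]
  let b' : Module.Basis (Fin n) ℝ (EuclideanSpace ℝ (Fin n)) := b
  let c'' : Module.Basis (Fin (n + 1)) ℝ (EuclideanSpace ℝ (Fin (n + 1))) := c'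
  let τ : EuclideanSpace ℝ (Fin 1) := circleUnitVector (e w).2
  have hτ0 : τ ≠ 0 := circleUnitVector_ne_zero (e w).2
  have hB' : ∀ i : Fin n, de.toLinearMap (B i.castSucc) = (b' i, 0) := hBb
  have hτ' : de.toLinearMap (B (Fin.last n)) = (0, τ) := hBτ
  have hc'' : ∀ i, dψ.toLinearMap (c'' i) = c i := hc'c
  have hde : Function.Bijective de.toLinearMap :=
    bijective_of_frame (by simp) B b' hτ0 hB' hτ'
  have hdψ : Function.Bijective dψ.toLinearMap := bijective_of_basis_apply_eq c'' c hc''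
  constructor
  · exact surjective_iff_det_ne_zero (dG := dG.toLinearMap) hde hdψ
  · have h1 := detSnoc_eq_det_mul B c b' c'' τ de.toLinearMap
      dG.toLinearMap dψ.toLinearMap hB' hτ' hc''
    have h2 := framePositive_iff b' c'' (dG.toLinearMap ∘ₗ LinearMap.inl ℝ _ _)
      (dG (0, τ))
    have h3 : PreservesOrientationAt oN oM circleUnitVector G (e w) ↔
        FramePositive b'.orientation c''.orientation
          (dG.toLinearMap ∘ₗ LinearMap.inl ℝ _ _)
          (dG (0, τ)) := by
      have e1 : b'.orientation = oN.orient (e w).1 := hb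
      have e2 : c''.orientation = oM.orient (G (e w)) := hc'
      rw [e1, e2]
      rfl
    rw [h3, h2]
    exact iff_of_eq (congrArg (fun r : ℝ => 0 < r) h1)

end Param

end AffineWinding

end

noncomputable section

namespace AffineWinding

/-! ### Local behaviour at regular points and density of regular values -/

section Chart

variable {E : Type*} [NormedAddCommGroup E] [NormedSpace ℝ E] {H : Type*} [TopologicalSpace H]
  {I : ModelWithCorners ℝ E H} {M : Type*} [TopologicalSpace M] [ChartedSpace H M]

/-- The range of the model lies in the closure of its interior. So even at a boundary point the
image of a neighbourhood contains a nonempty open set, which is too large to consist of critical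
values. -/
theorem interior_image_extChartAt_nonempty {p : M} {O : Set M} (hO : O ∈ 𝓝 p) :
    (interior (extChartAt I p '' O)).Nonempty := by
  have h1 : extChartAt I p '' O ∈ 𝓝[Set.range I] (extChartAt I p p) := by
    rw [← map_extChartAt_nhds]
    exact Filter.image_mem_map hO
  obtain ⟨u, hu, hpu, hsub⟩ := mem_nhdsWithin.1 h1
  have h2 : extChartAt I p p ∈ closure (interior (Set.range I)) :=
    I.range_subset_closure_interior (by simp)
  obtain ⟨x, hxu, hxi⟩ := mem_closure_iff.1 h2 u hu hpu
  refine ⟨x, mem_interior.2 ⟨u ∩ interior (Set.range I), fun a ha => hsub ⟨ha.1, interior_subset ha.2⟩,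
    hu.inter isOpen_interior, hxu, hxi⟩⟩

end Chart

section RegularValues

variable {n : ℕ} {N : Type*} [TopologicalSpace N] [ChartedSpace (EuclideanSpace ℝ (Fin n)) N]
  [IsManifold (𝓡 n) ∞ N]
  {H : Type*} [TopologicalSpace H] {I : ModelWithCorners ℝ (EuclideanSpace ℝ (Fin (n + 1))) H}
  {M : Type*} [TopologicalSpace M] [ChartedSpace H M] [IsManifold I ∞ M]
  {oN : MfdOrientation (𝓡 n) N} {oM : MfdOrientation I M}

theorem IsOrientedParam.contDiffAt
    {e : OpenPartialHomeomorph (EuclideanSpace ℝ (Fin (n + 1))) (N × Circle)}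
    {B : Module.Basis (Fin (n + 1)) ℝ (EuclideanSpace ℝ (Fin (n + 1)))}
    (he : IsOrientedParam oN e B) {p : M} (G : C^∞⟮(𝓡 n).prod (𝓡 1), N × Circle; I, M⟯)
    {w : EuclideanSpace ℝ (Fin (n + 1))} (hw : w ∈ e.source)
    (hG : G (e w) ∈ (chartAt H p).source) :
    ContDiffAt ℝ ∞ (fun w => extChartAt I p (G (e w))) w := by
  rw [← contMDiffAt_iff_contDiffAt]
  have h1 : ContMDiffAt (𝓡 (n + 1)) ((𝓡 n).prod (𝓡 1)) ∞ e w :=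
    he.smooth.contMDiffAt (e.open_source.mem_nhds hw)
  have h2 : ContMDiffAt (𝓡 (n + 1)) I ∞ (fun w => G (e w)) w := G.contMDiff.contMDiffAt.comp w h1
  exact (contMDiffAt_extChartAt' (I := I) (n := ∞) hG).comp w h2

theorem pointSign_eq_of_iff {G G' : C^∞⟮(𝓡 n).prod (𝓡 1), N × Circle; I, M⟯} {z z' : N × Circle}
    (h : PreservesOrientationAt oN oM circleUnitVector G z ↔
      PreservesOrientationAt oN oM circleUnitVector G' z') :
    pointSign oN oM circleUnitVector G z = pointSign oN oM circleUnitVector G' z' := by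
  unfold pointSign
  by_cases h0 : PreservesOrientationAt oN oM circleUnitVector G z
  · rw [if_pos h0, if_pos (h.1 h0)]
  · rw [if_neg h0, if_neg fun h1 => h0 (h.2 h1)]

theorem continuousAt_det_fderiv {E : Type*} [NormedAddCommGroup E] [NormedSpace ℝ E]
    [FiniteDimensional ℝ E] {f : E → E} {w : E} (hf : ContDiffAt ℝ ∞ f w) :
    ContinuousAt (fun w => (fderiv ℝ f w).det) w :=
  ContinuousLinearMap.continuous_det.continuousAt.comp (hf.continuousAt_fderiv (by simp))

/-- Near a regular point a map is a bijection onto a neighbourhood of the value, and the sign is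
constant. -/
theorem exists_nhds_of_surjective (hn : 1 ≤ n) (oN : MfdOrientation (𝓡 n) N)
    (oM : MfdOrientation I M)
    (G : C^∞⟮(𝓡 n).prod (𝓡 1), N × Circle; I, M⟯) {z : N × Circle}
    (hz : Function.Surjective (mfderiv ((𝓡 n).prod (𝓡 1)) I G z)) {U₀ : Set (N × Circle)}
    (hU₀ : U₀ ∈ 𝓝 z) :
    ∃ U ∈ 𝓝 z, U ⊆ U₀ ∧ Set.InjOn G U ∧
      (∀ z' ∈ U, Function.Surjective (mfderiv ((𝓡 n).prod (𝓡 1)) I G z') ∧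
        pointSign oN oM circleUnitVector G z' = pointSign oN oM circleUnitVector G z) ∧
      ∀ᶠ y in 𝓝 (G z), ∃ z' ∈ U, G z' = y := by
  obtain ⟨e, B, he, hze⟩ := exists_isOrientedParam hn oN z
  obtain ⟨V, c, hV, hzV⟩ := exists_isOrientedNhd (by omega) oM (G z)
  let f : EuclideanSpace ℝ (Fin (n + 1)) → EuclideanSpace ℝ (Fin (n + 1)) :=
    fun w => extChartAt I (G z) (G (e w))
  let w := e.symm z
  have hw : w ∈ e.source := e.map_target hze
  have hew : e w = z := e.right_inv hze
  have hGw : G (e w) ∈ V := by rwa [hew]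
  have hf : ContDiffAt ℝ ∞ f w := he.contDiffAt G hw (hV.subset_source hGw)
  have hdet : (fderiv ℝ f w).det ≠ 0 := by
    refine ((preservesOrientationAt_iff_det he hV G hw hGw).1).1 ?_
    rw [hew]; exact hz
  obtain ⟨φ, hwφ, hφ⟩ := exists_openPartialHomeomorph_of_det_ne_zero
    (hf.of_le (by norm_cast)) hdet
  have hce : ContinuousAt e w := e.continuousAt hw
  have hcG : ContinuousAt (fun w => G (e w)) w := G.contMDiff.continuous.continuousAt.comp hce
  let S : Set (EuclideanSpace ℝ (Fin (n + 1))) :=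
    {w' | w' ∈ e.source ∧ w' ∈ φ.source ∧ G (e w') ∈ V ∧ e w' ∈ U₀ ∧
      0 < (fderiv ℝ f w').det * (fderiv ℝ f w).det}
  have hS : S ∈ 𝓝 w := by
    have h1 := e.open_source.mem_nhds hw
    have h2 := φ.open_source.mem_nhds hwφ
    have h3 := hcG.preimage_mem_nhds (hV.isOpen.mem_nhds hGw)
    have h4 : e ⁻¹' U₀ ∈ 𝓝 w := hce.preimage_mem_nhds (by rwa [hew])
    have h5 : ∀ᶠ w' in 𝓝 w, 0 < (fderiv ℝ f w').det * (fderiv ℝ f w).det :=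
      ((continuousAt_det_fderiv hf).mul continuousAt_const).eventually
        (lt_mem_nhds (mul_self_pos.2 hdet))
    filter_upwards [h1, h2, h3, h4, h5] with w' a1 a2 a3 a4 a5 using ⟨a1, a2, a3, a4, a5⟩
  have hiff : ∀ w' ∈ S, Function.Surjective (mfderiv ((𝓡 n).prod (𝓡 1)) I G (e w')) ∧
      (PreservesOrientationAt oN oM circleUnitVector G (e w') ↔
        PreservesOrientationAt oN oM circleUnitVector G (e w)) := by
    rintro w' ⟨a1, a2, a3, a4, a5⟩
    have h1 := preservesOrientationAt_iff_det he hV G a1 a3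
    have h2 := preservesOrientationAt_iff_det he hV G hw hGw
    refine ⟨h1.1.2 fun h => ?_, ?_⟩
    · change (fderiv ℝ f w').det = 0 at h
      rw [h, zero_mul] at a5
      exact lt_irrefl _ a5
    · rw [h1.2, h2.2]
      change 0 < (fderiv ℝ f w').det * c.det B ↔ 0 < (fderiv ℝ f w).det * c.det B
      rcases lt_or_gt_of_ne hdet with h | h
      · have h' : (fderiv ℝ f w').det < 0 := by by_contra! hc; nlinarith
        constructor <;> intro hp
        · have := neg_of_mul_pos_right hp h'.le; nlinarith
        · have := neg_of_mul_pos_right hp h.le; nlinarith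
      · have h' : 0 < (fderiv ℝ f w').det := by by_contra! hc; nlinarith
        rw [mul_pos_iff_of_pos_left h, mul_pos_iff_of_pos_left h']
  refine ⟨e '' S, ?_, ?_, ?_, ?_, ?_⟩
  · rw [← hew]
    exact e.image_mem_nhds hw hS
  · rintro _ ⟨w', hw', rfl⟩
    exact hw'.2.2.2.1
  · rintro _ ⟨w₁, h₁, rfl⟩ _ ⟨w₂, h₂, rfl⟩ h
    have : φ w₁ = φ w₂ := by rw [hφ]; exact congrArg (extChartAt I (G z)) h
    rw [φ.injOn h₁.2.1 h₂.2.1 this]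
  · rintro _ ⟨w', hw', rfl⟩
    refine ⟨(hiff w' hw').1, ?_⟩
    rw [pointSign_eq_of_iff (hiff w' hw').2, hew]
  · have h1 : φ '' S ∈ 𝓝 (φ w) := φ.image_mem_nhds hwφ hS
    have h2 : φ w = extChartAt I (G z) (G z) := by rw [hφ]; simp only [f, hew]
    rw [h2] at h1
    have h3 := (continuousAt_extChartAt (I := I) (G z)).preimage_mem_nhds h1
    filter_upwards [h3, hV.isOpen.mem_nhds hzV] with y hy hyV
    obtain ⟨w', hw', hfw'⟩ := hy
    refine ⟨e w', ⟨w', hw', rfl⟩, ?_⟩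
    rw [hφ] at hfw'
    refine (extChartAt I (G z)).injOn ?_ ?_ hfw'
    · rw [extChartAt_source]; exact hV.subset_source hw'.2.2.1
    · rw [extChartAt_source]; exact hV.subset_source hyV

variable [CompactSpace N]

theorem finite_preimage_of_isRegularValue [T2Space M] (hn : 1 ≤ n) (oN : MfdOrientation (𝓡 n) N)
    (oM : MfdOrientation I M) (G : C^∞⟮(𝓡 n).prod (𝓡 1), N × Circle; I, M⟯)
    {y : M} (hy : IsRegularValue G y) : (G ⁻¹' {y}).Finite := by
  have h := finite_of_isCompact_of_isolated (K := (Set.univ : Set (N × Circle)))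
    (S := G ⁻¹' {y}) isCompact_univ ?_
  · rwa [Set.univ_inter] at h
  intro z _
  by_cases hz : G z = y
  · obtain ⟨U, hU, -, hinj, -⟩ := exists_nhds_of_surjective hn oN oM G (hy z hz) Filter.univ_mem
    exact ⟨U, hU, fun x hx => hinj hx.1 (mem_of_mem_nhds hU) (hx.2.trans hz.symm)⟩
  · refine ⟨G ⁻¹' {y}ᶜ, (isOpen_compl_singleton.preimage G.contMDiff.continuous).mem_nhds hz, ?_⟩
    rintro x ⟨hx, hx'⟩
    exact absurd hx' hx

/-- The signed count is locally constant on the set of regular values. -/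
theorem eventually_signedCount_eq [T2Space N] [T2Space M] (hn : 1 ≤ n) (oN : MfdOrientation (𝓡 n) N)
    (oM : MfdOrientation I M) (G : C^∞⟮(𝓡 n).prod (𝓡 1), N × Circle; I, M⟯)
    {y : M} (hy : IsRegularValue G y) :
    ∀ᶠ y' in 𝓝 y, IsRegularValue G y' ∧
      signedCount oN oM circleUnitVector G y' = signedCount oN oM circleUnitVector G y := by
  have hfin := finite_preimage_of_isRegularValue hn oN oM G hy
  obtain ⟨D, hD, hdisj⟩ := hfin.t2_separation
  have hLP := fun z (hz : z ∈ G ⁻¹' {y}) =>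
    exists_nhds_of_surjective hn oN oM G (hy z hz) ((hD z).2.mem_nhds (hD z).1)
  choose! U hU hUD hinj hsign hex using hLP
  -- The complement of these neighbourhoods is compact with closed image missing `y`. Hence for `y'`
  -- near `y` every preimage lies in some `U z`, and each `U z` contains exactly one, with the sign
  -- of `z`.
  have hopen : IsOpen (⋃ z ∈ G ⁻¹' {y}, interior (U z)) :=
    isOpen_biUnion fun _ _ => isOpen_interior
  have hclosed : IsClosed (G '' (⋃ z ∈ G ⁻¹' {y}, interior (U z))ᶜ) :=
    (hopen.isClosed_compl.isCompact.image G.contMDiff.continuous).isClosed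
  have hnot : y ∉ G '' (⋃ z ∈ G ⁻¹' {y}, interior (U z))ᶜ := by
    rintro ⟨z, hz, hzy⟩
    exact hz (Set.mem_biUnion hzy (mem_interior_iff_mem_nhds.2 (hU z hzy)))
  have hex' : ∀ᶠ y' in 𝓝 y, ∀ z ∈ G ⁻¹' {y}, ∃ z' ∈ U z, G z' = y' := by
    rw [Filter.eventually_all_finite hfin]
    intro z hz
    have := hex z hz
    rwa [show G z = y from hz] at this
  filter_upwards [hclosed.isOpen_compl.mem_nhds hnot, hex'] with y' hy' hex''
  have hcover : ∀ z', G z' = y' → ∃ z ∈ G ⁻¹' {y}, z' ∈ U z := by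
    intro z' hz'
    by_contra! hcon
    refine hy' ⟨z', fun hmem => ?_, hz'⟩
    obtain ⟨z, hz, hz''⟩ := Set.mem_iUnion₂.1 hmem
    exact hcon z hz (interior_subset hz'')
  refine ⟨fun z' hz' => ?_, ?_⟩
  · obtain ⟨z, hz, hz'U⟩ := hcover z' hz'
    exact (hsign z hz z' hz'U).1
  · choose! g hgU hgy using hex''
    unfold signedCount
    symm
    refine finsum_mem_eq_of_bijOn g ⟨fun z hz => hgy z hz, fun a ha b hb hab => ?_, fun z' hz' => ?_⟩
      fun z hz => ((hsign z hz _ (hgU z hz)).2).symm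
    · by_contra hne
      exact Set.disjoint_left.1 (hdisj ha hb hne) (hUD a ha (hgU a ha))
        (hab ▸ hUD b hb (hgU b hb))
    · obtain ⟨z, hz, hz'U⟩ := hcover z' hz'
      exact ⟨z, hz, hinj z hz (hgU z hz) hz'U ((hgy z hz).trans (Eq.symm hz'))⟩

/-- Sard's theorem: the critical values in a chart form a null set. -/
theorem volume_image_critical_values_eq_zero (hn : 1 ≤ n) (oN : MfdOrientation (𝓡 n) N)
    (G : C^∞⟮(𝓡 n).prod (𝓡 1), N × Circle; I, M⟯) {p : M} {V : Set M}
    {c : Module.Basis (Fin (n + 1)) ℝ (EuclideanSpace ℝ (Fin (n + 1)))}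
    (hV : IsOrientedNhd oM p V c) :
    MeasureTheory.volume (extChartAt I p '' (V ∩ {y | ¬ IsRegularValue G y})) = 0 := by
  choose e B he hz using exists_isOrientedParam hn oN
  obtain ⟨t, -, ht⟩ := (isCompact_univ (X := N × Circle)).elim_nhds_subcover
    (fun z => (e z).target) fun z _ => (e z).open_target.mem_nhds (hz z)
  let f : N × Circle → EuclideanSpace ℝ (Fin (n + 1)) → EuclideanSpace ℝ (Fin (n + 1)) :=
    fun z w => extChartAt I p (G (e z w))
  let S : N × Circle → Set (EuclideanSpace ℝ (Fin (n + 1))) := fun z =>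
    {w | w ∈ (e z).source ∧ G (e z w) ∈ V ∧ (fderiv ℝ (f z) w).det = 0}
  -- In equal dimensions Sard's theorem is just the fact that the image of the zero set of the
  -- Jacobian is null; compactness reduces to finitely many parametrizations.
  have hnull : MeasureTheory.volume (⋃ z ∈ t, f z '' S z) = 0 := by
    refine (MeasureTheory.measure_biUnion_null_iff t.countable_toSet).2 fun z _ => ?_
    refine MeasureTheory.addHaar_image_eq_zero_of_det_fderivWithin_eq_zero
      (f' := fun w => fderiv ℝ (f z) w) _ (fun w hw => ?_) fun w hw => hw.2.2
    exact (((he z).contDiffAt G hw.1 (hV.subset_source hw.2.1)).differentiableAt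
      (by simp)).hasFDerivAt.hasFDerivWithinAt
  refine MeasureTheory.measure_mono_null ?_ hnull
  rintro _ ⟨y, ⟨hyV, hy⟩, rfl⟩
  have hy' : ∃ z, G z = y ∧ ¬ Function.Surjective (mfderiv ((𝓡 n).prod (𝓡 1)) I G z) := by
    by_contra! hcon
    exact hy hcon
  obtain ⟨z', rfl, hz'⟩ := hy'
  obtain ⟨z, hzt, hz'z⟩ := Set.mem_iUnion₂.1 (ht (Set.mem_univ z'))
  refine Set.mem_biUnion hzt ⟨(e z).symm z', ⟨(e z).map_target hz'z, ?_, ?_⟩, ?_⟩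
  · rwa [(e z).right_inv hz'z]
  · by_contra hne
    have := (preservesOrientationAt_iff_det (he z) hV G ((e z).map_target hz'z)
      (by rwa [(e z).right_inv hz'z])).1.2 hne
    rw [(e z).right_inv hz'z] at this
    exact hz' this
  · simp only [f, (e z).right_inv hz'z]

/-- Simultaneous regular values of finitely many maps are dense. -/
theorem exists_isRegularValue_mem (hn : 1 ≤ n) (oN : MfdOrientation (𝓡 n) N)
    (oM : MfdOrientation I M) {ι : Type*} [Finite ι]
    (G : ι → C^∞⟮(𝓡 n).prod (𝓡 1), N × Circle; I, M⟯) {p : M} {O : Set M} (hO : O ∈ 𝓝 p) :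
    ∃ y ∈ O, ∀ i, IsRegularValue (G i) y := by
  obtain ⟨V, c, hV, hpV⟩ := exists_isOrientedNhd (by omega) oM p
  by_contra! hcon
  obtain ⟨x, hx⟩ := interior_image_extChartAt_nonempty (I := I)
    (Filter.inter_mem hO (hV.isOpen.mem_nhds hpV))
  have hnull : MeasureTheory.volume
      (⋃ i, extChartAt I p '' (V ∩ {y | ¬ IsRegularValue (G i) y})) = 0 :=
    (MeasureTheory.measure_iUnion_null_iff).2 fun i =>
      volume_image_critical_values_eq_zero hn oN (G i) hV
  have hpos : 0 < MeasureTheory.volume (interior (extChartAt I p '' (O ∩ V))) :=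
    isOpen_interior.measure_pos _ ⟨x, hx⟩
  refine hpos.ne' (MeasureTheory.measure_mono_null (interior_subset.trans ?_) hnull)
  rintro _ ⟨y, ⟨hyO, hyV⟩, rfl⟩
  obtain ⟨i, hi⟩ := hcon y hyO
  exact Set.mem_iUnion.2 ⟨i, y, ⟨hyV, hi⟩, rfl⟩

end RegularValues

end AffineWinding

end

noncomputable section

namespace AffineWinding

/-! ### Modifying a map inside one parametrization and one chart -/

section Push

variable {E : Type*} [NormedAddCommGroup E] [NormedSpace ℝ E] {H : Type*} [TopologicalSpace H]
  {I : ModelWithCorners ℝ E H} {M : Type*} [TopologicalSpace M] [ChartedSpace H M]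
  [IsManifold I ∞ M]
  {F : Type*} [NormedAddCommGroup F] [NormedSpace ℝ F] {G : Type*} [TopologicalSpace G]
  {J : ModelWithCorners ℝ F G} {X : Type*} [TopologicalSpace X] [ChartedSpace G X]

/-- A smooth map can be moved inside a chart of the target by a smooth displacement. -/
theorem exists_push (f : C^∞⟮J, X; I, M⟯) (p : M) {O C : Set X} (hO : IsOpen O) (hC : IsClosed C)
    (hCO : C ⊆ O) (hfO : ∀ x ∈ O, f x ∈ (chartAt H p).source) {d : X → E}
    (hd : ContMDiffOn J 𝓘(ℝ, E) ∞ d O) (hd0 : ∀ x ∈ O, x ∉ C → d x = 0)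
    (hdt : ∀ x ∈ O, extChartAt I p (f x) + d x ∈ (extChartAt I p).target) :
    ∃ g : C^∞⟮J, X; I, M⟯, (∀ x ∈ O, g x = (extChartAt I p).symm (extChartAt I p (f x) + d x)) ∧
      ∀ x ∉ C, g x = f x := by
  classical
  let g : X → M := fun x =>
    if x ∈ C then (extChartAt I p).symm (extChartAt I p (f x) + d x) else f x
  have hgC : ∀ x ∉ C, g x = f x := fun x hx => if_neg hx
  have hgO : ∀ x ∈ O, g x = (extChartAt I p).symm (extChartAt I p (f x) + d x) := by
    intro x hx
    by_cases hxC : x ∈ C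
    · exact if_pos hxC
    · rw [hgC x hxC, hd0 x hx hxC, add_zero, (extChartAt I p).left_inv]
      rw [extChartAt_source]
      exact hfO x hx
  have hg : ContMDiff J I ∞ g := by
    intro x
    by_cases hxC : x ∈ C
    · have hxO := hCO hxC
      have h1 : ContMDiffOn J 𝓘(ℝ, E) ∞ (fun x => extChartAt I p (f x) + d x) O := by
        refine ContMDiffOn.add ?_ hd
        exact (contMDiffOn_extChartAt (I := I) (n := ∞) (x := p)).comp f.contMDiff.contMDiffOn hfO
      have h2 : ContMDiffOn J I ∞
          (fun x => (extChartAt I p).symm (extChartAt I p (f x) + d x)) O :=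
        (contMDiffOn_extChartAt_symm (I := I) (n := ∞) p).comp h1 hdt
      exact (h2.congr hgO).contMDiffAt (hO.mem_nhds hxO)
    · refine (f.contMDiff x).congr_of_eventuallyEq ?_
      filter_upwards [hC.isOpen_compl.mem_nhds hxC] with a ha using hgC a ha
  exact ⟨⟨g, hg⟩, hgO, hgC⟩

end Push

section LocalModification

variable {n : ℕ} {N : Type*} [TopologicalSpace N] [ChartedSpace (EuclideanSpace ℝ (Fin n)) N]
  [IsManifold (𝓡 n) ∞ N]
  {H : Type*} [TopologicalSpace H] {I : ModelWithCorners ℝ (EuclideanSpace ℝ (Fin (n + 1))) H}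
  {M : Type*} [TopologicalSpace M] [ChartedSpace H M] [IsManifold I ∞ M]
  {oN : MfdOrientation (𝓡 n) N} {oM : MfdOrientation I M}

/-- Maps which agree up to a constant in an oriented chart near a point behave in the same way with
respect to orientations. -/
theorem preservesOrientationAt_congr (hn : 1 ≤ n) (oN : MfdOrientation (𝓡 n) N) {p : M} {V : Set M}
    {c : Module.Basis (Fin (n + 1)) ℝ (EuclideanSpace ℝ (Fin (n + 1)))}
    (hV : IsOrientedNhd oM p V c) {G G' : C^∞⟮(𝓡 n).prod (𝓡 1), N × Circle; I, M⟯}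
    {z : N × Circle} (hz : G z ∈ V) (hz' : G' z ∈ V) (v : EuclideanSpace ℝ (Fin (n + 1)))
    (h : ∀ᶠ a in 𝓝 z, extChartAt I p (G' a) = extChartAt I p (G a) + v) :
    (Function.Surjective (mfderiv ((𝓡 n).prod (𝓡 1)) I G z) ↔
      Function.Surjective (mfderiv ((𝓡 n).prod (𝓡 1)) I G' z)) ∧
    pointSign oN oM circleUnitVector G z = pointSign oN oM circleUnitVector G' z := by
  obtain ⟨e, B, he, hze⟩ := exists_isOrientedParam hn oN z
  obtain ⟨w, hw, rfl⟩ : ∃ w ∈ e.source, e w = z := ⟨e.symm z, e.map_target hze, e.right_inv hze⟩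
  have h1 := preservesOrientationAt_iff_det he hV G hw hz
  have h2 := preservesOrientationAt_iff_det he hV G' hw hz'
  have h3 : fderiv ℝ (fun w => extChartAt I p (G' (e w))) w =
      fderiv ℝ (fun w => extChartAt I p (G (e w))) w := by
    have : (fun w => extChartAt I p (G' (e w))) =ᶠ[𝓝 w] fun w => extChartAt I p (G (e w)) + v :=
      (e.continuousAt hw).eventually h
    rw [this.fderiv_eq, fderiv_add_const]
  rw [h3] at h2
  exact ⟨h1.1.trans h2.1.symm, pointSign_eq_of_iff (h1.2.trans h2.2.symm)⟩

theorem preservesOrientationAt_congr_eventuallyEq (hn : 1 ≤ n) (oN : MfdOrientation (𝓡 n) N)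
    (oM : MfdOrientation I M) {G G' : C^∞⟮(𝓡 n).prod (𝓡 1), N × Circle; I, M⟯}
    {z : N × Circle} (h : ∀ᶠ a in 𝓝 z, G' a = G a) :
    (Function.Surjective (mfderiv ((𝓡 n).prod (𝓡 1)) I G z) ↔
      Function.Surjective (mfderiv ((𝓡 n).prod (𝓡 1)) I G' z)) ∧
    pointSign oN oM circleUnitVector G z = pointSign oN oM circleUnitVector G' z := by
  obtain ⟨V, c, hV, hzV⟩ := exists_isOrientedNhd (by omega) oM (G z)
  refine preservesOrientationAt_congr hn oN hV hzV (by rwa [h.self_of_nhds]) 0 ?_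
  filter_upwards [h] with a ha
  rw [ha, add_zero]

/-- In an oriented parametrization, the signed count over a compact set is a count of signs of
Jacobian determinants. -/
theorem finsum_pointSign_eq_finsum_sign_det
    {e : OpenPartialHomeomorph (EuclideanSpace ℝ (Fin (n + 1))) (N × Circle)}
    {B : Module.Basis (Fin (n + 1)) ℝ (EuclideanSpace ℝ (Fin (n + 1)))}
    (he : IsOrientedParam oN e B) {p : M} {V : Set M}
    {c : Module.Basis (Fin (n + 1)) ℝ (EuclideanSpace ℝ (Fin (n + 1)))}
    (hV : IsOrientedNhd oM p V c) (G : C^∞⟮(𝓡 n).prod (𝓡 1), N × Circle; I, M⟯)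
    {K : Set (N × Circle)} (hKe : K ⊆ e.target) (hKV : ∀ z ∈ K, G z ∈ V)
    {g : EuclideanSpace ℝ (Fin (n + 1)) → EuclideanSpace ℝ (Fin (n + 1))}
    (hg : ∀ w ∈ e.symm '' K, g =ᶠ[𝓝 w] fun w => extChartAt I p (G (e w)))
    {y : M} (hyV : y ∈ V) (hy : IsRegularValue G y) (hfin : (G ⁻¹' {y}).Finite) :
    (∀ w ∈ e.symm '' K, g w = extChartAt I p y → (fderiv ℝ g w).det ≠ 0) ∧
    ∑ᶠ z ∈ K ∩ G ⁻¹' {y}, pointSign oN oM circleUnitVector G z =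
      (SignType.sign (c.det B) : ℤ) * ∑ᶠ w ∈ e.symm '' K ∩ {w | g w = extChartAt I p y},
        (SignType.sign (fderiv ℝ g w).det : ℤ) := by
  have hinj : ∀ z ∈ K, extChartAt I p (G z) = extChartAt I p y → G z = y := by
    intro z hz h
    refine (extChartAt I p).injOn ?_ ?_ h
    · rw [extChartAt_source]; exact hV.subset_source (hKV z hz)
    · rw [extChartAt_source]; exact hV.subset_source hyV
  have hκ : c.det B ≠ 0 := (c.isUnit_det B).ne_zero
  have key : ∀ z ∈ K, G z = y → (fderiv ℝ g (e.symm z)).det ≠ 0 ∧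
      pointSign oN oM circleUnitVector G z =
        (SignType.sign (c.det B) : ℤ) * (SignType.sign (fderiv ℝ g (e.symm z)).det : ℤ) := by
    intro z hz hzy
    have hw : e.symm z ∈ e.source := e.map_target (hKe hz)
    have hew : e (e.symm z) = z := e.right_inv (hKe hz)
    have h1 := preservesOrientationAt_iff_det he hV G hw (by rw [hew]; exact hKV z hz)
    rw [← (hg _ ⟨z, hz, rfl⟩).fderiv_eq, hew] at h1
    have h2 := h1.1.1 (hy z hzy)
    refine ⟨h2, ?_⟩
    unfold pointSign
    rcases lt_or_gt_of_ne hκ with a | a <;> rcases lt_or_gt_of_ne h2 with b | b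
    · rw [if_pos (h1.2.2 (mul_pos_of_neg_of_neg b a)), sign_neg a, sign_neg b]; rfl
    · rw [if_neg fun h => (mul_neg_of_pos_of_neg b a).not_gt (h1.2.1 h), sign_neg a, sign_pos b]; rfl
    · rw [if_neg fun h => (mul_neg_of_neg_of_pos b a).not_gt (h1.2.1 h), sign_pos a, sign_neg b]; rfl
    · rw [if_pos (h1.2.2 (mul_pos b a)), sign_pos a, sign_pos b]; rfl
  have hgval : ∀ z ∈ K, g (e.symm z) = extChartAt I p (G z) := by
    intro z hz
    rw [(hg _ ⟨z, hz, rfl⟩).eq_of_nhds, e.right_inv (hKe hz)]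
  refine ⟨?_, ?_⟩
  · rintro _ ⟨z, hz, rfl⟩ h
    rw [hgval z hz] at h
    exact (key z hz (hinj z hz h)).1
  · have hbij : Set.BijOn e.symm (K ∩ G ⁻¹' {y}) (e.symm '' K ∩ {w | g w = extChartAt I p y}) := by
      refine ⟨?_, (e.symm.injOn.mono (hKe)).mono Set.inter_subset_left, ?_⟩
      · rintro z ⟨hz, hzy⟩
        refine ⟨⟨z, hz, rfl⟩, ?_⟩
        change g (e.symm z) = _
        rw [hgval z hz, show G z = y from hzy]
      · rintro _ ⟨⟨z, hz, rfl⟩, h⟩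
        refine ⟨z, ⟨hz, hinj z hz ?_⟩, rfl⟩
        rw [← hgval z hz]; exact h
    rw [finsum_mem_eq_of_bijOn (g := fun w => (SignType.sign (c.det B) : ℤ) *
      (SignType.sign (fderiv ℝ g w).det : ℤ)) e.symm hbij fun z hz => (key z hz.1 hz.2).2]
    rcases lt_or_gt_of_ne hκ with a | a
    · rw [sign_neg a]
      simp only [SignType.coe_neg_one, neg_mul, one_mul]
      exact finsum_mem_neg_distrib _
        (hbij.image_eq ▸ (hfin.subset Set.inter_subset_right).image _)
    · rw [sign_pos a]
      simp only [SignType.coe_one, one_mul]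

variable [CompactSpace N] [T2Space M]

/-- Moving a map in a fixed direction of a chart, inside one oriented parametrization, does not
change signed counts. -/
theorem signedCount_eq_of_local_modification (hn : 1 ≤ n)
    {e : OpenPartialHomeomorph (EuclideanSpace ℝ (Fin (n + 1))) (N × Circle)}
    {B : Module.Basis (Fin (n + 1)) ℝ (EuclideanSpace ℝ (Fin (n + 1)))}
    (he : IsOrientedParam oN e B) {p : M} {V : Set M}
    {c : Module.Basis (Fin (n + 1)) ℝ (EuclideanSpace ℝ (Fin (n + 1)))}
    (hV : IsOrientedNhd oM p V c) {G₀ G₁ : C^∞⟮(𝓡 n).prod (𝓡 1), N × Circle; I, M⟯}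
    {K : Set (N × Circle)} (hK : IsClosed K) (hKe : K ⊆ e.target)
    (hKV : ∀ z ∈ K, G₀ z ∈ V) {u : N × Circle → ℝ}
    (hu : ContMDiff ((𝓡 n).prod (𝓡 1)) 𝓘(ℝ, ℝ) ∞ u) (huK : ∀ z ∉ K, u z = 0)
    (v : EuclideanSpace ℝ (Fin (n + 1)))
    (hGV : ∀ z, G₀ z ∈ V → G₁ z ∈ V ∧ extChartAt I p (G₁ z) = extChartAt I p (G₀ z) + u z • v)
    (hGK : ∀ z ∉ K, G₁ z = G₀ z) {y : M} (hy₀ : IsRegularValue G₀ y) (hy₁ : IsRegularValue G₁ y) :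
    signedCount oN oM circleUnitVector G₀ y = signedCount oN oM circleUnitVector G₁ y := by
  have hKc : IsCompact K := hK.isCompact
  have hf₀ := finite_preimage_of_isRegularValue hn oN oM G₀ hy₀
  have hf₁ := finite_preimage_of_isRegularValue hn oN oM G₁ hy₁
  unfold signedCount
  -- Off `K` the maps agree on an open set, so fibres and signs coincide there; only the part of the
  -- fibre in `K` needs the Euclidean result.
  rw [← finsum_mem_inter_add_sdiff K hf₀, ← finsum_mem_inter_add_sdiff K hf₁,
    Set.inter_comm _ K, Set.inter_comm _ K]
  congr 1
  swap
  · have hset : G₀ ⁻¹' {y} \ K = G₁ ⁻¹' {y} \ K := by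
      ext z
      refine and_congr_left fun hz => ?_
      simp only [Set.mem_preimage, hGK z hz]
    rw [hset]
    refine finsum_mem_congr rfl fun z hz => ?_
    refine (preservesOrientationAt_congr_eventuallyEq hn oN oM ?_).2
    filter_upwards [hK.isOpen_compl.mem_nhds hz.2] with a ha using hGK a ha
  by_cases hyV : y ∈ V
  swap
  · have hemp : ∀ G : C^∞⟮(𝓡 n).prod (𝓡 1), N × Circle; I, M⟯, (∀ z ∈ K, G z ∈ V) →
        K ∩ G ⁻¹' {y} = ∅ := by
      intro G hG
      ext z
      simp only [Set.mem_inter_iff, Set.mem_preimage, Set.mem_singleton_iff, Set.mem_empty_iff_false,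
        iff_false, not_and]
      rintro hz rfl
      exact hyV (hG z hz)
    rw [hemp G₀ hKV, hemp G₁ fun z hz => (hGV z (hKV z hz)).1, finsum_mem_empty, finsum_mem_empty]
  -- pass to the parametrization
  let Ω : Set (EuclideanSpace ℝ (Fin (n + 1))) := e.source ∩ e ⁻¹' (G₀ ⁻¹' V)
  have hΩ : IsOpen Ω := e.isOpen_inter_preimage (hV.isOpen.preimage G₀.contMDiff.continuous)
  have hK' : IsCompact (e.symm '' K) := hKc.image_of_continuousOn (e.continuousOn_symm.mono hKe)
  have hK'Ω : e.symm '' K ⊆ Ω := by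
    rintro _ ⟨z, hz, rfl⟩
    refine ⟨e.map_target (hKe hz), ?_⟩
    change G₀ (e (e.symm z)) ∈ V
    rw [e.right_inv (hKe hz)]
    exact hKV z hz
  obtain ⟨t, ht, hKt, htΩ⟩ := exists_compact_between hK' hΩ hK'Ω
  -- The Euclidean count wants maps defined on the whole space. The cutoff is 1 near the coordinate
  -- image of `K` and vanishes off a compact subset of `Ω`, so multiplying by it extends the
  -- coordinate expressions by zero without affecting them near that image.
  obtain ⟨κ, hκ1, hκ0, -⟩ := exists_contMDiffMap_one_nhds_of_subset_interior
    (𝓡 (n + 1)) hK'.isClosed hKt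
  have hκs : ContDiff ℝ ∞ κ := κ.contMDiff.contDiff
  have hsm : ∀ {F : Type} [NormedAddCommGroup F] [NormedSpace ℝ F]
      (f : EuclideanSpace ℝ (Fin (n + 1)) → F),
      (∀ w ∈ Ω, ContDiffAt ℝ ∞ f w) → ContDiff ℝ 2 (fun w => κ w • f w) := by
    intro F _ _ f hf
    refine contDiff_iff_contDiffAt.2 fun w => ?_
    by_cases hw : w ∈ t
    · exact (hκs.contDiffAt.smul (hf w (htΩ hw))).of_le (by norm_cast)
    · have : (fun w => κ w • f w) =ᶠ[𝓝 w] fun _ => 0 := by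
        filter_upwards [ht.isClosed.isOpen_compl.mem_nhds hw] with a ha
        rw [hκ0 a ha, zero_smul]
      exact contDiffAt_const.congr_of_eventuallyEq this
  let g : EuclideanSpace ℝ (Fin (n + 1)) → EuclideanSpace ℝ (Fin (n + 1)) :=
    fun w => κ w • extChartAt I p (G₀ (e w))
  let u' : EuclideanSpace ℝ (Fin (n + 1)) → ℝ := fun w => κ w • u (e w)
  have hg : ContDiff ℝ 2 g := hsm _ fun w hw => he.contDiffAt G₀ hw.1 (hV.subset_source hw.2)
  have hu' : ContDiff ℝ 2 u' := by
    refine hsm _ fun w hw => ?_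
    rw [← contMDiffAt_iff_contDiffAt]
    exact hu.contMDiffAt.comp w (he.smooth.contMDiffAt (e.open_source.mem_nhds hw.1))
  have hu'K : tsupport u' ⊆ e.symm '' K := by
    refine closure_minimal (fun w hw => ?_) hK'.isClosed
    have h1 : κ w ≠ 0 := fun h => hw (by simp [u', h])
    have h2 : u (e w) ≠ 0 := fun h => hw (by simp [u', h])
    have hwt : w ∈ t := by
      by_contra hwt; exact h1 (hκ0 w hwt)
    refine ⟨e w, ?_, e.left_inv (htΩ hwt).1⟩
    by_contra hwK
    exact h2 (huK _ hwK)
  have hnear : ∀ w ∈ e.symm '' K, ∀ᶠ a in 𝓝 w, κ a = 1 ∧ a ∈ Ω := by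
    intro w hw
    exact (hκ1.filter_mono (nhds_le_nhdsSet hw)).and (hΩ.mem_nhds (hK'Ω hw))
  have hg₀ : ∀ w ∈ e.symm '' K, g =ᶠ[𝓝 w] fun w => extChartAt I p (G₀ (e w)) := by
    intro w hw
    filter_upwards [hnear w hw] with a ha
    simp only [g, ha.1, one_smul]
  have hg₁ : ∀ w ∈ e.symm '' K,
      (fun w => g w + u' w • v) =ᶠ[𝓝 w] fun w => extChartAt I p (G₁ (e w)) := by
    intro w hw
    filter_upwards [hnear w hw] with a ha
    simp only [g, u', ha.1, one_smul]
    exact ((hGV _ ha.2.2).2).symm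
  obtain ⟨r₀, s₀⟩ := finsum_pointSign_eq_finsum_sign_det he hV G₀ hKe hKV hg₀ hyV hy₀ hf₀
  obtain ⟨r₁, s₁⟩ := finsum_pointSign_eq_finsum_sign_det he hV G₁ hKe
    (fun z hz => (hGV z (hKV z hz)).1) hg₁ hyV hy₁ hf₁
  rw [s₀, s₁, finsum_sign_det_eq_of_add_smul hg hu' v (extChartAt I p y) hK' hu'K r₀ r₁]

end LocalModification

end AffineWinding

end

noncomputable section

namespace AffineWinding

/-! ### Displacements of the target supported in a chart -/

section ChartPush

variable {E : Type*} [NormedAddCommGroup E] [NormedSpace ℝ E] {H : Type*} [TopologicalSpace H]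

/-- The data of a displacement by `χ • v` in a chart around `p`, supported in `A` and preserving the
open set `V`. -/
structure IsChartPush (I : ModelWithCorners ℝ E H) {M : Type*} [TopologicalSpace M]
    [ChartedSpace H M] (p : M) (V A : Set M) (χ : E → ℝ) (v : E) : Prop where
  isOpen : IsOpen V
  subset_source : V ⊆ (chartAt H p).source
  isClosed : IsClosed A
  subset : A ⊆ V
  smooth : ContDiff ℝ ∞ χ
  eq_zero : ∀ y ∈ V, y ∉ A → χ (extChartAt I p y) = 0
  exists_eq : ∀ y ∈ V, ∀ s ∈ Set.Icc (0 : ℝ) 1,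
    ∃ y' ∈ V, extChartAt I p y' = extChartAt I p y + (s * χ (extChartAt I p y)) • v

variable {I : ModelWithCorners ℝ E H} {M : Type*} [TopologicalSpace M] [ChartedSpace H M]
  {F : Type*} [NormedAddCommGroup F] [NormedSpace ℝ F] {G : Type*} [TopologicalSpace G]
  {J : ModelWithCorners ℝ F G} {X : Type*} [TopologicalSpace X] [ChartedSpace G X]

/-- `g` is obtained from `f` by the displacement `σ • χ • v` in the chart around `p`. -/
structure IsPushOf (I : ModelWithCorners ℝ E H) (p : M) (V A : Set M) (χ : E → ℝ) (v : E) (σ : X → ℝ) (f g : X → M) : Prop where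
  mem : ∀ x, f x ∈ V → g x ∈ V
  eq : ∀ x, f x ∈ V →
    extChartAt I p (g x) = extChartAt I p (f x) + (σ x * χ (extChartAt I p (f x))) • v
  eq_of_notMem : ∀ x, f x ∉ A → g x = f x

variable [IsManifold I ∞ M]

/-- `IsChartPush` allows every fraction `s` of the displacement, so it may be scaled by a function
`σ` on the source; later `σ` runs through the partial sums of a partition of unity. -/
theorem IsChartPush.exists_isPushOf {p : M} {V A : Set M} {χ : E → ℝ} {v : E}
    (h : IsChartPush I p V A χ v) (f : C^∞⟮J, X; I, M⟯) {σ : X → ℝ}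
    (hσ : ContMDiff J 𝓘(ℝ, ℝ) ∞ σ) (hσ' : ∀ x, σ x ∈ Set.Icc (0 : ℝ) 1) :
    ∃ g : C^∞⟮J, X; I, M⟯, IsPushOf I p V A χ v σ f g := by
  have hf := f.contMDiff.continuous
  have hs : ∀ x ∈ f ⁻¹' V, ∃ y' ∈ V, extChartAt I p y' =
      extChartAt I p (f x) + (σ x * χ (extChartAt I p (f x))) • v :=
    fun x hx => h.exists_eq _ hx _ (hσ' x)
  have hd : ContMDiffOn J 𝓘(ℝ, E) ∞ (fun x => (σ x * χ (extChartAt I p (f x))) • v)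
      (f ⁻¹' V) := by
    refine ContMDiffOn.smul (ContMDiffOn.mul hσ.contMDiffOn ?_) contMDiffOn_const
    have h1 : ContMDiffOn J 𝓘(ℝ, E) ∞ (fun x => extChartAt I p (f x)) (f ⁻¹' V) :=
      (contMDiffOn_extChartAt (I := I) (n := ∞) (x := p)).comp f.contMDiff.contMDiffOn
        fun x hx => h.subset_source hx
    exact h.smooth.contMDiff.comp_contMDiffOn h1
  obtain ⟨g, hg, hg'⟩ := exists_push f p (h.isOpen.preimage hf) (h.isClosed.preimage hf)
    (Set.preimage_mono h.subset) (fun x hx => h.subset_source hx) hd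
    (fun x hx hxA => by simp only [h.eq_zero _ hx hxA, mul_zero, zero_smul])
    (fun x hx => by
      obtain ⟨y', hy', h'⟩ := hs x hx
      rw [← h']
      exact (extChartAt I p).map_source (by rw [extChartAt_source]; exact h.subset_source hy'))
  have key : ∀ x, f x ∈ V → g x ∈ V ∧
      extChartAt I p (g x) = extChartAt I p (f x) + (σ x * χ (extChartAt I p (f x))) • v := by
    intro x hx
    obtain ⟨y', hy', h'⟩ := hs x hx
    have : g x = y' := by
      rw [hg x hx, ← h', (extChartAt I p).left_inv]
      rw [extChartAt_source]
      exact h.subset_source hy'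
    rw [this]
    exact ⟨hy', h'⟩
  exact ⟨g, fun x hx => (key x hx).1, fun x hx => (key x hx).2, fun x hx => hg' x hx⟩

/-- The cutoff of an `IsChartPush`, as a smooth function on the manifold. -/
theorem IsChartPush.exists_contMDiff {p : M} {V A : Set M} {χ : E → ℝ} {v : E}
    (h : IsChartPush I p V A χ v) :
    ∃ η : M → ℝ, ContMDiff I 𝓘(ℝ, ℝ) ∞ η ∧ (∀ y ∈ V, η y = χ (extChartAt I p y)) ∧
      ∀ y ∉ A, η y = 0 := by
  classical
  let η : M → ℝ := fun y => if y ∈ A then χ (extChartAt I p y) else 0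
  have hV : ∀ y ∈ V, η y = χ (extChartAt I p y) := by
    intro y hy
    by_cases hA : y ∈ A
    · exact if_pos hA
    · rw [h.eq_zero y hy hA]; exact if_neg hA
  refine ⟨η, fun y => ?_, hV, fun y hy => if_neg hy⟩
  by_cases hA : y ∈ A
  · have h1 : ContMDiffOn I 𝓘(ℝ, ℝ) ∞ (fun y => χ (extChartAt I p y)) V :=
      h.smooth.contMDiff.comp_contMDiffOn
        ((contMDiffOn_extChartAt (I := I) (n := ∞) (x := p)).mono h.subset_source)
    exact (h1.congr hV).contMDiffAt (h.isOpen.mem_nhds (h.subset hA))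
  · refine contMDiffAt_const (c := (0 : ℝ)).congr_of_eventuallyEq ?_
    filter_upwards [h.isClosed.isOpen_compl.mem_nhds hA] with a ha using if_neg ha

end ChartPush

/-! ### Displacements at interior points and at boundary points -/

section Existence

variable {d : ℕ} {H : Type*} [TopologicalSpace H]
  {I : ModelWithCorners ℝ (EuclideanSpace ℝ (Fin d)) H}
  {M : Type*} [TopologicalSpace M] [ChartedSpace H M]

theorem exists_ball_inter_range_subset_image (p : M) {V : Set M} (hV : IsOpen V) (hpV : p ∈ V) :
    ∃ R > 0, Metric.ball (extChartAt I p p) R ∩ Set.range I ⊆ extChartAt I p '' V := by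
  have h1 : extChartAt I p '' V ∈ 𝓝[Set.range I] (extChartAt I p p) := by
    rw [← map_extChartAt_nhds]
    exact Filter.image_mem_map (hV.mem_nhds hpV)
  exact Metric.mem_nhdsWithin_iff.1 h1

/-- The cutoff is a bump function vanishing beyond radius `2 * R / 3`, so a step shorter than `R /
3` keeps the points it moves inside the ball of radius `R`. Staying in the range of the model is
left as a condition on `v`, since it depends on whether the point is on the boundary. -/
theorem exists_isChartPush [T2Space M] {p : M} {V : Set M} (hV : IsOpen V) (hVs : V ⊆ (chartAt H p).source)
    {R : ℝ} (hR : 0 < R)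
    (hball : Metric.ball (extChartAt I p p) R ∩ Set.range I ⊆ extChartAt I p '' V) :
    ∃ (χ : EuclideanSpace ℝ (Fin d) → ℝ) (A : Set M),
      (∀ x, χ x ∈ Set.Icc (0 : ℝ) 1) ∧
      (∀ x ∈ Metric.ball (extChartAt I p p) (R / 3), χ x = 1) ∧
      ∀ v : EuclideanSpace ℝ (Fin d), ‖v‖ < R / 3 →
        (∀ x ∈ Metric.ball (extChartAt I p p) R ∩ Set.range I, ∀ s ∈ Set.Icc (0 : ℝ) 1,
          x + s • v ∈ Set.range I) → IsChartPush I p V A χ v := by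
  let b : ContDiffBump (extChartAt I p p) := ⟨R / 3, 2 * R / 3, by positivity, by linarith⟩
  let K := Metric.closedBall (extChartAt I p p) (2 * R / 3) ∩ Set.range I
  have hK : IsCompact K := (isCompact_closedBall _ _).inter_right I.isClosed_range
  have hKb : K ⊆ Metric.ball (extChartAt I p p) R ∩ Set.range I :=
    Set.inter_subset_inter_left _ (Metric.closedBall_subset_ball (by linarith))
  have hKV : ∀ x ∈ K, (extChartAt I p).symm x ∈ V ∧ x ∈ (extChartAt I p).target := by
    intro x hx
    obtain ⟨y, hy, rfl⟩ := hball (hKb hx)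
    have hys : y ∈ (extChartAt I p).source := by rw [extChartAt_source]; exact hVs hy
    rw [(extChartAt I p).left_inv hys]
    exact ⟨hy, (extChartAt I p).map_source hys⟩
  refine ⟨b, (extChartAt I p).symm '' K, fun x => ⟨b.nonneg, b.le_one⟩, fun x hx =>
    b.one_of_mem_closedBall (Metric.ball_subset_closedBall hx), fun v hv hvI => ?_⟩
  have hcl : IsClosed ((extChartAt I p).symm '' K) :=
    (hK.image_of_continuousOn
      ((continuousOn_extChartAt_symm p).mono fun x hx => (hKV x hx).2)).isClosed
  have hz : ∀ y ∈ V, y ∉ (extChartAt I p).symm '' K → b (extChartAt I p y) = 0 := by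
    intro y hy hyA
    refine b.zero_of_le_dist ?_
    by_contra! hlt
    have hys : y ∈ (extChartAt I p).source := by rw [extChartAt_source]; exact hVs hy
    refine hyA ⟨extChartAt I p y, ⟨Metric.mem_closedBall.2 hlt.le, ?_⟩,
      (extChartAt I p).left_inv hys⟩
    exact extChartAt_target_subset_range p ((extChartAt I p).map_source hys)
  refine ⟨hV, hVs, hcl, ?_, b.contDiff, hz, ?_⟩
  · rintro _ ⟨x, hx, rfl⟩
    exact (hKV x hx).1
  · intro y hy s hs
    by_cases hyA : y ∈ (extChartAt I p).symm '' K
    · obtain ⟨x, hx, rfl⟩ := hyA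
      rw [(extChartAt I p).right_inv (hKV x hx).2]
      have hb0 : 0 ≤ b x := b.nonneg
      have hb1 : b x ≤ 1 := b.le_one
      have hs' : s * b x ∈ Set.Icc (0 : ℝ) 1 :=
        ⟨mul_nonneg hs.1 hb0, mul_le_one₀ hs.2 hb0 hb1⟩
      have : x + (s * b x) • v ∈ extChartAt I p '' V := by
        refine hball ⟨?_, hvI x (hKb hx) _ hs'⟩
        have h1 : ‖(s * b x) • v‖ ≤ ‖v‖ := by
          rw [norm_smul, Real.norm_of_nonneg hs'.1]
          exact mul_le_of_le_one_left (norm_nonneg _) hs'.2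
        have h2 := Metric.mem_closedBall.1 hx.1
        rw [dist_eq_norm] at h2
        rw [Metric.mem_ball, dist_eq_norm, add_sub_right_comm]
        calc _ ≤ _ := norm_add_le _ _
          _ < R := by linarith
      obtain ⟨y', hy', h'⟩ := this
      exact ⟨y', hy', h'⟩
    · exact ⟨y, hy, by rw [hz y hy hyA, mul_zero, zero_smul, add_zero]⟩

/-- A point of a manifold with boundary is either an interior point or lies on the boundary of a
half-space. -/
theorem range_mem_nhds_or (hI : IsBoundaryModel I) (p : M) :
    Set.range I ∈ 𝓝 (extChartAt I p p) ∨
      ∃ φ : EuclideanSpace ℝ (Fin d) →L[ℝ] ℝ, φ ≠ 0 ∧ Set.range I = {v | 0 ≤ φ v} ∧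
        φ (extChartAt I p p) = 0 := by
  rcases hI with h | ⟨φ, hφ, h⟩
  · left; rw [h]; exact Filter.univ_mem
  · have hp : 0 ≤ φ (extChartAt I p p) := by
      have : extChartAt I p p ∈ Set.range I := by simp
      rw [h] at this; exact this
    rcases hp.eq_or_lt with h0 | h0
    · exact Or.inr ⟨φ, hφ, h, h0.symm⟩
    · left
      rw [h]
      filter_upwards [(isOpen_lt continuous_const φ.continuous).mem_nhds h0] with a ha
      exact le_of_lt ha

variable [T2Space M]

/-- Near an interior point, any point can be moved to any other one by a displacement in a chart. -/
theorem exists_nhds_isChartPush {p : M} (hp : Set.range I ∈ 𝓝 (extChartAt I p p)) {V : Set M}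
    (hV : IsOpen V) (hVs : V ⊆ (chartAt H p).source) (hpV : p ∈ V) :
    ∃ O ∈ 𝓝 p, ∀ y ∈ O, ∀ y' ∈ O, ∃ A χ v, y ∈ V ∧ y' ∈ V ∧ IsChartPush I p V A χ v ∧
      ∀ {X : Type _} [TopologicalSpace X] (f g : X → M), Continuous f →
        IsPushOf I p V A χ v (fun _ => 1) f g →
        (∀ x, g x = y' ↔ f x = y) ∧ ∀ x, f x = y →
          ∀ᶠ a in 𝓝 x, extChartAt I p (g a) = extChartAt I p (f a) + v := by
  obtain ⟨R₁, hR₁, hball₁⟩ := exists_ball_inter_range_subset_image (I := I) p hV hpV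
  obtain ⟨R₂, hR₂, hball₂⟩ := Metric.mem_nhds_iff.1 hp
  -- The factor 2 leaves room for points of the `R`-ball to be displaced without leaving the range
  -- of the model.
  obtain ⟨R, hR, hRR₁, hRR₂⟩ : ∃ R, 0 < R ∧ R ≤ R₁ ∧ 2 * R ≤ R₂ :=
    ⟨min R₁ (R₂ / 2), by positivity, min_le_left _ _, by linarith [min_le_right R₁ (R₂ / 2)]⟩
  obtain ⟨χ, A, hχ', hχ, hpush⟩ := exists_isChartPush (I := I) hV hVs hR
    ((Set.inter_subset_inter_left _ (Metric.ball_subset_ball hRR₁)).trans hball₁)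
  have hψ : ∀ y ∈ V, y ∈ (extChartAt I p).source := fun y hy => by
    rw [extChartAt_source]; exact hVs hy
  -- Radius `R / 12` gives `‖v‖ < R / 6`. Then `y`, and any point that lands on `y'`, lies within `R
  -- / 3` of the centre, where the cutoff is 1 and the displacement is exactly `v`.
  refine ⟨V ∩ extChartAt I p ⁻¹' Metric.ball (extChartAt I p p) (R / 12),
    Filter.inter_mem (hV.mem_nhds hpV)
      ((continuousAt_extChartAt p).preimage_mem_nhds (Metric.ball_mem_nhds _ (by positivity))), ?_⟩
  rintro y ⟨hyV, hyb⟩ y' ⟨hyV', hyb'⟩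
  have hyb : ‖extChartAt I p y - extChartAt I p p‖ < R / 12 := by
    rw [← dist_eq_norm]; exact hyb
  have hyb' : ‖extChartAt I p y' - extChartAt I p p‖ < R / 12 := by
    rw [← dist_eq_norm]; exact hyb'
  obtain ⟨v, hvdef⟩ : ∃ v, v = extChartAt I p y' - extChartAt I p y := ⟨_, rfl⟩
  have hv : ‖v‖ < R / 6 := by
    rw [hvdef, ← sub_sub_sub_cancel_right _ _ (extChartAt I p p)]
    exact (norm_sub_le _ _).trans_lt (by linarith)
  have hsv : ∀ s ∈ Set.Icc (0 : ℝ) 1, ‖s • v‖ < R / 6 := by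
    intro s hs
    rw [norm_smul, Real.norm_of_nonneg hs.1]
    exact (mul_le_of_le_one_left (norm_nonneg _) hs.2).trans_lt hv
  have hP : IsChartPush I p V A χ v := by
    refine hpush v (by linarith) fun x hx s hs => hball₂ ?_
    have h1 := Metric.mem_ball.1 hx.1
    rw [dist_eq_norm] at h1
    rw [Metric.mem_ball, dist_eq_norm, add_sub_right_comm]
    exact (norm_add_le _ _).trans_lt (by linarith [hsv s hs])
  refine ⟨A, χ, v, hyV, hyV', hP, fun {X} _ f g hf hg => ?_⟩
  have hone : ∀ z, f z = y → ∀ᶠ a in 𝓝 z, f a ∈ V ∧ χ (extChartAt I p (f a)) = 1 := by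
    intro z hz
    have hO : V ∩ extChartAt I p ⁻¹' Metric.ball (extChartAt I p p) (R / 3) ∈ 𝓝 (f z) := by
      rw [hz]
      refine Filter.inter_mem (hV.mem_nhds hyV)
        ((continuousAt_extChartAt' (hψ y hyV)).preimage_mem_nhds (Metric.isOpen_ball.mem_nhds ?_))
      rw [Metric.mem_ball, dist_eq_norm]
      linarith
    filter_upwards [hf.continuousAt hO] with a ha
    exact ⟨ha.1, hχ _ ha.2⟩
  refine ⟨fun z => ⟨fun hz => ?_, fun hz => ?_⟩, fun z hz => ?_⟩
  · have hzV : f z ∈ V := by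
      by_contra hcon
      rw [hg.eq_of_notMem z fun hA => hcon (hP.subset hA)] at hz
      exact hcon (hz ▸ hyV')
    have h1 := hg.eq z hzV
    rw [hz] at h1
    have hb : extChartAt I p (f z) ∈ Metric.ball (extChartAt I p p) (R / 3) := by
      rw [one_mul] at h1
      rw [Metric.mem_ball, dist_eq_norm, eq_sub_of_add_eq h1.symm, sub_right_comm]
      exact (norm_sub_le _ _).trans_lt (by linarith [hsv _ (hχ' (extChartAt I p (f z)))])
    rw [hχ _ hb, one_mul, one_smul, hvdef] at h1
    refine (extChartAt I p).injOn (hψ _ hzV) (hψ _ hyV) ?_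
    have h2 := sub_eq_of_eq_add h1
    rw [sub_sub_cancel] at h2
    exact h2.symm
  · obtain ⟨hzV, h1⟩ := (hone z hz).self_of_nhds
    refine (extChartAt I p).injOn (hψ _ (hg.mem z hzV)) (hψ _ hyV') ?_
    rw [hg.eq z hzV, h1, one_mul, one_smul, hz, hvdef, add_sub_cancel]
  · filter_upwards [hone z hz] with a ha
    rw [hg.eq a ha.1, ha.2, one_mul, one_smul]

/-- Near a boundary point, every map can be moved off a neighbourhood of the point. -/
theorem exists_isChartPush_notMem {p : M} {φ : EuclideanSpace ℝ (Fin d) →L[ℝ] ℝ} (hφ : φ ≠ 0)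
    (hφI : Set.range I = {v | 0 ≤ φ v}) (hφp : φ (extChartAt I p p) = 0) {V : Set M}
    (hV : IsOpen V) (hVs : V ⊆ (chartAt H p).source) (hpV : p ∈ V) :
    ∃ O ∈ 𝓝 p, ∃ A χ v, IsChartPush I p V A χ v ∧
      ∀ {X : Type _} (f g : X → M), IsPushOf I p V A χ v (fun _ => 1) f g → ∀ x, g x ∉ O := by
  obtain ⟨R, hR, hball⟩ := exists_ball_inter_range_subset_image (I := I) p hV hpV
  obtain ⟨χ, A, hχ', hχ, hpush⟩ := exists_isChartPush (I := I) hV hVs hR hball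
  -- A vector pointing into the half-space: moving along it never leaves the range of the model.
  obtain ⟨v, hv, hφv⟩ : ∃ v, ‖v‖ < R / 6 ∧ 0 < φ v := by
    obtain ⟨w, hw⟩ : ∃ w, 0 < φ w := by
      obtain ⟨w, hw⟩ := DFunLike.ne_iff.1 hφ
      rcases lt_or_gt_of_ne hw with h | h
      · exact ⟨-w, by rw [map_neg]; exact neg_pos.2 h⟩
      · exact ⟨w, h⟩
    refine ⟨(R / (6 * (‖w‖ + 1))) • w, ?_, ?_⟩
    · rw [norm_smul, Real.norm_of_nonneg (by positivity), div_mul_eq_mul_div,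
        div_lt_div_iff₀ (by positivity) (by norm_num)]
      nlinarith [norm_nonneg w]
    · rw [map_smul, smul_eq_mul]
      positivity
  have hP : IsChartPush I p V A χ v := by
    refine hpush v (by linarith) fun x hx s hs => ?_
    have h1 := hx.2
    rw [hφI] at h1 ⊢
    change 0 ≤ φ (x + s • v)
    rw [map_add, map_smul, smul_eq_mul]
    exact add_nonneg h1 (mul_nonneg hs.1 hφv.le)
  -- A displaced point in this set would have moved by the full `v`, hence come from a point with `φ
  -- < 0`, outside the half-space.
  refine ⟨V ∩ extChartAt I p ⁻¹' (Metric.ball (extChartAt I p p) (R / 6) ∩ {x | φ x < φ v}),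
    Filter.inter_mem (hV.mem_nhds hpV) ((continuousAt_extChartAt p).preimage_mem_nhds
      (Filter.inter_mem (Metric.ball_mem_nhds _ (by positivity))
        ((isOpen_lt φ.continuous continuous_const).mem_nhds (by rwa [Set.mem_ofPred_eq, hφp])))),
    A, χ, v, hP, ?_⟩
  rintro X f g hg x ⟨hxV, hxb, hxφ⟩
  have hxV' : f x ∈ V := by
    by_contra hcon
    rw [hg.eq_of_notMem x fun hA => hcon (hP.subset hA)] at hxV
    exact hcon hxV
  have h1 := hg.eq x hxV'
  rw [one_mul] at h1
  have hb : extChartAt I p (f x) ∈ Metric.ball (extChartAt I p p) (R / 3) := by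
    have hxb' := Metric.mem_ball.1 hxb
    rw [dist_eq_norm] at hxb'
    have h2 := hχ' (extChartAt I p (f x))
    have h3 : ‖χ (extChartAt I p (f x)) • v‖ < R / 6 := by
      rw [norm_smul, Real.norm_of_nonneg h2.1]
      exact (mul_le_of_le_one_left (norm_nonneg _) h2.2).trans_lt hv
    rw [Metric.mem_ball, dist_eq_norm, eq_sub_of_add_eq h1.symm, sub_right_comm]
    exact (norm_sub_le _ _).trans_lt (by linarith)
  rw [hχ _ hb, one_smul] at h1
  have h4 : 0 ≤ φ (extChartAt I p (f x)) := by
    have : extChartAt I p (f x) ∈ Set.range I := extChartAt_target_subset_range p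
      ((extChartAt I p).map_source (by rw [extChartAt_source]; exact hVs hxV'))
    rw [hφI] at this
    exact this
  have h5 : φ (extChartAt I p (g x)) < φ v := hxφ
  rw [h1, map_add] at h5
  linarith

end Existence

/-! ### The degree of a map on the product with the circle -/

section OmittedValue

variable {n : ℕ} {N : Type*} [TopologicalSpace N] [ChartedSpace (EuclideanSpace ℝ (Fin n)) N]
  {H : Type*} [TopologicalSpace H] {I : ModelWithCorners ℝ (EuclideanSpace ℝ (Fin (n + 1))) H}
  {M : Type*} [TopologicalSpace M] [ChartedSpace H M]
  {L : Type*} [TopologicalSpace L] {J : ModelWithCorners ℝ (EuclideanSpace ℝ (Fin 1)) L}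
  {P : Type*} [TopologicalSpace P] [ChartedSpace L P]

theorem isRegularValue_of_forall_ne {G : C^∞⟮(𝓡 n).prod J, N × P; I, M⟯} {y : M}
    (h : ∀ z, G z ≠ y) : IsRegularValue G y := fun z hz => absurd hz (h z)

variable [IsManifold (𝓡 n) ∞ N] [IsManifold I ∞ M]

theorem signedCount_of_forall_ne (oN : MfdOrientation (𝓡 n) N) (oM : MfdOrientation I M)
    {τ : ∀ t : P, TangentSpace J t} {G : C^∞⟮(𝓡 n).prod J, N × P; I, M⟯} {y : M}
    (h : ∀ z, G z ≠ y) : signedCount oN oM τ G y = 0 := by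
  unfold signedCount
  have : G ⁻¹' {y} = ∅ := Set.eq_empty_of_forall_notMem h
  rw [this, finsum_mem_empty]

end OmittedValue

section Degree

variable {n : ℕ} {N : Type*} [TopologicalSpace N] [ChartedSpace (EuclideanSpace ℝ (Fin n)) N]
  [IsManifold (𝓡 n) ∞ N]
  {H : Type*} [TopologicalSpace H] {I : ModelWithCorners ℝ (EuclideanSpace ℝ (Fin (n + 1))) H}
  {M : Type*} [TopologicalSpace M] [ChartedSpace H M] [IsManifold I ∞ M]
  {oN : MfdOrientation (𝓡 n) N} {oM : MfdOrientation I M} [CompactSpace N] [T2Space N] [T2Space M]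

/-- The value `y` may be critical for the intermediate map. Since the outer counts are locally
constant, `y` can be replaced by a nearby value regular for all three maps. -/
theorem signedCount_eq_trans (hn : 1 ≤ n) {G₀ G₁ G₂ : C^∞⟮(𝓡 n).prod (𝓡 1), N × Circle; I, M⟯}
    (h₀₁ : ∀ y, IsRegularValue G₀ y → IsRegularValue G₁ y →
      signedCount oN oM circleUnitVector G₀ y = signedCount oN oM circleUnitVector G₁ y)
    (h₁₂ : ∀ y, IsRegularValue G₁ y → IsRegularValue G₂ y →
      signedCount oN oM circleUnitVector G₁ y = signedCount oN oM circleUnitVector G₂ y)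
    {y : M} (hy₀ : IsRegularValue G₀ y) (hy₂ : IsRegularValue G₂ y) :
    signedCount oN oM circleUnitVector G₀ y = signedCount oN oM circleUnitVector G₂ y := by
  obtain ⟨y', ⟨h0, h2⟩, h1⟩ := exists_isRegularValue_mem hn oN oM (fun _ : Unit => G₁)
    ((eventually_signedCount_eq hn oN oM G₀ hy₀).and (eventually_signedCount_eq hn oN oM G₂ hy₂))
  rw [← h0.2, ← h2.2, h₀₁ y' h0.1 (h1 ()), h₁₂ y' (h1 ()) h2.1]

/-- A displacement in an oriented chart does not change signed counts. -/
theorem signedCount_eq_of_isPushOf (hn : 1 ≤ n) {p : M} {V A : Set M}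
    {c : Module.Basis (Fin (n + 1)) ℝ (EuclideanSpace ℝ (Fin (n + 1)))}
    (hV : IsOrientedNhd oM p V c) {χ : EuclideanSpace ℝ (Fin (n + 1)) → ℝ}
    {v : EuclideanSpace ℝ (Fin (n + 1))} (h : IsChartPush I p V A χ v)
    {G G₁ : C^∞⟮(𝓡 n).prod (𝓡 1), N × Circle; I, M⟯}
    (h₁ : IsPushOf I p V A χ v (fun _ => 1) G G₁) {y : M}
    (hy₀ : IsRegularValue G y) (hy₁ : IsRegularValue G₁ y) :
    signedCount oN oM circleUnitVector G y = signedCount oN oM circleUnitVector G₁ y := by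
  classical
  choose e B he hz using exists_isOrientedParam hn oN
  obtain ⟨t, -, ht⟩ := (isCompact_univ (X := N × Circle)).elim_nhds_subcover
    (fun z => (e z).target) fun z _ => (e z).open_target.mem_nhds (hz z)
  obtain ⟨ρ, hρ⟩ := SmoothPartitionOfUnity.exists_isSubordinate ((𝓡 n).prod (𝓡 1))
    (isClosed_univ (X := N × Circle)) (fun z : t => (e z).target) (fun z => (e z).open_target)
    (fun a _ => by
      obtain ⟨z, hz, ha⟩ := Set.mem_iUnion₂.1 (ht (Set.mem_univ a))
      exact Set.mem_iUnion.2 ⟨⟨z, hz⟩, ha⟩)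
  obtain ⟨η, hη, hηV, hηA⟩ := h.exists_contMDiff
  have hρs : ∀ i, ContMDiff ((𝓡 n).prod (𝓡 1)) 𝓘(ℝ, ℝ) ∞ (ρ i) := fun i => (ρ i).contMDiff
  have hsum : ∀ z, ∑ i, ρ i z = 1 := fun z => by
    rw [← finsum_eq_sum_of_fintype]; exact ρ.sum_eq_one (Set.mem_univ z)
  have hσs : ∀ T : Finset t, ContMDiff ((𝓡 n).prod (𝓡 1)) 𝓘(ℝ, ℝ) ∞ (fun z => ∑ i ∈ T, ρ i z) :=
    fun T => contMDiff_finsetSum fun i _ => hρs i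
  have hσ' : ∀ (T : Finset t) (z : N × Circle), ∑ i ∈ T, ρ i z ∈ Set.Icc (0 : ℝ) 1 := by
    intro T z
    refine ⟨Finset.sum_nonneg fun i _ => ρ.nonneg i z, ?_⟩
    rw [← hsum z]
    exact Finset.sum_le_sum_of_subset_of_nonneg (Finset.subset_univ _) fun i _ _ => ρ.nonneg i z
  -- The displacement is switched on one partition function at a time, so that each stage changes
  -- the map inside a single oriented parametrization, in the fixed direction `v`.
  have main : ∀ T : Finset t, ∀ G' : C^∞⟮(𝓡 n).prod (𝓡 1), N × Circle; I, M⟯,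
      IsPushOf I p V A χ v (fun z => ∑ i ∈ T, ρ i z) G G' → ∀ y, IsRegularValue G y →
      IsRegularValue G' y →
      signedCount oN oM circleUnitVector G y = signedCount oN oM circleUnitVector G' y := by
    intro T
    induction T using Finset.induction_on with
    | empty =>
      intro G' hG' y _ _
      have : G' = G := by
        ext z
        by_cases hz : G z ∈ V
        · refine (extChartAt I p).injOn ?_ ?_ ?_
          · rw [extChartAt_source]; exact h.subset_source (hG'.mem z hz)
          · rw [extChartAt_source]; exact h.subset_source hz
          · simpa using hG'.eq z hz
        · exact hG'.eq_of_notMem z fun hA => hz (h.subset hA)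
      rw [this]
    | insert i T hi ih =>
      intro G' hG' y hy hy'
      obtain ⟨GT, hGT⟩ := h.exists_isPushOf G (hσs T) (hσ' T)
      have hback : ∀ z, GT z ∈ V → G z ∈ V := by
        intro z hz
        by_contra hcon
        rw [hGT.eq_of_notMem z fun hA => hcon (h.subset hA)] at hz
        exact hcon hz
      refine signedCount_eq_trans hn (ih GT hGT) (fun y hyT hy' => ?_) hy hy'
      refine signedCount_eq_of_local_modification hn (he i) hV
        (K := tsupport (ρ i) ∩ G ⁻¹' A) (u := fun z => ρ i z * η (G z)) (v := v)
        ((isClosed_tsupport _).inter (h.isClosed.preimage G.contMDiff.continuous))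
        (Set.inter_subset_left.trans (hρ i)) (fun z hz => hGT.mem z (h.subset hz.2))
        ((hρs i).mul (hη.comp G.contMDiff)) ?_ ?_ ?_ hyT hy'
      · intro z hz
        by_cases hzA : G z ∈ A
        · have : ρ i z = 0 := image_eq_zero_of_notMem_tsupport fun h => hz ⟨h, hzA⟩
          simp only [this, zero_mul]
        · simp only [hηA _ hzA, mul_zero]
      · intro z hz
        have hzV := hback z hz
        refine ⟨hG'.mem z hzV, ?_⟩
        rw [hG'.eq z hzV, hGT.eq z hzV, hηV _ hzV, Finset.sum_insert hi, add_assoc, ← add_smul]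
        congr 2
        ring
      · intro z hz
        by_cases hzA : G z ∈ A
        · have h0 : ρ i z = 0 := image_eq_zero_of_notMem_tsupport fun h => hz ⟨h, hzA⟩
          have hzV := h.subset hzA
          refine (extChartAt I p).injOn ?_ ?_ ?_
          · rw [extChartAt_source]; exact h.subset_source (hG'.mem z hzV)
          · rw [extChartAt_source]; exact h.subset_source (hGT.mem z hzV)
          · rw [hG'.eq z hzV, hGT.eq z hzV, Finset.sum_insert hi, h0, zero_add]
        · rw [hG'.eq_of_notMem z hzA, hGT.eq_of_notMem z hzA]
  refine main Finset.univ G₁ ?_ y hy₀ hy₁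
  simpa only [hsum] using h₁

/-- Near an interior point, all regular values have the same signed count. -/
theorem exists_nhds_signedCount_eq (hn : 1 ≤ n) {p : M}
    (hp : Set.range I ∈ 𝓝 (extChartAt I p p))
    (G : C^∞⟮(𝓡 n).prod (𝓡 1), N × Circle; I, M⟯) :
    ∃ O ∈ 𝓝 p, ∀ y ∈ O, ∀ y' ∈ O, IsRegularValue G y → IsRegularValue G y' →
      signedCount oN oM circleUnitVector G y = signedCount oN oM circleUnitVector G y' := by
  obtain ⟨V, c, hV, hpV⟩ := exists_isOrientedNhd (by omega) oM p
  obtain ⟨O, hO, h⟩ := exists_nhds_isChartPush hp hV.isOpen hV.subset_source hpV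
  refine ⟨O, hO, fun y hyO y' hyO' hy hy' => ?_⟩
  obtain ⟨A, χ, v, hyV, hyV', hP, h⟩ := h y hyO y' hyO'
  obtain ⟨G₁, hG₁⟩ := hP.exists_isPushOf G (σ := fun _ => 1) contMDiff_const (fun _ => by simp)
  obtain ⟨hset, hnear⟩ := h G G₁ G.contMDiff.continuous hG₁
  have hcongr : ∀ z, G z = y → _ := fun z hz =>
    preservesOrientationAt_congr hn oN hV (G := G) (G' := G₁) (z := z) (hz ▸ hyV)
      ((hset z).2 hz ▸ hyV') v (hnear z hz)
  have hy₁ : IsRegularValue G₁ y' := fun z hz =>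
    (hcongr z ((hset z).1 hz)).1.1 (hy z ((hset z).1 hz))
  -- The displacement takes the fibre over `y` to the fibre of `G₁` over `y'` with the same signs,
  -- while leaving the count at `y'` unchanged.
  rw [signedCount_eq_of_isPushOf hn hV hP hG₁ hy' hy₁]
  unfold signedCount
  have : G₁ ⁻¹' {y'} = G ⁻¹' {y} := Set.ext hset
  rw [this]
  exact finsum_mem_congr rfl fun z hz => (hcongr z hz).2

/-- Near a boundary point, the signed count of regular values vanishes. -/
theorem exists_nhds_signedCount_eq_zero (hn : 1 ≤ n) {p : M}
    {φ : EuclideanSpace ℝ (Fin (n + 1)) →L[ℝ] ℝ} (hφ : φ ≠ 0)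
    (hφI : Set.range I = {v | 0 ≤ φ v}) (hφp : φ (extChartAt I p p) = 0)
    (G : C^∞⟮(𝓡 n).prod (𝓡 1), N × Circle; I, M⟯) :
    ∃ O ∈ 𝓝 p, ∀ y ∈ O, IsRegularValue G y → signedCount oN oM circleUnitVector G y = 0 := by
  obtain ⟨V, c, hV, hpV⟩ := exists_isOrientedNhd (by omega) oM p
  obtain ⟨O, hO, A, χ, v, hP, h⟩ :=
    exists_isChartPush_notMem hφ hφI hφp hV.isOpen hV.subset_source hpV
  obtain ⟨G₁, hG₁⟩ := hP.exists_isPushOf G (σ := fun _ => 1) contMDiff_const (fun _ => by simp)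
  refine ⟨O, hO, fun y hyO hy => ?_⟩
  have hne : ∀ z, G₁ z ≠ y := fun z hz => h G G₁ hG₁ z (hz ▸ hyO)
  rw [signedCount_eq_of_isPushOf hn hV hP hG₁ hy (isRegularValue_of_forall_ne hne),
    signedCount_of_forall_ne oN oM hne]

variable [ConnectedSpace M]

/-- The degree: all regular values have the same signed count, which vanishes if the target is not
closed. -/
theorem exists_degree (hn : 1 ≤ n) (hI : IsBoundaryModel I) (oN : MfdOrientation (𝓡 n) N)
    (oM : MfdOrientation I M)
    (G : C^∞⟮(𝓡 n).prod (𝓡 1), N × Circle; I, M⟯) :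
    ∃ d : ℤ, (∀ y, IsRegularValue G y → signedCount oN oM circleUnitVector G y = d) ∧
      (¬ (CompactSpace M ∧ BoundarylessManifold I M) → d = 0) := by
  have hloc : ∀ p : M, ∃ d : ℤ, ∀ᶠ y in 𝓝 p, IsRegularValue G y →
      signedCount oN oM circleUnitVector G y = d := by
    intro p
    rcases range_mem_nhds_or hI p with hp | ⟨φ, hφ, hφI, hφp⟩
    · obtain ⟨O, hO, h⟩ := exists_nhds_signedCount_eq (oN := oN) (oM := oM) hn hp G
      obtain ⟨y, hyO, hy⟩ := exists_isRegularValue_mem hn oN oM (fun _ : Unit => G) hO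
      refine ⟨signedCount oN oM circleUnitVector G y, ?_⟩
      filter_upwards [hO] with y' hy'O hy' using h y' hy'O y hyO hy' (hy ())
    · obtain ⟨O, hO, h⟩ := exists_nhds_signedCount_eq_zero (oN := oN) (oM := oM) hn hφ hφI hφp G
      exact ⟨0, by filter_upwards [hO] with y' hy'O hy' using h y' hy'O hy'⟩
  choose d hd using hloc
  -- Regular values are dense, so two local values valid near the same point must agree; hence the
  -- local value is locally constant.
  have huniq : ∀ p p', (∀ᶠ y in 𝓝 p, IsRegularValue G y →
      signedCount oN oM circleUnitVector G y = d p') → d p = d p' := by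
    intro p p' h
    obtain ⟨y, hyO, hy⟩ := exists_isRegularValue_mem hn oN oM (fun _ : Unit => G) ((hd p).and h)
    exact (hyO.1 (hy ())).symm.trans (hyO.2 (hy ()))
  have hlc : IsLocallyConstant d := (IsLocallyConstant.iff_eventually_eq d).2 fun p => by
    filter_upwards [(hd p).eventually_nhds] with p' hp' using huniq p' p hp'
  obtain ⟨p₀⟩ : Nonempty M := inferInstance
  have hconst : ∀ p, d p = d p₀ := fun p => hlc.apply_eq_of_isPreconnected isPreconnected_univ
    (Set.mem_univ _) (Set.mem_univ _)
  have hall : ∀ y, IsRegularValue G y → signedCount oN oM circleUnitVector G y = d p₀ :=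
    fun y hy => ((hd y).self_of_nhds hy).trans (hconst y)
  refine ⟨d p₀, hall, fun hM => ?_⟩
  by_cases hc : CompactSpace M
  · have hb : ¬ BoundarylessManifold I M := fun h => hM ⟨hc, h⟩
    obtain ⟨p, hp⟩ : ∃ p : M, ¬ I.IsInteriorPoint p := by
      by_contra! hcon
      exact hb ⟨fun x => hcon x⟩
    rcases range_mem_nhds_or hI p with hp' | ⟨φ, hφ, hφI, hφp⟩
    · exact absurd (mem_interior_iff_mem_nhds.2 hp') hp
    · obtain ⟨O, hO, h⟩ := exists_nhds_signedCount_eq_zero (oN := oN) (oM := oM) hn hφ hφI hφp G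
      obtain ⟨y, hyO, hy⟩ := exists_isRegularValue_mem hn oN oM (fun _ : Unit => G) hO
      rw [← hall y (hy ()), h y hyO (hy ())]
  -- The image of the compact source is compact, so it cannot be all of a noncompact target; an
  -- omitted value is regular with count zero.
  · have : ∃ y, ∀ z, G z ≠ y := by
      by_contra! hcon
      refine hc ⟨?_⟩
      rw [← Set.range_eq_univ.2 fun y => hcon y]
      exact isCompact_range G.contMDiff.continuous
    obtain ⟨y, hy⟩ := this
    rw [← hall y (isRegularValue_of_forall_ne hy), signedCount_of_forall_ne oN oM hy]

end Degree

end AffineWinding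

end

noncomputable section

namespace AffineWinding

/-! ### Regularity and signs through partial derivatives, and change of parameter -/

section Slices

variable {n : ℕ} {N : Type*} [TopologicalSpace N] [ChartedSpace (EuclideanSpace ℝ (Fin n)) N]
  {H : Type*} [TopologicalSpace H]
  (I : ModelWithCorners ℝ (EuclideanSpace ℝ (Fin (n + 1))) H)
  {M : Type*} [TopologicalSpace M] [ChartedSpace H M]
  {F : Type*} [NormedAddCommGroup F] [NormedSpace ℝ F] {L : Type*} [TopologicalSpace L]
  (J : ModelWithCorners ℝ F L) {P : Type*} [TopologicalSpace P] [ChartedSpace L P]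
  {F' : Type*} [NormedAddCommGroup F'] [NormedSpace ℝ F'] {L' : Type*} [TopologicalSpace L']
  {J' : ModelWithCorners ℝ F' L'} {P' : Type*} [TopologicalSpace P'] [ChartedSpace L' P']

/-- The derivative in the direction of the first factor. -/
def sliceLeft (h : N × P → M) (z : N × P) :
    EuclideanSpace ℝ (Fin n) →L[ℝ] EuclideanSpace ℝ (Fin (n + 1)) :=
  mfderiv (𝓡 n) I (fun x => h (x, z.2)) z.1

/-- The derivative in the direction of the second factor. -/
def sliceRightMap (h : N × P → M) (z : N × P) : F →L[ℝ] EuclideanSpace ℝ (Fin (n + 1)) :=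
  mfderiv J I (fun t => h (z.1, t)) z.2

/-- The derivative in the direction of a vector field on the second factor. -/
def sliceRight (τ : ∀ t : P, TangentSpace J t) (h : N × P → M) (z : N × P) :
    EuclideanSpace ℝ (Fin (n + 1)) :=
  sliceRightMap I J h z (τ z.2)

/-- The two derivatives of `h` at `z` span the tangent space of the target. -/
def IsSliceRegular (τ : ∀ t : P, TangentSpace J t) (h : N × P → M) (z : N × P) : Prop :=
  Submodule.span ℝ {sliceRight I J τ h z} ⊔ (sliceLeft I h z).range = ⊤

/-- The point `y` is a regular value of the restriction of `h` to `N × Q`. -/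
def IsRegularOn (τ : ∀ t : P, TangentSpace J t) (h : N × P → M) (y : M) (Q : Set P) : Prop :=
  ∀ z, z.2 ∈ Q → h z = y → IsSliceRegular I J τ h z

variable {I J}

/-- By the chain rule a change of parameter leaves the derivative along `N` alone and multiplies the
other by `r`. This lets the interval, the line and the circle be compared. -/
theorem slice_reparam {h : N × P → M} {h' : N × P' → M} {γ : P → P'} {z : N × P}
    {τ : ∀ t : P, TangentSpace J t} {τ' : ∀ t : P', TangentSpace J' t} {r : ℝ}
    (hγ : MDifferentiableAt J J' γ z.2)
    (hh' : MDifferentiableAt J' I (fun t => h' (z.1, t)) (γ z.2))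
    (heq : ∀ᶠ t in 𝓝 z.2, ∀ x, h (x, t) = h' (x, γ t))
    (hr : mfderiv J J' γ z.2 (τ z.2) = r • τ' (γ z.2)) :
    sliceLeft I h z = sliceLeft I h' (z.1, γ z.2) ∧
      sliceRight I J τ h z = r • sliceRight I J' τ' h' (z.1, γ z.2) := by
  have h1 : (fun x => h (x, z.2)) = fun x => h' (x, γ z.2) := funext heq.self_of_nhds
  refine ⟨?_, ?_⟩
  · unfold sliceLeft
    have h2 : ∀ f g : N → M, f = g →
        @Eq (EuclideanSpace ℝ (Fin n) →L[ℝ] EuclideanSpace ℝ (Fin (n + 1)))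
          (mfderiv (𝓡 n) I f z.1) (mfderiv (𝓡 n) I g z.1) := by rintro f _ rfl; rfl
    exact h2 _ _ h1
  · have h2 : HasMFDerivAt J I (fun t => h (z.1, t)) z.2
        ((mfderiv J' I (fun t => h' (z.1, t)) (γ z.2)).comp (mfderiv J J' γ z.2)) := by
      refine (hh'.hasMFDerivAt.comp z.2 hγ.hasMFDerivAt).congr_of_eventuallyEq ?_
      filter_upwards [heq] with t ht using ht z.1
    unfold sliceRight sliceRightMap
    have h3 : mfderiv J I (fun t => h (z.1, t)) z.2 (τ z.2) =
        mfderiv J' I (fun t => h' (z.1, t)) (γ z.2) (mfderiv J J' γ z.2 (τ z.2)) := by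
      rw [h2.mfderiv]; rfl
    refine h3.trans ?_
    have h4 := congrArg (mfderiv J' I (fun t => h' (z.1, t)) (γ z.2)) hr
    exact h4.trans (map_smul _ _ _)

theorem isSliceRegular_reparam {h : N × P → M} {h' : N × P' → M} {γ : P → P'} {z : N × P}
    {τ : ∀ t : P, TangentSpace J t} {τ' : ∀ t : P', TangentSpace J' t} {r : ℝ} (hr0 : r ≠ 0)
    (hγ : MDifferentiableAt J J' γ z.2)
    (hh' : MDifferentiableAt J' I (fun t => h' (z.1, t)) (γ z.2))
    (heq : ∀ᶠ t in 𝓝 z.2, ∀ x, h (x, t) = h' (x, γ t))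
    (hr : mfderiv J J' γ z.2 (τ z.2) = r • τ' (γ z.2)) :
    IsSliceRegular I J τ h z ↔ IsSliceRegular I J' τ' h' (z.1, γ z.2) := by
  obtain ⟨h1, h2⟩ := slice_reparam hγ hh' heq hr
  unfold IsSliceRegular
  rw [h1, h2, Submodule.span_singleton_smul_eq hr0.isUnit]

/-- `h` is obtained from `h'` over `Q` by a change `γ` of the parameter in the second factor, which
preserves or reverses the orientation according to the sign `ε`. -/
structure IsReparam (τ : ∀ t : P, TangentSpace J t) (τ' : ∀ t : P', TangentSpace J' t)
    (h : N × P → M) (h' : N × P' → M) (γ : P → P') (Q : Set P) (Q' : Set P') (ε : ℤ) : Prop where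
  sign : ε = 1 ∨ ε = -1
  bijOn : Set.BijOn γ Q Q'
  eq : ∀ t ∈ Q, ∀ᶠ t' in 𝓝 t, ∀ x, h (x, t') = h' (x, γ t')
  deriv : ∀ t ∈ Q, MDifferentiableAt J J' γ t ∧
    ∃ r : ℝ, 0 < ε * r ∧ mfderiv J J' γ t (τ t) = r • τ' (γ t)

theorem IsReparam.bijOn_preimage {h : N × P → M} {h' : N × P' → M} {γ : P → P'} {Q : Set P}
    {Q' : Set P'} {τ : ∀ t : P, TangentSpace J t} {τ' : ∀ t : P', TangentSpace J' t} {ε : ℤ}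
    (hγ : IsReparam τ τ' h h' γ Q Q' ε) (y : M) :
    Set.BijOn (fun z : N × P => (z.1, γ z.2)) {z | z.2 ∈ Q ∧ h z = y} {z | z.2 ∈ Q' ∧ h' z = y} := by
  have hval : ∀ z : N × P, z.2 ∈ Q → h z = h' (z.1, γ z.2) := fun z hz =>
    (hγ.eq z.2 hz).self_of_nhds z.1
  refine ⟨?_, ?_, ?_⟩
  · rintro z ⟨hz, rfl⟩
    exact ⟨hγ.bijOn.mapsTo hz, (hval z hz).symm⟩
  · rintro z ⟨hz, -⟩ w ⟨hw, -⟩ hzw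
    exact Prod.ext (Prod.ext_iff.1 hzw).1 (hγ.bijOn.injOn hz hw (Prod.ext_iff.1 hzw).2)
  · rintro ⟨x, t'⟩ ⟨ht', hy⟩
    obtain ⟨t, ht, rfl⟩ := hγ.bijOn.surjOn ht'
    exact ⟨(x, t), ⟨ht, (hval (x, t) ht).trans hy⟩, rfl⟩

theorem IsReparam.isRegularOn_iff {h : N × P → M} {h' : N × P' → M} {γ : P → P'} {Q : Set P}
    {Q' : Set P'} {τ : ∀ t : P, TangentSpace J t} {τ' : ∀ t : P', TangentSpace J' t} {ε : ℤ}
    (hγ : IsReparam τ τ' h h' γ Q Q' ε) (hh' : MDifferentiable ((𝓡 n).prod J') I h') (y : M) :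
    IsRegularOn I J τ h y Q ↔ IsRegularOn I J' τ' h' y Q' := by
  have key : ∀ z : N × P, z.2 ∈ Q →
      (IsSliceRegular I J τ h z ↔ IsSliceRegular I J' τ' h' (z.1, γ z.2)) := by
    intro z hz
    obtain ⟨h1, r, hr, h2⟩ := hγ.deriv z.2 hz
    exact isSliceRegular_reparam (right_ne_zero_of_mul hr.ne') h1
      ((hh' _).comp _ (mdifferentiableAt_const.prodMk mdifferentiableAt_id)) (hγ.eq _ hz) h2
  constructor
  · intro hreg z hz hy
    obtain ⟨w, hw, rfl⟩ := (hγ.bijOn_preimage y).surjOn ⟨hz, hy⟩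
    exact (key w hw.1).1 (hreg w hw.1 hw.2)
  · intro hreg z hz hy
    have := (hγ.bijOn_preimage y).mapsTo ⟨hz, hy⟩
    exact (key z hz).2 (hreg _ this.1 this.2)

variable [IsManifold (𝓡 n) ∞ N] [IsManifold I ∞ M]

/-- The orientation of a tangent space, as an orientation of the model space. -/
def MfdOrientation.model {d : ℕ} {I : ModelWithCorners ℝ (EuclideanSpace ℝ (Fin d)) H}
    {M : Type*} [TopologicalSpace M] [ChartedSpace H M] [IsManifold I ∞ M]
    (o : MfdOrientation I M) (x : M) : Orientation ℝ (EuclideanSpace ℝ (Fin d)) (Fin d) :=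
  o.orient x

open Classical in
/-- The sign of a point, in terms of the two derivatives. -/
def sliceSign (oN : MfdOrientation (𝓡 n) N) (oM : MfdOrientation I M)
    (τ : ∀ t : P, TangentSpace J t) (h : N × P → M) (z : N × P) : ℤ :=
  if FramePositive (oN.model z.1) (oM.model (h z)) (sliceLeft I h z).toLinearMap (sliceRight I J τ h z)
  then 1 else -1

/-- The sum of the signs of the preimages of `y` in `N × Q`. -/
def countOn (oN : MfdOrientation (𝓡 n) N) (oM : MfdOrientation I M)
    (τ : ∀ t : P, TangentSpace J t) (h : N × P → M) (y : M) (Q : Set P) : ℤ :=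
  ∑ᶠ z ∈ {z | z.2 ∈ Q ∧ h z = y}, sliceSign oN oM τ h z

variable {oN : MfdOrientation (𝓡 n) N} {oM : MfdOrientation I M}

theorem ite_sign_congr {p q : Prop} {_ : Decidable p} {_ : Decidable q} (h : p ↔ q) :
    (if p then (1 : ℤ) else -1) = if q then 1 else -1 := by
  simp only [h]

theorem ite_sign_congr_neg {p q : Prop} {_ : Decidable p} {_ : Decidable q} (h : p ↔ ¬ q) :
    (if p then (1 : ℤ) else -1) = -1 * if q then 1 else -1 := by
  by_cases hq : q <;> simp [h, hq]

/-- A positive factor on the last vector is invisible to orientations. A negative one exchanges the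
two signs, but only because regularity makes the frame nondegenerate: a degenerate frame would be
given `-1` in both cases. -/
theorem sliceSign_reparam (hn : 1 ≤ n) {h : N × P → M} {h' : N × P' → M} {γ : P → P'} {z : N × P}
    {τ : ∀ t : P, TangentSpace J t} {τ' : ∀ t : P', TangentSpace J' t} {r : ℝ} {ε : ℤ}
    (hε : ε = 1 ∨ ε = -1) (hr0 : 0 < ε * r)
    (hγ : MDifferentiableAt J J' γ z.2)
    (hh' : MDifferentiableAt J' I (fun t => h' (z.1, t)) (γ z.2))
    (heq : ∀ᶠ t in 𝓝 z.2, ∀ x, h (x, t) = h' (x, γ t))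
    (hr : mfderiv J J' γ z.2 (τ z.2) = r • τ' (γ z.2))
    (hreg : IsSliceRegular I J' τ' h' (z.1, γ z.2)) :
    sliceSign oN oM τ h z = ε * sliceSign oN oM τ' h' (z.1, γ z.2) := by
  obtain ⟨h1, h2⟩ := slice_reparam hγ hh' heq hr
  have h3 : h z = h' (z.1, γ z.2) := heq.self_of_nhds z.1
  unfold sliceSign
  rw [h1, h2, h3]
  rcases hε with rfl | rfl
  · rw [Int.cast_one, one_mul] at hr0
    rw [one_mul]
    exact ite_sign_congr (framePositive_smul_iff hr0)
  · have hr1 : 0 < -r := by simpa using hr0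
    have h4 : r • sliceRight I J' τ' h' (z.1, γ z.2) =
        (-r) • (-sliceRight I J' τ' h' (z.1, γ z.2)) := by rw [smul_neg, neg_smul, neg_neg]
    rw [h4]
    exact ite_sign_congr_neg ((framePositive_smul_iff hr1).trans
      (framePositive_neg_iff hn (by simp) (by simp) hreg))

theorem IsReparam.countOn_eq (hn : 1 ≤ n) {h : N × P → M} {h' : N × P' → M} {γ : P → P'} {Q : Set P}
    {Q' : Set P'} {τ : ∀ t : P, TangentSpace J t} {τ' : ∀ t : P', TangentSpace J' t} {ε : ℤ}
    (hγ : IsReparam τ τ' h h' γ Q Q' ε) (hh' : MDifferentiable ((𝓡 n).prod J') I h') {y : M}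
    (hy : IsRegularOn I J' τ' h' y Q') :
    countOn oN oM τ h y Q = ε * countOn oN oM τ' h' y Q' := by
  unfold countOn
  rw [finsum_mem_eq_of_bijOn (g := fun z => ε * sliceSign oN oM τ' h' z) _ (hγ.bijOn_preimage y)]
  · rw [mul_finsum_mem]
  · intro z hz
    obtain ⟨h1, r, hr, h2⟩ := hγ.deriv z.2 hz.1
    have := (hγ.bijOn_preimage y).mapsTo hz
    exact sliceSign_reparam hn hγ.sign hr h1
      ((hh' _).comp _ (mdifferentiableAt_const.prodMk mdifferentiableAt_id)) (hγ.eq _ hz.1) h2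
      (hy _ this.1 this.2)

end Slices

/-! ### Comparison with the differential on the product -/

section Comparison

variable {n : ℕ} {N : Type*} [TopologicalSpace N] [ChartedSpace (EuclideanSpace ℝ (Fin n)) N]
  {H : Type*} [TopologicalSpace H]
  {I : ModelWithCorners ℝ (EuclideanSpace ℝ (Fin (n + 1))) H}
  {M : Type*} [TopologicalSpace M] [ChartedSpace H M]
  {L : Type*} [TopologicalSpace L] {J : ModelWithCorners ℝ (EuclideanSpace ℝ (Fin 1)) L}
  {P : Type*} [TopologicalSpace P] [ChartedSpace L P]

theorem mfderiv_eq_slices (G : C^∞⟮(𝓡 n).prod J, N × P; I, M⟯) (z : N × P)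
    (v : EuclideanSpace ℝ (Fin n)) (w : EuclideanSpace ℝ (Fin 1)) :
    (mfderiv ((𝓡 n).prod J) I G z (v, w) : EuclideanSpace ℝ (Fin (n + 1))) =
      sliceLeft I G z v + sliceRightMap I J G z w :=
  mfderiv_prod_eq_add_apply (G.contMDiff.mdifferentiableAt (by simp))

/-- The second factor is one-dimensional and `τ` does not vanish, so the image of the differential
is spanned by the derivative along `τ` and the image of the derivative along `N`. -/
theorem surjective_mfderiv_iff (G : C^∞⟮(𝓡 n).prod J, N × P; I, M⟯) {z : N × P}
    {τ : ∀ t : P, TangentSpace J t} (hτ : τ z.2 ≠ 0) :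
    Function.Surjective (mfderiv ((𝓡 n).prod J) I G z) ↔ IsSliceRegular I J τ G z := by
  let B : EuclideanSpace ℝ (Fin 1) →L[ℝ] EuclideanSpace ℝ (Fin (n + 1)) :=
    sliceRightMap I J G z
  let w₀ : EuclideanSpace ℝ (Fin 1) := τ z.2
  have hw₀ : w₀ ≠ 0 := hτ
  have hspan : ∀ w : EuclideanSpace ℝ (Fin 1), ∃ r : ℝ, r • w₀ = w := fun w =>
    (finrank_eq_one_iff_of_nonzero' w₀ hw₀).1 (by simp) w
  have hG : ∀ v w, (mfderiv ((𝓡 n).prod J) I G z (v, w) : EuclideanSpace ℝ (Fin (n + 1))) =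
      sliceLeft I G z v + B w := mfderiv_eq_slices G z
  have hs : sliceRight I J τ G z = B w₀ := rfl
  unfold IsSliceRegular
  rw [hs, Submodule.eq_top_iff']
  constructor
  · intro h u
    obtain ⟨⟨v, w⟩, hvw⟩ := h u
    obtain ⟨r, rfl⟩ := hspan w
    have h1 : sliceLeft I G z v + B (r • w₀) = u := (hG v (r • w₀)).symm.trans hvw
    rw [← h1, add_comm (sliceLeft I G z v)]
    refine Submodule.add_mem_sup ?_ ⟨v, rfl⟩
    rw [map_smul]
    exact Submodule.smul_mem _ _ (Submodule.mem_span_singleton_self _)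
  · intro h u
    obtain ⟨a, ha, b, ⟨v, rfl⟩, hab⟩ := Submodule.mem_sup.1 (h u)
    obtain ⟨r, rfl⟩ := Submodule.mem_span_singleton.1 ha
    refine ⟨((v, r • w₀) : EuclideanSpace ℝ (Fin n) × EuclideanSpace ℝ (Fin 1)), ?_⟩
    refine (hG v (r • w₀)).trans ?_
    rw [map_smul]
    exact (add_comm _ _).trans hab

theorem isRegularValue_iff_isRegularOn (G : C^∞⟮(𝓡 n).prod J, N × P; I, M⟯)
    {τ : ∀ t : P, TangentSpace J t} (hτ : ∀ t, τ t ≠ 0) {y : M} {Q : Set P}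
    (hQ : ∀ z, G z = y → z.2 ∈ Q) : IsRegularValue G y ↔ IsRegularOn I J τ G y Q :=
  ⟨fun h z _ hz => (surjective_mfderiv_iff G (hτ _)).1 (h z hz),
    fun h z hz => (surjective_mfderiv_iff G (hτ _)).2 (h z (hQ z hz) hz)⟩

variable [IsManifold (𝓡 n) ∞ N] [IsManifold I ∞ M]

theorem pointSign_eq_sliceSign (oN : MfdOrientation (𝓡 n) N) (oM : MfdOrientation I M)
    (τ : ∀ t : P, TangentSpace J t) (G : C^∞⟮(𝓡 n).prod J, N × P; I, M⟯) (z : N × P) :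
    pointSign oN oM τ G z = sliceSign oN oM τ G z := by
  have h1 : ∀ v : EuclideanSpace ℝ (Fin n),
      (mfderiv ((𝓡 n).prod J) I G z (v, (0 : EuclideanSpace ℝ (Fin 1))) :
        EuclideanSpace ℝ (Fin (n + 1))) = sliceLeft I G z v := by
    intro v
    refine (mfderiv_eq_slices G z v 0).trans ?_
    exact (congrArg (sliceLeft I G z v + ·) (map_zero _)).trans (add_zero _)
  have h2 : (mfderiv ((𝓡 n).prod J) I G z ((0 : EuclideanSpace ℝ (Fin n)), τ z.2) :
      EuclideanSpace ℝ (Fin (n + 1))) = sliceRight I J τ G z := by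
    refine (mfderiv_eq_slices G z 0 (τ z.2)).trans ?_
    rw [map_zero, zero_add]
    rfl
  have h3 : PreservesOrientationAt oN oM τ G z ↔
      FramePositive (oN.model z.1) (oM.model (G z)) (sliceLeft I G z).toLinearMap (sliceRight I J τ G z) := by
    constructor
    · rintro ⟨b, c, hb, hc, hA, hv⟩
      exact ⟨b, c, hb, hc, fun i => (hA i).trans (h1 _), hv.trans h2⟩
    · rintro ⟨b, c, hb, hc, hA, hv⟩
      exact ⟨b, c, hb, hc, fun i => (hA i).trans (h1 _).symm, hv.trans h2.symm⟩
  unfold pointSign sliceSign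
  exact ite_sign_congr h3

theorem signedCount_eq_countOn (oN : MfdOrientation (𝓡 n) N) (oM : MfdOrientation I M)
    (τ : ∀ t : P, TangentSpace J t) (G : C^∞⟮(𝓡 n).prod J, N × P; I, M⟯) {y : M} {Q : Set P}
    (hQ : ∀ z, G z = y → z.2 ∈ Q) : signedCount oN oM τ G y = countOn oN oM τ G y Q := by
  unfold signedCount countOn
  refine finsum_mem_congr ?_ fun z _ => pointSign_eq_sliceSign oN oM τ G z
  ext z
  exact ⟨fun h => ⟨hQ z h, h⟩, fun h => h.2⟩

end Comparison

end AffineWinding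

end

noncomputable section

namespace AffineWinding

/-! ### Parameters on the interval and on the circle -/

section Parameters

theorem hasDerivAt_expNegInvGlue {x : ℝ} (hx : 0 < x) :
    HasDerivAt expNegInvGlue (Real.exp (-x⁻¹) * (x ^ 2)⁻¹) x := by
  have h1 : HasDerivAt (fun y : ℝ => Real.exp (-y⁻¹)) (Real.exp (-x⁻¹) * (x ^ 2)⁻¹) x := by
    have := ((hasDerivAt_inv hx.ne').neg).exp
    simpa using this
  refine h1.congr_of_eventuallyEq ?_
  filter_upwards [lt_mem_nhds hx] with y hy
  simp [expNegInvGlue, not_le.2 hy]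

/-- For `f / (f + g)` the numerator of the derivative is `f' * g - f * g'`, here with `f` increasing
and `g` decreasing. So the smooth step is an admissible change of parameter of the open interval. -/
theorem exists_hasDerivAt_smoothTransition {x : ℝ} (hx : x ∈ Set.Ioo (0 : ℝ) 1) :
    ∃ r > 0, HasDerivAt Real.smoothTransition r x := by
  have h0 := hx.1
  have h1 : 0 < 1 - x := by linarith [hx.2]
  have d1 := hasDerivAt_expNegInvGlue h0
  have d2 : HasDerivAt (fun y => expNegInvGlue (1 - y))
      (Real.exp (-(1 - x)⁻¹) * ((1 - x) ^ 2)⁻¹ * (-1)) x :=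
    (hasDerivAt_expNegInvGlue h1).comp x ((hasDerivAt_id x).const_sub 1)
  have hD := Real.smoothTransition.pos_denom x
  refine ⟨_, ?_, d1.div (d1.add d2) hD.ne'⟩
  have p1 := expNegInvGlue.pos_of_pos h0
  have p2 := expNegInvGlue.pos_of_pos h1
  have q1 : 0 < Real.exp (-x⁻¹) * (x ^ 2)⁻¹ := by positivity
  have q2 : 0 < Real.exp (-(1 - x)⁻¹) * ((1 - x) ^ 2)⁻¹ := by positivity
  generalize Real.exp (-x⁻¹) * (x ^ 2)⁻¹ = a at q1 ⊢
  generalize Real.exp (-(1 - x)⁻¹) * ((1 - x) ^ 2)⁻¹ = b at q2 ⊢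
  refine div_pos ?_ (by positivity)
  nlinarith [mul_pos q1 p2, mul_pos p1 q2]

theorem bijOn_smoothTransition :
    Set.BijOn Real.smoothTransition (Set.Ioo 0 1) (Set.Ioo 0 1) := by
  refine ⟨fun x hx => ⟨Real.smoothTransition.pos_of_pos hx.1,
    Real.smoothTransition.lt_one_of_lt_one hx.2⟩, ?_, ?_⟩
  · refine (strictMonoOn_of_deriv_pos (convex_Ioo 0 1)
      Real.smoothTransition.continuous.continuousOn fun x hx => ?_).injOn
    rw [interior_Ioo] at hx
    obtain ⟨r, hr, h⟩ := exists_hasDerivAt_smoothTransition hx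
    rwa [h.deriv]
  · have := intermediate_value_Ioo zero_le_one
      Real.smoothTransition.continuous.continuousOn (δ := ℝ)
    rwa [Real.smoothTransition.zero, Real.smoothTransition.one] at this

/-- The smooth transition function, with values in the unit interval. -/
def unitTransition (t : ℝ) : unitInterval :=
  ⟨Real.smoothTransition t, Real.smoothTransition.nonneg t, Real.smoothTransition.le_one t⟩

theorem contMDiff_unitTransition : ContMDiff 𝓘(ℝ, ℝ) (𝓡∂ 1) ∞ unitTransition :=
  contMDiff_iff_comp_subtypeVal_Icc.2
    ⟨Real.smoothTransition.continuous.subtype_mk _, Real.smoothTransition.contDiff.contMDiff⟩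

theorem bijOn_unitTransition : Set.BijOn unitTransition (Set.Ioo 0 1) (Set.Ioo 0 1) := by
  refine ⟨fun t ht => ?_, fun t ht t' ht' h => ?_, fun s hs => ?_⟩
  · have := bijOn_smoothTransition.mapsTo ht
    exact ⟨this.1, this.2⟩
  · exact bijOn_smoothTransition.injOn ht ht' (congrArg Subtype.val h)
  · obtain ⟨t, ht, h⟩ := bijOn_smoothTransition.surjOn (show (s : ℝ) ∈ Set.Ioo 0 1 from hs)
    exact ⟨t, ht, Subtype.ext h⟩

theorem oneTangentSpaceIcc_ne_zero (t : unitInterval) :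
    (oneTangentSpaceIcc t : TangentSpace (𝓡∂ 1) t) ≠ 0 := by
  intro h
  have h1 : mfderiv (𝓡∂ 1) 𝓘(ℝ, ℝ) (Subtype.val : unitInterval → ℝ) t (oneTangentSpaceIcc t) =
    (1 : ℝ) := mfderiv_subtypeVal_Icc_one t
  rw [h, map_zero] at h1
  exact zero_ne_one (α := ℝ) h1

/-- The tangent line of the interval is spanned by its unit vector, and the factor is found by
composing with the inclusion into `ℝ`, which sends that vector to 1. -/
theorem exists_mfderiv_unitTransition {t : ℝ} (ht : t ∈ Set.Ioo (0 : ℝ) 1) :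
    ∃ r : ℝ, 0 < r ∧ mfderiv 𝓘(ℝ, ℝ) (𝓡∂ 1) unitTransition t (1 : ℝ) =
      r • oneTangentSpaceIcc (unitTransition t) := by
  obtain ⟨r, hr, hd⟩ := exists_hasDerivAt_smoothTransition ht
  let w₀ : EuclideanSpace ℝ (Fin 1) := oneTangentSpaceIcc (unitTransition t)
  have hw₀ : w₀ ≠ 0 := oneTangentSpaceIcc_ne_zero _
  let D : EuclideanSpace ℝ (Fin 1) →L[ℝ] ℝ :=
    mfderiv (𝓡∂ 1) 𝓘(ℝ, ℝ) (Subtype.val : unitInterval → ℝ) (unitTransition t)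
  let C : ℝ →L[ℝ] EuclideanSpace ℝ (Fin 1) := mfderiv 𝓘(ℝ, ℝ) (𝓡∂ 1) unitTransition t
  have hfr : Module.finrank ℝ (EuclideanSpace ℝ (Fin 1)) = 1 := by simp
  obtain ⟨c, hc⟩ := (finrank_eq_one_iff_of_nonzero' w₀ hw₀).1 hfr (C 1)
  have hcomp : HasFDerivAt Real.smoothTransition (D.comp C) t :=
    (((contMDiff_subtypeVal_Icc (n := ∞)).mdifferentiableAt (by simp)).hasMFDerivAt.comp t
      (contMDiff_unitTransition.mdifferentiableAt (by simp)).hasMFDerivAt).hasFDerivAt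
  have h2 : D (C 1) = r := hcomp.hasDerivAt.unique hd
  have h5 : D w₀ = 1 := mfderiv_subtypeVal_Icc_one (unitTransition t)
  rw [← hc, map_smul, h5, smul_eq_mul, mul_one] at h2
  exact ⟨c, by rw [h2]; exact hr, hc.symm⟩

theorem contMDiff_coe_circle : ContMDiff (𝓡 1) 𝓘(ℝ, ℂ) ∞ (fun s : Circle => (s : ℂ)) :=
  have := finrank_real_complex_fact'
  (contMDiff_coe_sphere :
    ContMDiff (𝓡 1) 𝓘(ℝ, ℂ) ∞ ((↑) : Metric.sphere (0 : ℂ) 1 → ℂ))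

theorem contMDiffAt_arg {s : Circle} (hs : (s : ℂ) ∈ Complex.slitPlane) :
    ContMDiffAt (𝓡 1) 𝓘(ℝ, ℝ) ∞ (fun s : Circle => Complex.arg s) s := by
  have h1 : ContDiffAt ℝ ∞ (fun w : ℂ => Complex.arg w) (s : ℂ) := by
    have : (fun w : ℂ => Complex.arg w) = fun w => Complex.imCLM (Complex.log w) := by
      funext w; simp [Complex.log_im]
    rw [this]
    exact Complex.imCLM.contDiff.contDiffAt.comp (s : ℂ)
      ((Complex.contDiffAt_log hs).restrict_scalars ℝ)
  exact h1.contMDiffAt.comp s contMDiff_coe_circle.contMDiffAt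

theorem mfderiv_circleExp_comp {θ : ℝ → ℝ} {t r : ℝ} (h : HasDerivAt θ r t) :
    MDifferentiableAt 𝓘(ℝ, ℝ) (𝓡 1) (fun t => Circle.exp (θ t)) t ∧
    mfderiv 𝓘(ℝ, ℝ) (𝓡 1) (fun t => Circle.exp (θ t)) t (1 : ℝ) =
      r • circleUnitVector (Circle.exp (θ t)) := by
  have h1 : HasMFDerivAt 𝓘(ℝ, ℝ) 𝓘(ℝ, ℝ) θ t (ContinuousLinearMap.toSpanSingleton ℝ r) :=
    h.hasFDerivAt.hasMFDerivAt
  have h2 : MDifferentiableAt 𝓘(ℝ, ℝ) (𝓡 1) Circle.exp (θ t) :=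
    (contMDiff_circleExp (m := 1)).mdifferentiableAt one_ne_zero
  have h3 := h2.hasMFDerivAt.comp t h1
  refine ⟨h3.mdifferentiableAt, ?_⟩
  rw [circleUnitVector_exp]
  let D : ℝ →L[ℝ] EuclideanSpace ℝ (Fin 1) := mfderiv 𝓘(ℝ, ℝ) (𝓡 1) Circle.exp (θ t)
  have h4 : (mfderiv 𝓘(ℝ, ℝ) (𝓡 1) (fun t => Circle.exp (θ t)) t (1 : ℝ) :
      EuclideanSpace ℝ (Fin 1)) = D (ContinuousLinearMap.toSpanSingleton ℝ r (1 : ℝ)) :=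
    congrArg (fun f : ℝ →L[ℝ] EuclideanSpace ℝ (Fin 1) => f 1) h3.mfderiv
  have h5 : D (ContinuousLinearMap.toSpanSingleton ℝ r (1 : ℝ)) = r • D 1 := by
    rw [← map_smul]; simp
  exact h4.trans h5

end Parameters

end AffineWinding

end

noncomputable section

namespace AffineWinding

/-! ### Strips: homotopies parametrized by the line, and their closure to the circle -/

section Strips

variable {n : ℕ} {N : Type*} [TopologicalSpace N] [ChartedSpace (EuclideanSpace ℝ (Fin n)) N]
  {H : Type*} [TopologicalSpace H]
  {I : ModelWithCorners ℝ (EuclideanSpace ℝ (Fin (n + 1))) H}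
  {M : Type*} [TopologicalSpace M] [ChartedSpace H M]

/-- The unit vector field on the real line. -/
def realUnit (t : ℝ) : TangentSpace 𝓘(ℝ, ℝ) t := (1 : ℝ)

variable (I) in
/-- A smooth homotopy from `f₀` to `f₁`, parametrized by the real line and constant outside the unit
interval. -/
structure IsStrip (k : N × ℝ → M) (f₀ f₁ : N → M) : Prop where
  smooth : ContMDiff ((𝓡 n).prod 𝓘(ℝ, ℝ)) I ∞ k
  left : ∀ x t, t ≤ 0 → k (x, t) = f₀ x
  right : ∀ x t, 1 ≤ t → k (x, t) = f₁ x

variable (I) in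
/-- The point `y` is a regular value of a strip. -/
def IsStripRegular (k : N × ℝ → M) (y : M) : Prop :=
  IsRegularOn I 𝓘(ℝ, ℝ) realUnit k y (Set.Ioo 0 1)

theorem IsStrip.mdifferentiable {k : N × ℝ → M} {f₀ f₁ : N → M} (hk : IsStrip I k f₀ f₁) :
    MDifferentiable ((𝓡 n).prod 𝓘(ℝ, ℝ)) I k := hk.smooth.mdifferentiable (by simp)

theorem contMDiff_comp_snd {L : Type*} [TopologicalSpace L] {F : Type*} [NormedAddCommGroup F]
    [NormedSpace ℝ F] {J : ModelWithCorners ℝ F L} {P : Type*} [TopologicalSpace P]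
    [ChartedSpace L P]
    {F' : Type*} [NormedAddCommGroup F'] [NormedSpace ℝ F'] {L' : Type*} [TopologicalSpace L']
    {J' : ModelWithCorners ℝ F' L'} {P' : Type*} [TopologicalSpace P'] [ChartedSpace L' P']
    {k : N × P' → M} (hk : ContMDiff ((𝓡 n).prod J') I ∞ k) {θ : P → P'} (hθ : ContMDiff J J' ∞ θ) :
    ContMDiff ((𝓡 n).prod J) I ∞ (fun z : N × P => k (z.1, θ z.2)) :=
  hk.comp (contMDiff_fst.prodMk (hθ.comp contMDiff_snd))

theorem isStrip_refl {f : N → M} (hf : ContMDiff (𝓡 n) I ∞ f) :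
    IsStrip I (fun z : N × ℝ => f z.1) f f :=
  ⟨hf.comp contMDiff_fst, fun _ _ _ => rfl, fun _ _ _ => rfl⟩

theorem IsStrip.symm {k : N × ℝ → M} {f₀ f₁ : N → M} (hk : IsStrip I k f₀ f₁) :
    IsStrip I (fun z => k (z.1, 1 - z.2)) f₁ f₀ :=
  ⟨contMDiff_comp_snd hk.smooth (contDiff_const.sub contDiff_id).contMDiff,
    fun x t ht => hk.right x _ (by linarith), fun x t ht => hk.left x _ (by linarith)⟩

theorem mfderiv_realUnit {θ : ℝ → ℝ} {t r : ℝ} (h : HasDerivAt θ r t) :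
    MDifferentiableAt 𝓘(ℝ, ℝ) 𝓘(ℝ, ℝ) θ t ∧
      mfderiv 𝓘(ℝ, ℝ) 𝓘(ℝ, ℝ) θ t (realUnit t) = r • realUnit (θ t) := by
  have h1 : HasMFDerivAt 𝓘(ℝ, ℝ) 𝓘(ℝ, ℝ) θ t (ContinuousLinearMap.toSpanSingleton ℝ r) :=
    h.hasFDerivAt.hasMFDerivAt
  refine ⟨h1.mdifferentiableAt, ?_⟩
  rw [h1.mfderiv]
  have : (1 : ℝ) • r = r • (1 : ℝ) := mul_comm _ _
  exact this

theorem isReparam_symm (k : N × ℝ → M) :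
    IsReparam realUnit realUnit (fun z => k (z.1, 1 - z.2)) k (fun t => 1 - t)
      (Set.Ioo 0 1) (Set.Ioo 0 1) (-1) := by
  refine ⟨Or.inr rfl, ⟨?_, ?_, ?_⟩, fun t _ => Filter.Eventually.of_forall fun _ _ => rfl, ?_⟩
  · intro t ht
    exact ⟨by linarith [ht.2], by linarith [ht.1]⟩
  · intro t _ t' _ h
    simpa using h
  · intro t ht
    exact ⟨1 - t, ⟨by linarith [ht.2], by linarith [ht.1]⟩, by simp⟩
  · intro t _
    have h := mfderiv_realUnit ((hasDerivAt_id t).const_sub 1)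
    exact ⟨h.1, -1, by norm_num, h.2⟩

/-- The concatenation of two strips. -/
def stripTrans (k k' : N × ℝ → M) : N × ℝ → M := fun z =>
  if z.2 ≤ 1 / 2 then k (z.1, 3 * z.2) else k' (z.1, 3 * z.2 - 2)

/-- With speed 3 the middle third is stationary at `f₁`, so each of the two formulas remains valid
across it; the overlap of their domains makes the concatenation smooth. -/
theorem IsStrip.stripTrans_left {k k' : N × ℝ → M} {f₀ f₁ f₂ : N → M} (hk : IsStrip I k f₀ f₁)
    (hk' : IsStrip I k' f₁ f₂) {t : ℝ} (ht : t < 2 / 3) (x : N) :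
    stripTrans k k' (x, t) = k (x, 3 * t) := by
  unfold stripTrans
  split_ifs with h
  · rfl
  · have h : ¬ t ≤ 1 / 2 := h
    change k' (x, 3 * t - 2) = k (x, 3 * t)
    rw [hk'.left x _ (by linarith), hk.right x _ (by linarith)]

theorem IsStrip.stripTrans_right {k k' : N × ℝ → M} {f₀ f₁ f₂ : N → M} (hk : IsStrip I k f₀ f₁)
    (hk' : IsStrip I k' f₁ f₂) {t : ℝ} (ht : 1 / 3 < t) (x : N) :
    stripTrans k k' (x, t) = k' (x, 3 * t - 2) := by
  unfold stripTrans
  split_ifs with h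
  · have h : t ≤ 1 / 2 := h
    change k (x, 3 * t) = k' (x, 3 * t - 2)
    rw [hk'.left x _ (by linarith), hk.right x _ (by linarith)]
  · rfl

theorem IsStrip.trans {k k' : N × ℝ → M} {f₀ f₁ f₂ : N → M} (hk : IsStrip I k f₀ f₁)
    (hk' : IsStrip I k' f₁ f₂) : IsStrip I (stripTrans k k') f₀ f₂ := by
  refine ⟨fun z => ?_, fun x t ht => ?_, fun x t ht => ?_⟩
  · rcases lt_or_ge z.2 (1 / 2) with h | h
    · have h1 : ContMDiff ((𝓡 n).prod 𝓘(ℝ, ℝ)) I ∞ (fun z : N × ℝ => k (z.1, 3 * z.2)) :=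
        contMDiff_comp_snd hk.smooth (contDiff_const.mul contDiff_id).contMDiff
      refine (h1 z).congr_of_eventuallyEq ?_
      have h2 : ∀ᶠ w : N × ℝ in 𝓝 z, w.2 < 2 / 3 :=
        continuous_snd.continuousAt.eventually (gt_mem_nhds (by linarith))
      filter_upwards [h2] with w hw using hk.stripTrans_left hk' hw w.1
    · have h1 : ContMDiff ((𝓡 n).prod 𝓘(ℝ, ℝ)) I ∞ (fun z : N × ℝ => k' (z.1, 3 * z.2 - 2)) :=
        contMDiff_comp_snd hk'.smooth
          ((contDiff_const.mul contDiff_id).sub contDiff_const).contMDiff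
      refine (h1 z).congr_of_eventuallyEq ?_
      have h2 : ∀ᶠ w : N × ℝ in 𝓝 z, 1 / 3 < w.2 :=
        continuous_snd.continuousAt.eventually (lt_mem_nhds (by linarith))
      filter_upwards [h2] with w hw using hk.stripTrans_right hk' hw w.1
  · rw [hk.stripTrans_left hk' (by linarith), hk.left x _ (by linarith)]
  · rw [hk.stripTrans_right hk' (by linarith), hk'.right x _ (by linarith)]

theorem IsStrip.isReparam_trans_left {k k' : N × ℝ → M} {f₀ f₁ f₂ : N → M}
    (hk : IsStrip I k f₀ f₁) (hk' : IsStrip I k' f₁ f₂) :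
    IsReparam realUnit realUnit (stripTrans k k') k (fun t => 3 * t)
      (Set.Ioo 0 (1 / 3)) (Set.Ioo 0 1) 1 := by
  refine ⟨Or.inl rfl, ⟨?_, ?_, ?_⟩, fun t ht => ?_, fun t _ => ?_⟩
  · intro t ht
    exact ⟨by linarith [ht.1], by linarith [ht.2]⟩
  · intro t _ t' _ h
    simpa using h
  · intro t ht
    exact ⟨t / 3, ⟨by linarith [ht.1], by linarith [ht.2]⟩, by ring⟩
  · filter_upwards [gt_mem_nhds (show t < 2 / 3 by linarith [ht.2])] with t' ht' x
    exact hk.stripTrans_left hk' ht' x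
  · have h := mfderiv_realUnit ((hasDerivAt_id t).const_mul 3)
    exact ⟨h.1, 3 * 1, by norm_num, h.2⟩

theorem IsStrip.isReparam_trans_right {k k' : N × ℝ → M} {f₀ f₁ f₂ : N → M}
    (hk : IsStrip I k f₀ f₁) (hk' : IsStrip I k' f₁ f₂) :
    IsReparam realUnit realUnit (stripTrans k k') k' (fun t => 3 * t - 2)
      (Set.Ioo (2 / 3) 1) (Set.Ioo 0 1) 1 := by
  refine ⟨Or.inl rfl, ⟨?_, ?_, ?_⟩, fun t ht => ?_, fun t _ => ?_⟩
  · intro t ht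
    exact ⟨by linarith [ht.1], by linarith [ht.2]⟩
  · intro t _ t' _ h
    simpa using h
  · intro t ht
    exact ⟨(t + 2) / 3, ⟨by linarith [ht.1], by linarith [ht.2]⟩, by ring⟩
  · filter_upwards [lt_mem_nhds (show 1 / 3 < t by linarith [ht.1])] with t' ht' x
    exact hk.stripTrans_right hk' ht' x
  · have h := mfderiv_realUnit (((hasDerivAt_id t).const_mul 3).sub_const 2)
    exact ⟨h.1, 3 * 1, by norm_num, h.2⟩

theorem IsStrip.mem_of_trans_eq {k k' : N × ℝ → M} {f₀ f₁ f₂ : N → M} (hk : IsStrip I k f₀ f₁)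
    (hk' : IsStrip I k' f₁ f₂) {y : M} (hy : y ∉ Set.range f₁) {z : N × ℝ}
    (hz : z.2 ∈ Set.Ioo (0 : ℝ) 1) (h : stripTrans k k' z = y) :
    z.2 ∈ Set.Ioo (0 : ℝ) (1 / 3) ∨ z.2 ∈ Set.Ioo (2 / 3 : ℝ) 1 := by
  by_contra! hcon
  have h1 : 1 / 3 ≤ z.2 := by
    by_contra! h'; exact hcon.1 ⟨hz.1, h'⟩
  have h2 : z.2 ≤ 2 / 3 := by
    by_contra! h'; exact hcon.2 ⟨h', hz.2⟩
  refine hy ⟨z.1, ?_⟩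
  rw [← h]
  rcases h2.lt_or_eq with h3 | h3
  · exact ((hk.stripTrans_left hk' h3 z.1).trans (hk.right z.1 _ (by linarith))).symm
  · exact ((hk.stripTrans_right hk' (by linarith) z.1).trans (hk'.left z.1 _ (by linarith))).symm

theorem IsStrip.isStripRegular_trans {k k' : N × ℝ → M} {f₀ f₁ f₂ : N → M} (hk : IsStrip I k f₀ f₁)
    (hk' : IsStrip I k' f₁ f₂) {y : M} (hy : y ∉ Set.range f₁) :
    IsStripRegular I (stripTrans k k') y ↔ IsStripRegular I k y ∧ IsStripRegular I k' y := by
  unfold IsStripRegular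
  rw [← (hk.isReparam_trans_left hk').isRegularOn_iff hk.mdifferentiable,
    ← (hk.isReparam_trans_right hk').isRegularOn_iff hk'.mdifferentiable]
  constructor
  · intro h
    exact ⟨fun z hz => h z ⟨hz.1, by linarith [hz.2]⟩, fun z hz => h z ⟨by linarith [hz.1], hz.2⟩⟩
  · rintro ⟨h1, h2⟩ z hz hzy
    rcases hk.mem_of_trans_eq hk' hy hz hzy with h | h
    · exact h1 z h hzy
    · exact h2 z h hzy

theorem IsStrip.isStripRegular_symm {k : N × ℝ → M} {f₀ f₁ : N → M} (hk : IsStrip I k f₀ f₁)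
    {y : M} : IsStripRegular I (fun z => k (z.1, 1 - z.2)) y ↔ IsStripRegular I k y :=
  (isReparam_symm k).isRegularOn_iff hk.mdifferentiable y

/-- A strip from a map to itself closes up to a map on the product with the circle. -/
theorem IsStrip.exists_circle {k : N × ℝ → M} {f₀ : N → M} (hk : IsStrip I k f₀ f₀) :
    ∃ μ : C^∞⟮(𝓡 n).prod (𝓡 1), N × Circle; I, M⟯,
      (∀ x (s : Circle), (s : ℂ).re ≤ 0 → μ (x, s) = f₀ x) ∧
      IsReparam realUnit circleUnitVector k μ
        (fun t => Circle.exp (Real.pi * t - Real.pi / 2)) (Set.Ioo 0 1) {s | 0 < (s : ℂ).re} 1 := by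
  have hπ := Real.pi_pos
  -- The open right half-circle is mapped onto the open unit interval, and the left half to
  -- parameters where the strip is stationary.
  let θ : Circle → ℝ := fun s => Complex.arg s / Real.pi + 1 / 2
  have hout : ∀ x (s : Circle), (s : ℂ).re ≤ 0 → k (x, θ s) = f₀ x := by
    intro x s hs
    have h1 : ¬ |Complex.arg s| < Real.pi / 2 := by
      rw [Complex.abs_arg_lt_pi_div_two_iff]
      rintro (h | h)
      · linarith
      · exact s.coe_ne_zero h
    rcases le_abs.1 (not_lt.1 h1) with h | h
    · refine hk.right x _ ?_
      have : 1 / 2 ≤ Complex.arg s / Real.pi := by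
        rw [le_div_iff₀ hπ]; linarith
      change 1 ≤ Complex.arg s / Real.pi + 1 / 2
      linarith
    · refine hk.left x _ ?_
      have : Complex.arg s / Real.pi ≤ - (1 / 2) := by
        rw [div_le_iff₀ hπ]; linarith
      change Complex.arg s / Real.pi + 1 / 2 ≤ 0
      linarith
  have hf₀ : ContMDiff ((𝓡 n).prod (𝓡 1)) I ∞ (fun z : N × Circle => f₀ z.1) := by
    have h1 : (fun z : N × Circle => f₀ z.1) = fun z => k (z.1, 0) := by
      funext z; rw [hk.left z.1 0 le_rfl]
    rw [h1]
    exact hk.smooth.comp (contMDiff_fst.prodMk contMDiff_const)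
  have hμ : ContMDiff ((𝓡 n).prod (𝓡 1)) I ∞ (fun z : N × Circle => k (z.1, θ z.2)) := by
    intro z
    by_cases hz : (z.2 : ℂ) ∈ Complex.slitPlane
    · have h1 : ContMDiffAt (𝓡 1) 𝓘(ℝ, ℝ) ∞ θ z.2 := by
        have h2 : ContDiff ℝ ∞ (fun a : ℝ => a / Real.pi + 1 / 2) :=
          (contDiff_id.div_const _).add contDiff_const
        exact h2.contMDiff.contMDiffAt.comp z.2 (contMDiffAt_arg hz)
      exact hk.smooth.contMDiffAt.comp z (contMDiffAt_fst.prodMk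
        (h1.comp z (contMDiffAt_snd (I := 𝓡 n) (J := 𝓡 1))))
    -- Only at `-1` is the argument not smooth, and near that point the map is `f₀`, whichever side
    -- of the jump is taken.
    · have hre : (z.2 : ℂ).re < 0 := by
        rw [Complex.mem_slitPlane_iff, not_or, not_lt, not_not] at hz
        refine hz.1.lt_of_ne fun h => z.2.coe_ne_zero (Complex.ext h hz.2)
      refine (hf₀ z).congr_of_eventuallyEq ?_
      have hc : Continuous fun w : N × Circle => (w.2 : ℂ).re :=
        Complex.continuous_re.comp (contMDiff_coe_circle.continuous.comp continuous_snd)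
      filter_upwards [hc.continuousAt.eventually (gt_mem_nhds hre)] with w hw
        using hout w.1 w.2 (le_of_lt hw)
  have harg : ∀ t ∈ Set.Ioo (0 : ℝ) 1,
      Complex.arg (Circle.exp (Real.pi * t - Real.pi / 2)) = Real.pi * t - Real.pi / 2 := by
    intro t ht
    exact Circle.arg_exp (by nlinarith [ht.1]) (by nlinarith [ht.2])
  refine ⟨⟨_, hμ⟩, hout, Or.inl rfl, ⟨?_, ?_, ?_⟩, ?_, ?_⟩
  · intro t ht
    change 0 < ((Circle.exp (Real.pi * t - Real.pi / 2) : Circle) : ℂ).re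
    rw [Circle.coe_exp, Complex.exp_ofReal_mul_I_re]
    exact Real.cos_pos_of_mem_Ioo ⟨by nlinarith [ht.1], by nlinarith [ht.2]⟩
  · intro t ht t' ht' h
    have h1 := harg t ht
    have h2 : Circle.exp (Real.pi * t - Real.pi / 2) = Circle.exp (Real.pi * t' - Real.pi / 2) := h
    rw [h2, harg t' ht'] at h1
    exact mul_left_cancel₀ hπ.ne' (by linarith)
  · intro s hs
    have h1 : |Complex.arg s| < Real.pi / 2 := Complex.abs_arg_lt_pi_div_two_iff.2 (Or.inl hs)
    rw [abs_lt] at h1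
    have h2 : Real.pi * (Complex.arg s / Real.pi) = Complex.arg s := by field_simp
    refine ⟨Complex.arg s / Real.pi + 1 / 2, ⟨?_, ?_⟩, ?_⟩
    · have : - (1 / 2) < Complex.arg s / Real.pi := by rw [lt_div_iff₀ hπ]; linarith
      linarith
    · have : Complex.arg s / Real.pi < 1 / 2 := by rw [div_lt_iff₀ hπ]; linarith
      linarith
    · change Circle.exp (Real.pi * (Complex.arg s / Real.pi + 1 / 2) - Real.pi / 2) = s
      rw [mul_add, h2, mul_one_div, add_sub_cancel_right, Circle.exp_arg]
  · intro t ht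
    filter_upwards [isOpen_Ioo.mem_nhds ht] with t' ht' x
    change k (x, t') = k (x, θ (Circle.exp (Real.pi * t' - Real.pi / 2)))
    have : θ (Circle.exp (Real.pi * t' - Real.pi / 2)) = t' := by
      simp only [θ, harg t' ht']
      field_simp
      ring
    rw [this]
  · intro t _
    obtain ⟨h1, h2⟩ := mfderiv_circleExp_comp
      (((hasDerivAt_id t).const_mul Real.pi).sub_const (Real.pi / 2))
    exact ⟨h1, Real.pi * 1, by simpa using hπ, h2⟩

/-- A map that does not depend on the circle variable has rank at most `n` everywhere, so its
regular values are omitted values. Sard's theorem thereby also yields values off the image of a map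
of `N`. -/
theorem notMem_range_of_isRegularValue {f : N → M}
    {G : C^∞⟮(𝓡 n).prod (𝓡 1), N × Circle; I, M⟯} (hG : ∀ z, G z = f z.1) {y : M}
    (hy : IsRegularValue G y) : y ∉ Set.range f := by
  rintro ⟨x, hx⟩
  have h1 := (surjective_mfderiv_iff G (z := (x, 1)) (circleUnitVector_ne_zero 1)).1
    (hy (x, 1) ((hG _).trans hx))
  unfold IsSliceRegular at h1
  have h2 : sliceRight I (𝓡 1) circleUnitVector G (x, 1) = 0 := by
    unfold sliceRight sliceRightMap
    have h3 : HasMFDerivAt (𝓡 1) I (fun t : Circle => G (x, t)) 1 0 := by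
      have : (fun t : Circle => G (x, t)) = fun _ => f x := funext fun t => hG (x, t)
      rw [this]
      exact hasMFDerivAt_const _ _
    exact congrArg (fun A : EuclideanSpace ℝ (Fin 1) →L[ℝ] EuclideanSpace ℝ (Fin (n + 1)) =>
      A (circleUnitVector 1)) h3.mfderiv
  rw [h2, Submodule.span_zero_singleton, bot_sup_eq] at h1
  have h4 := LinearMap.finrank_range_le (sliceLeft I G (x, 1)).toLinearMap
  rw [h1, finrank_top] at h4
  simp at h4

end Strips

end AffineWinding

end

noncomputable section

namespace AffineWinding

/-! ### Signed counts of strips -/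

section StripCount

variable {n : ℕ} {N : Type*} [TopologicalSpace N] [ChartedSpace (EuclideanSpace ℝ (Fin n)) N]
  [IsManifold (𝓡 n) ∞ N]
  {H : Type*} [TopologicalSpace H]
  {I : ModelWithCorners ℝ (EuclideanSpace ℝ (Fin (n + 1))) H}
  {M : Type*} [TopologicalSpace M] [ChartedSpace H M] [IsManifold I ∞ M]

/-- The sum of the signs of the preimages of `y` in a strip. -/
def stripCount (oN : MfdOrientation (𝓡 n) N) (oM : MfdOrientation I M) (k : N × ℝ → M) (y : M) : ℤ :=
  countOn oN oM realUnit k y (Set.Ioo 0 1)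

theorem stripCount_symm (hn : 1 ≤ n) (oN : MfdOrientation (𝓡 n) N) (oM : MfdOrientation I M)
    {k : N × ℝ → M} {f₀ f₁ : N → M} (hk : IsStrip I k f₀ f₁) {y : M} (hy : IsStripRegular I k y) :
    stripCount oN oM (fun z => k (z.1, 1 - z.2)) y = - stripCount oN oM k y := by
  unfold stripCount
  rw [(isReparam_symm k).countOn_eq hn hk.mdifferentiable hy, neg_one_mul]

/-- Over the left half-circle the closed-up map is `f₀`. If `f₀` omits `y`, all preimages lie over
the right half, which is a positive change of parameter of the strip. -/
theorem IsStrip.exists_circle_count (hn : 1 ≤ n) (oN : MfdOrientation (𝓡 n) N)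
    (oM : MfdOrientation I M) {k : N × ℝ → M} {f₀ : N → M} (hk : IsStrip I k f₀ f₀) :
    ∃ μ : C^∞⟮(𝓡 n).prod (𝓡 1), N × Circle; I, M⟯, (∀ x, μ (x, -1) = f₀ x) ∧
      ∀ y, y ∉ Set.range f₀ → (IsRegularValue μ y ↔ IsStripRegular I k y) ∧
        (IsRegularValue μ y → signedCount oN oM circleUnitVector μ y = stripCount oN oM k y) ∧
        ((μ ⁻¹' {y}).Finite → {z : N × ℝ | z.2 ∈ Set.Ioo (0 : ℝ) 1 ∧ k z = y}.Finite) := by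
  obtain ⟨μ, hμ, hγ⟩ := hk.exists_circle
  have hμd : MDifferentiable ((𝓡 n).prod (𝓡 1)) I μ := μ.contMDiff.mdifferentiable (by simp)
  refine ⟨μ, fun x => hμ x (-1) (by simp), fun y hy => ?_⟩
  have hQ : ∀ z, μ z = y → z.2 ∈ {s : Circle | 0 < (s : ℂ).re} := by
    intro z hz
    by_contra hcon
    exact hy ⟨z.1, (hμ z.1 z.2 (not_lt.1 hcon)).symm.trans hz⟩
  have hreg := isRegularValue_iff_isRegularOn μ circleUnitVector_ne_zero hQ
  refine ⟨hreg.trans (hγ.isRegularOn_iff hμd y).symm, fun h => ?_, fun h => ?_⟩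
  · rw [signedCount_eq_countOn oN oM _ μ hQ]
    unfold stripCount
    rw [hγ.countOn_eq hn hμd (hreg.1 h), one_mul]
  · exact (hγ.bijOn_preimage y).finite_iff_finite.2 (h.subset fun z hz => hz.2)

variable [CompactSpace N] [T2Space M]

/-- A strip with different ends does not close up, but followed by its reverse it does; finiteness
then comes from the compactness of `N × S¹`. -/
theorem IsStrip.finite (hn : 1 ≤ n) (oN : MfdOrientation (𝓡 n) N) (oM : MfdOrientation I M)
    {k : N × ℝ → M} {f₀ f₁ : N → M} (hk : IsStrip I k f₀ f₁) {y : M} (hy₀ : y ∉ Set.range f₀)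
    (hy₁ : y ∉ Set.range f₁) (hy : IsStripRegular I k y) :
    {z : N × ℝ | z.2 ∈ Set.Ioo (0 : ℝ) 1 ∧ k z = y}.Finite := by
  have hc := hk.trans hk.symm
  obtain ⟨μ, -, hμ⟩ := hc.exists_circle_count hn oN oM
  obtain ⟨h1, -, h2⟩ := hμ y hy₀
  have h3 := h2 (finite_preimage_of_isRegularValue hn oN oM μ
    (h1.2 ((hk.isStripRegular_trans hk.symm hy₁).2 ⟨hy, hk.isStripRegular_symm.2 hy⟩)))
  exact ((hk.isReparam_trans_left hk.symm).bijOn_preimage y).finite_iff_finite.1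
    (h3.subset fun z hz => ⟨⟨hz.1.1, by linarith [hz.1.2]⟩, hz.2⟩)

theorem stripCount_trans (hn : 1 ≤ n) (oN : MfdOrientation (𝓡 n) N) (oM : MfdOrientation I M)
    {k k' : N × ℝ → M} {f₀ f₁ f₂ : N → M} (hk : IsStrip I k f₀ f₁) (hk' : IsStrip I k' f₁ f₂)
    {y : M} (hy₀ : y ∉ Set.range f₀) (hy₁ : y ∉ Set.range f₁) (hy₂ : y ∉ Set.range f₂)
    (hy : IsStripRegular I k y) (hy' : IsStripRegular I k' y) :
    stripCount oN oM (stripTrans k k') y = stripCount oN oM k y + stripCount oN oM k' y := by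
  unfold stripCount
  have h1 := (hk.isReparam_trans_left hk').countOn_eq (oN := oN) (oM := oM) hn hk.mdifferentiable hy
  have h2 := (hk.isReparam_trans_right hk').countOn_eq (oN := oN) (oM := oM) hn
    hk'.mdifferentiable hy'
  rw [one_mul] at h1 h2
  rw [← h1, ← h2]
  -- Splitting the sum over the two outer thirds requires finiteness, because `finsum` is zero on
  -- infinite supports.
  have hfin := (hk.trans hk').finite hn oN oM hy₀ hy₂ ((hk.isStripRegular_trans hk' hy₁).2 ⟨hy, hy'⟩)
  unfold countOn
  rw [← finsum_mem_union]
  · refine finsum_mem_congr (Set.ext fun z => ⟨fun hz => ?_, ?_⟩) fun _ _ => rfl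
    · rcases hk.mem_of_trans_eq hk' hy₁ hz.1 hz.2 with h | h
      · exact Or.inl ⟨h, hz.2⟩
      · exact Or.inr ⟨h, hz.2⟩
    · rintro (h | h)
      · exact ⟨⟨h.1.1, by linarith [h.1.2]⟩, h.2⟩
      · exact ⟨⟨by linarith [h.1.1], h.1.2⟩, h.2⟩
  · rw [Set.disjoint_left]
    rintro z ⟨h, -⟩ ⟨h', -⟩
    linarith [h.2, h'.1]
  · exact hfin.subset fun z h => ⟨⟨h.1.1, by linarith [h.1.2]⟩, h.2⟩
  · exact hfin.subset fun z h => ⟨⟨by linarith [h.1.1], h.1.2⟩, h.2⟩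

/-- Regular values are dense, for finitely many strips at once. -/
theorem exists_isStripRegular (hn : 1 ≤ n) (oN : MfdOrientation (𝓡 n) N) (oM : MfdOrientation I M)
    {ι : Type*} [Finite ι] {k : ι → N × ℝ → M} {f₀ f₁ : ι → N → M}
    (hk : ∀ i, IsStrip I (k i) (f₀ i) (f₁ i)) {p : M} {O : Set M} (hO : O ∈ 𝓝 p) :
    ∃ y ∈ O, ∀ i, y ∉ Set.range (f₀ i) ∧ y ∉ Set.range (f₁ i) ∧ IsStripRegular I (k i) y := by
  choose μ hμ hμ' using fun i => ((hk i).trans (hk i).symm).exists_circle_count hn oN oM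
  have hs : ∀ (i : ι) (t : ℝ),
      ContMDiff ((𝓡 n).prod (𝓡 1)) I ∞ (fun z : N × Circle => k i (z.1, t)) := fun i t =>
    (hk i).smooth.comp (contMDiff_fst.prodMk contMDiff_const)
  -- The maps used are the closed doubles of the strips, and the two ends made constant in the
  -- circle variable, whose regular values are exactly those the ends omit.
  obtain ⟨y, hyO, hy⟩ := exists_isRegularValue_mem hn oN oM
    (fun i : ι ⊕ ι ⊕ ι => Sum.elim μ (Sum.elim (fun i => ⟨_, hs i 0⟩) fun i => ⟨_, hs i 1⟩) i) hO
  refine ⟨y, hyO, fun i => ?_⟩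
  have h0 : y ∉ Set.range (f₀ i) :=
    notMem_range_of_isRegularValue (fun z => (hk i).left z.1 0 le_rfl) (hy (Sum.inr (Sum.inl i)))
  have h1 : y ∉ Set.range (f₁ i) :=
    notMem_range_of_isRegularValue (fun z => (hk i).right z.1 1 le_rfl) (hy (Sum.inr (Sum.inr i)))
  exact ⟨h0, h1, (((hk i).isStripRegular_trans (hk i).symm h1).1
    ((hμ' i y h0).1.1 (hy (Sum.inl i)))).1⟩

end StripCount

/-! ### Good homotopies, strips and loops -/

section Homotopies

variable {n : ℕ} {N : Type*} [TopologicalSpace N] [ChartedSpace (EuclideanSpace ℝ (Fin n)) N]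
  [IsManifold (𝓡 n) ∞ N]
  {H : Type*} [TopologicalSpace H]
  {I : ModelWithCorners ℝ (EuclideanSpace ℝ (Fin (n + 1))) H}
  {M : Type*} [TopologicalSpace M] [ChartedSpace H M] [IsManifold I ∞ M]

/-- Composing with the smooth step makes the homotopy stationary outside the unit interval. The step
has positive derivative inside, and no preimage of `p` lies at the ends, so regularity and count
survive. -/
theorem IsGoodHomotopy.exists_isStrip (hn : 1 ≤ n) (oN : MfdOrientation (𝓡 n) N)
    (oM : MfdOrientation I M) {p : M} {F : C^∞⟮(𝓡 n).prod (𝓡∂ 1), N × unitInterval; I, M⟯}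
    {f₀ f₁ : C^∞⟮𝓡 n, N; I, M⟯} (hF : IsGoodHomotopy p F f₀ f₁) :
    ∃ k, IsStrip I k f₀ f₁ ∧ p ∉ Set.range f₀ ∧ p ∉ Set.range f₁ ∧ IsStripRegular I k p ∧
      stripCount oN oM k p = Delta oN oM p F ∧
      ({z : N × ℝ | z.2 ∈ Set.Ioo (0 : ℝ) 1 ∧ k z = p}.Finite → (F ⁻¹' {p}).Finite) := by
  obtain ⟨⟨hends, hreg⟩, h0, h1⟩ := hF
  have hFd : MDifferentiable ((𝓡 n).prod (𝓡∂ 1)) I F := F.contMDiff.mdifferentiable (by simp)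
  have hγ : IsReparam realUnit (fun t : unitInterval => oneTangentSpaceIcc t)
      (fun z : N × ℝ => F (z.1, unitTransition z.2)) F unitTransition
      (Set.Ioo 0 1) (Set.Ioo 0 1) 1 := by
    refine ⟨Or.inl rfl, bijOn_unitTransition,
      fun t _ => Filter.Eventually.of_forall fun _ _ => rfl, fun t ht => ?_⟩
    obtain ⟨r, hr, h⟩ := exists_mfderiv_unitTransition ht
    exact ⟨contMDiff_unitTransition.mdifferentiableAt (by simp), r, by simpa using hr, h⟩
  have hQ : ∀ z, F z = p → z.2 ∈ Set.Ioo (0 : unitInterval) 1 := by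
    intro z hz
    refine ⟨unitInterval.pos_iff_ne_zero.2 fun h => ?_, unitInterval.lt_one_iff_ne_one.2 fun h => ?_⟩
    · refine (hends z.1).1 ?_
      rw [← h]; exact hz
    · refine (hends z.1).2 ?_
      rw [← h]; exact hz
  have hreg' := (isRegularValue_iff_isRegularOn F oneTangentSpaceIcc_ne_zero hQ).1 hreg
  refine ⟨_, ⟨contMDiff_comp_snd F.contMDiff contMDiff_unitTransition, fun x t ht => ?_,
    fun x t ht => ?_⟩, ?_, ?_, (hγ.isRegularOn_iff hFd p).2 hreg', ?_, fun h => ?_⟩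
  · have : unitTransition t = 0 := Subtype.ext (Real.smoothTransition.zero_of_nonpos ht)
    change F (x, unitTransition t) = f₀ x
    rw [this, h0]
  · have : unitTransition t = 1 := Subtype.ext (Real.smoothTransition.one_of_one_le ht)
    change F (x, unitTransition t) = f₁ x
    rw [this, h1]
  · rintro ⟨x, hx⟩
    exact (hends x).1 ((h0 x).trans hx)
  · rintro ⟨x, hx⟩
    exact (hends x).2 ((h1 x).trans hx)
  · unfold stripCount Delta
    rw [hγ.countOn_eq hn hFd hreg', one_mul, signedCount_eq_countOn oN oM _ F hQ]
  · exact ((hγ.bijOn_preimage p).finite_iff_finite.1 h).subset fun z hz => ⟨hQ z hz, hz⟩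

theorem IsStrip.exists_isGoodHomotopy {k : N × ℝ → M} {f₀ f₁ : C^∞⟮𝓡 n, N; I, M⟯}
    (hk : IsStrip I k f₀ f₁) {p : M} (hp₀ : p ∉ Set.range f₀) (hp₁ : p ∉ Set.range f₁)
    (hp : IsStripRegular I k p) :
    ∃ F : C^∞⟮(𝓡 n).prod (𝓡∂ 1), N × unitInterval; I, M⟯, IsGoodHomotopy p F f₀ f₁ ∧
      ∀ z, F z = k (z.1, z.2) := by
  let F : C^∞⟮(𝓡 n).prod (𝓡∂ 1), N × unitInterval; I, M⟯ :=
    ⟨fun z => k (z.1, z.2), contMDiff_comp_snd hk.smooth contMDiff_subtypeVal_Icc⟩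
  have hγ : IsReparam (fun t : unitInterval => oneTangentSpaceIcc t) realUnit F k
      (fun t : unitInterval => (t : ℝ)) (Set.Ioo 0 1) (Set.Ioo 0 1) 1 := by
    refine ⟨Or.inl rfl, ⟨fun t ht => ht, fun t _ t' _ h => Subtype.ext h, fun t ht =>
      ⟨⟨t, ht.1.le, ht.2.le⟩, ht, rfl⟩⟩, fun t _ => Filter.Eventually.of_forall fun _ _ => rfl,
      fun t _ => ⟨contMDiff_subtypeVal_Icc.mdifferentiableAt (n := ∞) (by simp), 1, by simp, ?_⟩⟩
    rw [one_smul]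
    exact mfderiv_subtypeVal_Icc_one t
  have h0 : ∀ x, F (x, 0) = f₀ x := fun x => hk.left x 0 le_rfl
  have h1 : ∀ x, F (x, 1) = f₁ x := fun x => hk.right x 1 le_rfl
  have hends : ∀ x : N, F (x, 0) ≠ p ∧ F (x, 1) ≠ p := fun x =>
    ⟨fun h => hp₀ ⟨x, (h0 x).symm.trans h⟩, fun h => hp₁ ⟨x, (h1 x).symm.trans h⟩⟩
  have hQ : ∀ z, F z = p → z.2 ∈ Set.Ioo (0 : unitInterval) 1 := by
    intro z hz
    refine ⟨unitInterval.pos_iff_ne_zero.2 fun h => ?_, unitInterval.lt_one_iff_ne_one.2 fun h => ?_⟩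
    · refine (hends z.1).1 ?_
      rw [← h]; exact hz
    · refine (hends z.1).2 ?_
      rw [← h]; exact hz
  refine ⟨F, ⟨⟨hends, ?_⟩, h0, h1⟩, fun z => rfl⟩
  exact (isRegularValue_iff_isRegularOn F oneTangentSpaceIcc_ne_zero hQ).2
    ((hγ.isRegularOn_iff hk.mdifferentiable p).2 hp)

/-- A map on the product with the circle opens up to a strip. -/
theorem exists_isStrip_of_circle (hn : 1 ≤ n) (oN : MfdOrientation (𝓡 n) N)
    (oM : MfdOrientation I M) (μ : C^∞⟮(𝓡 n).prod (𝓡 1), N × Circle; I, M⟯) (s : Circle) :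
    ∃ k : N × ℝ → M, IsStrip I k (fun x => μ (x, s)) (fun x => μ (x, s)) ∧
      ∀ y, (∀ x, μ (x, s) ≠ y) → (IsRegularValue μ y ↔ IsStripRegular I k y) ∧
        (IsRegularValue μ y → signedCount oN oM circleUnitVector μ y = stripCount oN oM k y) := by
  have hπ := Real.pi_pos
  obtain ⟨α, rfl⟩ : ∃ α, Circle.exp α = s := ⟨_, Circle.exp_arg s⟩
  have hμd : MDifferentiable ((𝓡 n).prod (𝓡 1)) I μ := μ.contMDiff.mdifferentiable (by simp)
  -- One positive turn of the circle starting and ending at the given point, at rest outside the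
  -- unit interval; the open interval covers every other point once.
  let γ : ℝ → Circle := fun t => Circle.exp (α + 2 * Real.pi * Real.smoothTransition t)
  have hγs : ContMDiff 𝓘(ℝ, ℝ) (𝓡 1) ∞ γ := by
    have h1 : ContDiff ℝ ∞ (fun t => α + 2 * Real.pi * Real.smoothTransition t) :=
      contDiff_const.add (contDiff_const.mul Real.smoothTransition.contDiff)
    exact contMDiff_circleExp.comp h1.contMDiff
  have hγ : IsReparam realUnit circleUnitVector (fun z : N × ℝ => μ (z.1, γ z.2)) μ γ
      (Set.Ioo 0 1) {Circle.exp α}ᶜ 1 := by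
    have hexp : ∀ a b : ℝ, Circle.exp (α + 2 * Real.pi * a) = Circle.exp (α + 2 * Real.pi * b) →
        ∃ m : ℤ, a = b + m := by
      intro a b hab
      obtain ⟨m, hm⟩ := Circle.exp_eq_exp.1 hab
      refine ⟨m, mul_left_cancel₀ (by positivity : (2 * Real.pi) ≠ 0) ?_⟩
      linarith
    refine ⟨Or.inl rfl, ⟨fun t ht h => ?_, fun t ht t' ht' h => ?_, fun s hs => ?_⟩,
      fun t _ => Filter.Eventually.of_forall fun _ _ => rfl, fun t ht => ?_⟩
    · obtain ⟨h1, h2⟩ := bijOn_smoothTransition.mapsTo ht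
      obtain ⟨m, hm⟩ := hexp (Real.smoothTransition t) 0 (by simpa [γ] using h)
      rw [hm, zero_add] at h1 h2
      have h1' : 0 < m := by exact_mod_cast h1
      have h2' : m < 1 := by exact_mod_cast h2
      omega
    · refine bijOn_smoothTransition.injOn ht ht' ?_
      obtain ⟨h1, h2⟩ := bijOn_smoothTransition.mapsTo ht
      obtain ⟨h1', h2'⟩ := bijOn_smoothTransition.mapsTo ht'
      obtain ⟨m, hm⟩ := hexp _ _ h
      have a : (m : ℝ) < 1 := by linarith
      have b : (-1 : ℝ) < m := by linarith
      have a' : m < 1 := by exact_mod_cast a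
      have b' : -1 < m := by exact_mod_cast b
      have : m = 0 := by omega
      rw [hm, this, Int.cast_zero, add_zero]
    -- The fractional part of the angle from the base point, in turns, is the value the smooth step
    -- has to take; it is nonzero because `s` is not the base point.
    · obtain ⟨a, ha⟩ : ∃ a, a = (Complex.arg s - α) / (2 * Real.pi) := ⟨_, rfl⟩
      have hs' : Circle.exp (α + 2 * Real.pi * Int.fract a) = s := by
        conv_rhs => rw [← Circle.exp_arg s]
        refine Circle.exp_eq_exp.2 ⟨-⌊a⌋, ?_⟩
        have h1 : 2 * Real.pi * a = Complex.arg s - α := by rw [ha]; field_simp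
        rw [← Int.self_sub_floor, mul_sub, h1]
        push_cast
        ring
      have hne : Int.fract a ≠ 0 := by
        intro h
        rw [h, mul_zero, add_zero] at hs'
        exact hs hs'.symm
      obtain ⟨t, ht, h⟩ := bijOn_smoothTransition.surjOn
        (show Int.fract a ∈ Set.Ioo (0 : ℝ) 1 from
          ⟨(Int.fract_nonneg a).lt_of_ne hne.symm, Int.fract_lt_one a⟩)
      refine ⟨t, ht, ?_⟩
      change Circle.exp (α + 2 * Real.pi * Real.smoothTransition t) = s
      rw [h, hs']
    · obtain ⟨r, hr, h⟩ := exists_hasDerivAt_smoothTransition ht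
      obtain ⟨h1, h2⟩ := mfderiv_circleExp_comp ((h.const_mul (2 * Real.pi)).const_add α)
      exact ⟨h1, 2 * Real.pi * r, by rw [Int.cast_one, one_mul]; positivity, h2⟩
  have hend : ∀ t, Real.smoothTransition t = 0 ∨ Real.smoothTransition t = 1 →
      γ t = Circle.exp α := by
    rintro t (h | h)
    · simp [γ, h]
    · simp only [γ, h, mul_one]
      exact Circle.periodic_exp α
  refine ⟨_, ⟨contMDiff_comp_snd μ.contMDiff hγs, fun x t ht => ?_, fun x t ht => ?_⟩,
    fun y hy => ?_⟩
  · change μ (x, γ t) = _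
    rw [hend t (Or.inl (Real.smoothTransition.zero_of_nonpos ht))]
  · change μ (x, γ t) = _
    rw [hend t (Or.inr (Real.smoothTransition.one_of_one_le ht))]
  · have hQ : ∀ z, μ z = y → z.2 ∈ ({Circle.exp α} : Set Circle)ᶜ := by
      intro z hz h
      refine hy z.1 ?_
      rw [← Set.mem_singleton_iff.1 h]
      exact hz
    have hreg := isRegularValue_iff_isRegularOn μ circleUnitVector_ne_zero hQ
    refine ⟨hreg.trans (hγ.isRegularOn_iff hμd y).symm, fun h => ?_⟩
    rw [signedCount_eq_countOn oN oM _ μ hQ]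
    unfold stripCount
    rw [hγ.countOn_eq hn hμd (hreg.1 h), one_mul]

end Homotopies

end AffineWinding

end

noncomputable section

namespace AffineWinding

/-! ### Nearby maps are smoothly homotopic -/

section GraphNeighbourhoods

variable {n : ℕ} {N : Type*} [TopologicalSpace N] [ChartedSpace (EuclideanSpace ℝ (Fin n)) N]
  {H : Type*} [TopologicalSpace H]
  {I : ModelWithCorners ℝ (EuclideanSpace ℝ (Fin (n + 1))) H}
  {M : Type*} [TopologicalSpace M] [ChartedSpace H M] [IsManifold I ∞ M]

/-- Convexity keeps straight segments in charts inside the manifold, even at its boundary. -/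
theorem IsBoundaryModel.convex_range (hI : IsBoundaryModel I) : Convex ℝ (Set.range I) := by
  rcases hI with h | ⟨φ, -, h⟩
  · rw [h]; exact convex_univ
  · rw [h]; exact convex_halfSpace_ge φ.toLinearMap.isLinear 0

/-- A map close to `f` can be deformed to `f` over a chart, staying close to `f`. -/
theorem exists_isStrip_of_chart (hI : IsBoundaryModel I) (f : C^∞⟮𝓡 n, N; I, M⟯) {q : M} {ρ : N → ℝ}
    (hρ : ContMDiff (𝓡 n) 𝓘(ℝ, ℝ) ∞ ρ) (hρ' : ∀ x, ρ x ∈ Set.Icc (0 : ℝ) 1)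
    (hq : ∀ x ∈ tsupport ρ, f x ∈ (chartAt H q).source) {Ω : Set (N × M)}
    (hΩ : ∀ x, Ω ∈ 𝓝 (x, f x)) :
    ∃ Ω' ⊆ Ω, (∀ x, Ω' ∈ 𝓝 (x, f x)) ∧ ∀ g : C^∞⟮𝓡 n, N; I, M⟯, (∀ x, (x, g x) ∈ Ω') →
      ∃ (g' : C^∞⟮𝓡 n, N; I, M⟯) (k : N × ℝ → M), IsStrip I k g g' ∧ (∀ z, (z.1, k z) ∈ Ω) ∧
        (∀ x, ρ x = 1 → g' x = f x) ∧ ∀ x, g x = f x → g' x = f x := by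
  have hf := f.contMDiff.continuous
  have hsrc : ∀ {y}, y ∈ (chartAt H q).source ↔ y ∈ (extChartAt I q).source := fun {y} => by
    rw [extChartAt_source]
  -- Over the support of `ρ` the whole segment from `w.2` to `f w.1` must stay in the chart and in
  -- `Ω`; small balls intersected with the convex range make this a neighbourhood condition.
  refine ⟨Ω ∩ {w | w.1 ∈ tsupport ρ → w.2 ∈ (chartAt H q).source ∧ ∀ s ∈ Set.Icc (0 : ℝ) 1,
    extChartAt I q w.2 + s • (extChartAt I q (f w.1) - extChartAt I q w.2) ∈ (extChartAt I q).target ∧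
    (w.1, (extChartAt I q).symm (extChartAt I q w.2 +
      s • (extChartAt I q (f w.1) - extChartAt I q w.2))) ∈ Ω}, Set.inter_subset_left, ?_, ?_⟩
  · intro x
    refine Filter.inter_mem (hΩ x) ?_
    by_cases hx : x ∈ tsupport ρ
    swap
    · have : ∀ᶠ w : N × M in 𝓝 (x, f x), w.1 ∉ tsupport ρ :=
        (continuous_fst.tendsto (x, f x)) ((isClosed_tsupport ρ).isOpen_compl.mem_nhds hx)
      filter_upwards [this] with w hw h using absurd h hw
    have hxs := hsrc.1 (hq x hx)
    have hxt := (extChartAt I q).map_source hxs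
    have h1 : ∀ᶠ w : N × EuclideanSpace ℝ (Fin (n + 1)) in 𝓝 x ×ˢ 𝓝[Set.range I] (extChartAt I q (f x)),
        w.2 ∈ (extChartAt I q).target ∧ (w.1, (extChartAt I q).symm w.2) ∈ Ω := by
      refine Filter.Eventually.and ?_ ?_
      · exact Filter.tendsto_snd.eventually (extChartAt_target_mem_nhdsWithin' hxs)
      · have h2 : Filter.Tendsto (fun w : N × EuclideanSpace ℝ (Fin (n + 1)) =>
            (w.1, (extChartAt I q).symm w.2)) (𝓝 x ×ˢ 𝓝[Set.range I] (extChartAt I q (f x)))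
            (𝓝 (x, f x)) := by
          rw [nhds_prod_eq]
          refine Filter.Tendsto.prodMk Filter.tendsto_fst ?_
          have h3 := (continuousAt_extChartAt_symm'' hxt).tendsto
          rw [(extChartAt I q).left_inv hxs] at h3
          exact (h3.mono_left nhdsWithin_le_nhds).comp Filter.tendsto_snd
        exact h2.eventually (hΩ x)
    obtain ⟨U, hU, B, hB, hUB⟩ := Filter.mem_prod_iff.1 h1
    obtain ⟨r, hr, hrB⟩ := Metric.mem_nhdsWithin_iff.1 hB
    have hψ : ∀ y ∈ (extChartAt I q).source, ContinuousAt (extChartAt I q) y := fun y hy =>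
      continuousAt_extChartAt' hy
    have h2 : ∀ᶠ y in 𝓝 (f x), y ∈ (extChartAt I q).source ∧
        extChartAt I q y ∈ Metric.ball (extChartAt I q (f x)) r :=
      (Filter.Eventually.and ((isOpen_extChartAt_source q).mem_nhds hxs)
        ((hψ _ hxs).eventually (Metric.ball_mem_nhds _ hr)))
    have h3 : ∀ᶠ w : N × M in 𝓝 (x, f x), w.1 ∈ U := continuous_fst.continuousAt.eventually hU
    have h4 : ∀ᶠ w : N × M in 𝓝 (x, f x), w.2 ∈ (extChartAt I q).source ∧
        extChartAt I q w.2 ∈ Metric.ball (extChartAt I q (f x)) r :=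
      (continuous_snd.tendsto (x, f x)).eventually h2
    have h5 : ∀ᶠ w : N × M in 𝓝 (x, f x), f w.1 ∈ (extChartAt I q).source ∧
        extChartAt I q (f w.1) ∈ Metric.ball (extChartAt I q (f x)) r :=
      ((hf.comp continuous_fst).tendsto (x, f x)).eventually h2
    filter_upwards [h3, h4, h5] with w hwU hw hfw _
    refine ⟨hsrc.2 hw.1, fun s hs => ?_⟩
    have hmem : extChartAt I q w.2 + s • (extChartAt I q (f w.1) - extChartAt I q w.2) ∈
        Metric.ball (extChartAt I q (f x)) r ∩ Set.range I := by
      have hconv : Convex ℝ (Metric.ball (extChartAt I q (f x)) r ∩ Set.range I) :=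
        (convex_ball _ _).inter hI.convex_range
      have hr' : ∀ y ∈ (extChartAt I q).source, extChartAt I q y ∈ Set.range I := fun y hy =>
        extChartAt_target_subset_range q ((extChartAt I q).map_source hy)
      exact hconv.add_smul_sub_mem ⟨hw.2, hr' _ hw.1⟩ ⟨hfw.2, hr' _ hfw.1⟩ hs
    exact hUB (Set.mk_mem_prod hwU (hrB hmem))
  · intro g hg
    have hgc := g.contMDiff.continuous
    let O : Set (N × ℝ) := {z | g z.1 ∈ (chartAt H q).source ∧ f z.1 ∈ (chartAt H q).source}
    have hO : IsOpen O :=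
      ((chartAt H q).open_source.preimage (hgc.comp continuous_fst)).inter
        ((chartAt H q).open_source.preimage (hf.comp continuous_fst))
    let C : Set (N × ℝ) := {z | z.1 ∈ tsupport ρ}
    have hC : IsClosed C := (isClosed_tsupport ρ).preimage continuous_fst
    have hCO : C ⊆ O := fun z hz => ⟨((hg z.1).2 hz).1, hq _ hz⟩
    -- At time 1 the fraction of the segment covered is `ρ`: points with `ρ = 1` reach `f`. Points
    -- where `g` already equals `f` do not move, so successive corrections do not spoil each other.
    let c : N × ℝ → ℝ := fun z => Real.smoothTransition z.2 * ρ z.1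
    have hc : ∀ z, c z ∈ Set.Icc (0 : ℝ) 1 := fun z =>
      ⟨mul_nonneg (Real.smoothTransition.nonneg _) (hρ' _).1,
        mul_le_one₀ (Real.smoothTransition.le_one _) (hρ' _).1 (hρ' _).2⟩
    let d : N × ℝ → EuclideanSpace ℝ (Fin (n + 1)) := fun z =>
      c z • (extChartAt I q (f z.1) - extChartAt I q (g z.1))
    have hd : ContMDiffOn ((𝓡 n).prod 𝓘(ℝ, ℝ)) 𝓘(ℝ, EuclideanSpace ℝ (Fin (n + 1))) ∞ d O := by
      have h1 : ContMDiffOn ((𝓡 n).prod 𝓘(ℝ, ℝ)) 𝓘(ℝ, ℝ) ∞ c O :=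
        ((Real.smoothTransition.contDiff.contMDiff.comp contMDiff_snd).mul
          (hρ.comp contMDiff_fst)).contMDiffOn
      have h2 : ContMDiffOn ((𝓡 n).prod 𝓘(ℝ, ℝ)) 𝓘(ℝ, EuclideanSpace ℝ (Fin (n + 1))) ∞
          (fun z : N × ℝ => extChartAt I q (f z.1) - extChartAt I q (g z.1)) O := by
        refine ContMDiffOn.sub ?_ ?_
        · exact (contMDiffOn_extChartAt (I := I) (n := ∞) (x := q)).comp
            (f.contMDiff.comp contMDiff_fst).contMDiffOn fun z hz => hz.2
        · exact (contMDiffOn_extChartAt (I := I) (n := ∞) (x := q)).comp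
            (g.contMDiff.comp contMDiff_fst).contMDiffOn fun z hz => hz.1
      exact h1.smul h2
    have hd0 : ∀ z ∈ O, z ∉ C → d z = 0 := by
      intro z _ hz
      simp only [d, c, image_eq_zero_of_notMem_tsupport hz, mul_zero, zero_smul]
    have hdt : ∀ z ∈ O, extChartAt I q (g z.1) + d z ∈ (extChartAt I q).target := by
      intro z hz
      by_cases hzC : z ∈ C
      · exact (((hg z.1).2 hzC).2 (c z) (hc z)).1
      · rw [hd0 z hz hzC, add_zero]
        exact (extChartAt I q).map_source (hsrc.1 hz.1)
    obtain ⟨k, hkO, hkC⟩ := exists_push (J := (𝓡 n).prod 𝓘(ℝ, ℝ)) (X := N × ℝ)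
      ⟨fun z => g z.1, g.contMDiff.comp contMDiff_fst⟩ q hO hC hCO (fun z hz => hz.1) hd hd0 hdt
    have hkO : ∀ z ∈ C, k z = (extChartAt I q).symm (extChartAt I q (g z.1) + d z) :=
      fun z hz => hkO z (hCO hz)
    have hkC : ∀ z ∉ C, k z = g z.1 := hkC
    have hgs : ∀ z ∈ C, (extChartAt I q).symm (extChartAt I q (g z.1)) = g z.1 := fun z hz =>
      (extChartAt I q).left_inv (hsrc.1 (hCO hz).1)
    have hg'e : ContMDiff (𝓡 n) I ∞ (fun x => k (x, 1)) :=
      k.contMDiff.comp (contMDiff_id.prodMk contMDiff_const)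
    refine ⟨⟨fun x => k (x, 1), hg'e⟩, k, ⟨k.contMDiff, fun x t ht => ?_, fun x t ht => ?_⟩,
      fun z => ?_, fun x hx => ?_, fun x hx => ?_⟩
    · by_cases hx : ((x, t) : N × ℝ) ∈ C
      · rw [hkO _ hx]
        simp only [d, c, Real.smoothTransition.zero_of_nonpos ht, zero_mul, zero_smul, add_zero]
        exact hgs _ hx
      · exact hkC _ hx
    · change k (x, t) = k (x, 1)
      by_cases hx : x ∈ tsupport ρ
      · rw [hkO _ hx, hkO (x, 1) hx]
        simp only [d, c, Real.smoothTransition.one_of_one_le ht, Real.smoothTransition.one]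
      · rw [hkC (x, t) hx, hkC (x, 1) hx]
    · by_cases hz : z ∈ C
      · rw [hkO z hz]
        exact (((hg z.1).2 hz).2 (c z) (hc z)).2
      · rw [hkC z hz]
        exact (hg z.1).1
    · have hx' : x ∈ tsupport ρ := subset_tsupport _ (by simp [hx])
      change k (x, 1) = f x
      rw [hkO (x, 1) hx']
      simp only [d, c, Real.smoothTransition.one, hx, mul_one, one_smul, add_sub_cancel]
      exact (extChartAt I q).left_inv (hsrc.1 (hq x hx'))
    · change k (x, 1) = f x
      by_cases hx' : x ∈ tsupport ρ
      · rw [hkO (x, 1) hx']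
        simp only [d, hx, sub_self, smul_zero, add_zero]
        exact (extChartAt I q).left_inv (hsrc.1 (hq x hx'))
      · rw [hkC (x, 1) hx']
        exact hx

variable [IsManifold (𝓡 n) ∞ N] [CompactSpace N] [T2Space N]

/-- Maps whose graph is close to that of `f` are smoothly homotopic to `f`, close to `f`. -/
theorem exists_isStrip_of_graph (hI : IsBoundaryModel I) (f : C^∞⟮𝓡 n, N; I, M⟯) {Ω : Set (N × M)}
    (hΩ : ∀ x, Ω ∈ 𝓝 (x, f x)) :
    ∃ Ω' : Set (N × M), (∀ x, Ω' ∈ 𝓝 (x, f x)) ∧ ∀ g : C^∞⟮𝓡 n, N; I, M⟯, (∀ x, (x, g x) ∈ Ω') →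
      ∃ k : N × ℝ → M, IsStrip I k g f ∧ ∀ z, (z.1, k z) ∈ Ω := by
  classical
  have hρ : ∀ x : N, ∃ ρ : SmoothBumpFunction (𝓡 n) x,
      ∀ x' ∈ tsupport ρ, f x' ∈ (chartAt H (f x)).source := by
    intro x
    have h1 : f ⁻¹' (chartAt H (f x)).source ∈ 𝓝 x :=
      f.contMDiff.continuous.continuousAt ((chartAt H (f x)).open_source.mem_nhds (mem_chart_source H _))
    obtain ⟨ρ, -, h⟩ := (SmoothBumpFunction.nhds_basis_tsupport (I := 𝓡 n) x).mem_iff.1 h1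
    exact ⟨ρ, h⟩
  choose ρ hρ using hρ
  obtain ⟨t, -, ht⟩ := (isCompact_univ (X := N)).elim_nhds_subcover
    (fun x => {x' | ρ x x' = 1}) fun x _ => (ρ x).eventuallyEq_one
  have main : ∀ T : Finset N, ∀ Ω : Set (N × M), (∀ x, Ω ∈ 𝓝 (x, f x)) →
      ∃ Ω' : Set (N × M), (∀ x, Ω' ∈ 𝓝 (x, f x)) ∧ ∀ g : C^∞⟮𝓡 n, N; I, M⟯, (∀ x, (x, g x) ∈ Ω') →
        ∃ (g' : C^∞⟮𝓡 n, N; I, M⟯) (k : N × ℝ → M), IsStrip I k g g' ∧ (∀ z, (z.1, k z) ∈ Ω) ∧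
          ∀ i ∈ T, ∀ x, ρ i x = 1 → g' x = f x := by
    intro T
    induction T using Finset.induction_on with
    | empty =>
      intro Ω hΩ
      exact ⟨Ω, hΩ, fun g hg => ⟨g, _, isStrip_refl g.contMDiff, fun z => hg z.1, by simp⟩⟩
    | insert i T hi ih =>
      intro Ω hΩ
      -- The neighbourhoods are chosen backwards: the last correction starts in `Ω₁`, and the
      -- earlier ones must stay inside it.
      obtain ⟨Ω₁, hΩ₁Ω, hΩ₁, h₁⟩ := exists_isStrip_of_chart hI f (ρ i).contMDiff
        (fun x => (ρ i).mem_Icc) (hρ i) hΩ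
      obtain ⟨Ω₂, hΩ₂, h₂⟩ := ih Ω₁ hΩ₁
      refine ⟨Ω₂, hΩ₂, fun g hg => ?_⟩
      obtain ⟨g₁, k₁, hk₁, hk₁Ω, hg₁⟩ := h₂ g hg
      obtain ⟨g₂, k₂, hk₂, hk₂Ω, hg₂, hg₂'⟩ := h₁ g₁ fun x => by
        rw [← hk₁.right x 1 le_rfl]; exact hk₁Ω (x, 1)
      refine ⟨g₂, stripTrans k₁ k₂, hk₁.trans hk₂, fun z => ?_, fun j hj x hx => ?_⟩
      · unfold stripTrans
        split_ifs
        · exact hΩ₁Ω (hk₁Ω (z.1, 3 * z.2))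
        · exact hk₂Ω (z.1, 3 * z.2 - 2)
      · rcases Finset.mem_insert.1 hj with rfl | hj
        · exact hg₂ x hx
        · exact hg₂' x (hg₁ j hj x hx)
  obtain ⟨Ω', hΩ', h⟩ := main t Ω hΩ
  refine ⟨Ω', hΩ', fun g hg => ?_⟩
  obtain ⟨g', k, hk, hkΩ, hg'⟩ := h g hg
  have : g' = f := by
    ext x
    obtain ⟨i, hi, hx⟩ := Set.mem_iUnion₂.1 (ht (Set.mem_univ x))
    exact hg' i hi x hx
  rw [this] at hk
  exact ⟨k, hk, hkΩ⟩

/-- Closeness of graphs is an open condition in the `C^∞` topology. -/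
theorem eventually_graph_mem (f : C^∞⟮𝓡 n, N; I, M⟯) {Ω : Set (N × M)}
    (hΩ : ∀ x, Ω ∈ 𝓝 (x, f x)) : ∀ᶠ g : C^∞⟮𝓡 n, N; I, M⟯ in 𝓝 f, ∀ x, (x, g x) ∈ Ω := by
  have hf := f.contMDiff.continuous
  have key : ∀ x : N, ∃ K ∈ 𝓝 x, ∀ᶠ g : C^∞⟮𝓡 n, N; I, M⟯ in 𝓝 f, ∀ x' ∈ K, (x', g x') ∈ Ω := by
    intro x
    let ψ := extChartAt I (f x)
    have hxs : f x ∈ ψ.source := mem_extChartAt_source (f x)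
    have h1 : ∀ᶠ w : N × EuclideanSpace ℝ (Fin (n + 1)) in 𝓝 (x, ψ (f x)),
        (w.1, ψ.symm w.2) ∈ Ω := by
      have h2 : Filter.Tendsto (fun w : N × EuclideanSpace ℝ (Fin (n + 1)) =>
          (w.1, ψ.symm w.2)) (𝓝 (x, ψ (f x))) (𝓝 (x, f x)) := by
        rw [nhds_prod_eq, nhds_prod_eq]
        refine Filter.Tendsto.prodMk Filter.tendsto_fst ?_
        have h3 := (continuousAt_extChartAt_symm'' (I := I) (ψ.map_source hxs)).tendsto
        rw [ψ.left_inv hxs] at h3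
        exact h3.comp Filter.tendsto_snd
      exact h2.eventually (hΩ x)
    rw [nhds_prod_eq] at h1
    obtain ⟨U, hU, B, hB, hUB⟩ := Filter.mem_prod_iff.1 h1
    obtain ⟨δ, hδ, hδB⟩ := Metric.mem_nhds_iff.1 hB
    have h2 : ∀ᶠ x' in 𝓝 x, x' ∈ U ∧ x' ∈ (chartAt (EuclideanSpace ℝ (Fin n)) x).source ∧
        f x' ∈ ψ.source ∧ ψ (f x') ∈ Metric.ball (ψ (f x)) (δ / 2) := by
      refine Filter.Eventually.and hU (Filter.Eventually.and (chart_source_mem_nhds _ x)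
        (Filter.Eventually.and ?_ ?_))
      · exact hf.continuousAt.eventually (extChartAt_source_mem_nhds (I := I) (f x))
      · exact ((continuousAt_extChartAt (I := I) (f x)).comp hf.continuousAt).eventually
          (Metric.ball_mem_nhds _ (by positivity))
    have hlc : LocallyCompactSpace N := ChartedSpace.locallyCompactSpace (EuclideanSpace ℝ (Fin n)) N
    obtain ⟨K, hK, hKs, hKc⟩ := local_compact_nhds h2
    refine ⟨K, hK, ?_⟩
    let φ := chartAt (EuclideanSpace ℝ (Fin n)) x
    -- Derivatives of order 0 suffice: only uniform closeness of the values is needed.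
    have hopen : IsOpen (basicNhd f φ (chartAt H (f x)) K 0 (δ / 2)) := by
      refine TopologicalSpace.isOpen_generateFrom_of_mem
        ⟨f, φ, IsManifold.chart_mem_maximalAtlas x, _, IsManifold.chart_mem_maximalAtlas (f x), K, 0,
          δ / 2, hKc, fun a ha => (hKs ha).2.1, fun a ha => ?_, by positivity, rfl⟩
      rw [← extChartAt_source I]
      exact (hKs ha).2.2.1
    have hmem : f ∈ basicNhd f φ (chartAt H (f x)) K 0 (δ / 2) := by
      refine ⟨fun a ha => ?_, fun a _ k _ => ?_⟩
      · rw [← extChartAt_source I]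
        exact (hKs ha).2.2.1
      · rw [sub_self, norm_zero]
        positivity
    filter_upwards [hopen.mem_nhds hmem] with g hg x' hx'
    have h3 := hg.2 x' hx' 0 le_rfl
    have h4 : ‖ψ (g x') - ψ (f x')‖ < δ / 2 := by
      have h5 : φ.symm (φ x') = x' := φ.left_inv (hKs hx').2.1
      rw [iteratedFDeriv_zero_eq_comp, iteratedFDeriv_zero_eq_comp] at h3
      simp only [Function.comp_apply, h5] at h3
      rw [← map_sub, LinearIsometryEquiv.norm_map] at h3
      exact h3
    have h6 : g x' ∈ ψ.source := by
      rw [extChartAt_source]; exact hg.1 x' hx'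
    have h7 : ψ (g x') ∈ Metric.ball (ψ (f x)) δ := by
      have h8 := Metric.mem_ball.1 (hKs hx').2.2.2
      rw [← dist_eq_norm] at h4
      exact Metric.mem_ball.2 ((dist_triangle _ _ _).trans_lt (by linarith))
    have h9 := hUB (Set.mk_mem_prod (hKs hx').1 (hδB h7))
    change (x', ψ.symm (ψ (g x'))) ∈ Ω at h9
    rwa [ψ.left_inv h6] at h9
  choose K hK hKΩ using key
  obtain ⟨t, -, ht⟩ := (isCompact_univ (X := N)).elim_nhds_subcover K fun x _ => hK x
  have hall : ∀ᶠ g : C^∞⟮𝓡 n, N; I, M⟯ in 𝓝 f, ∀ i ∈ t, ∀ x' ∈ K i, (x', g x') ∈ Ω :=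
    (Filter.eventually_all_finset t).2 fun i _ => hKΩ i
  filter_upwards [hall] with g hg x
  obtain ⟨i, hi, hx⟩ := Set.mem_iUnion₂.1 (ht (Set.mem_univ x))
  exact hg i hi x hx

/-- Maps close to `f` are homotopic to `f` inside any neighbourhood of the image of `f`. -/
theorem eventually_exists_isStrip (hI : IsBoundaryModel I) (f : C^∞⟮𝓡 n, N; I, M⟯) {W : Set M}
    (hW : IsOpen W) (hfW : Set.range f ⊆ W) :
    ∀ᶠ g : C^∞⟮𝓡 n, N; I, M⟯ in 𝓝 f, ∃ k : N × ℝ → M, IsStrip I k g f ∧ ∀ z, k z ∈ W := by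
  have hΩ : ∀ x, (Set.univ ×ˢ W : Set (N × M)) ∈ 𝓝 (x, f x) := fun x =>
    prod_mem_nhds Filter.univ_mem (hW.mem_nhds (hfW ⟨x, rfl⟩))
  obtain ⟨Ω', hΩ', h⟩ := exists_isStrip_of_graph hI f hΩ
  filter_upwards [eventually_graph_mem f hΩ'] with g hg
  obtain ⟨k, hk, hkW⟩ := h g hg
  exact ⟨k, hk, fun z => (hkW z).2⟩

/-- Maps in the same component of the space of smooth maps are smoothly homotopic. -/
theorem exists_isStrip_of_mem_connectedComponent (hI : IsBoundaryModel I)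
    {f g : C^∞⟮𝓡 n, N; I, M⟯} (hg : g ∈ connectedComponent f) : ∃ k, IsStrip I k f g := by
  have hev : ∀ f : C^∞⟮𝓡 n, N; I, M⟯, ∀ᶠ g : C^∞⟮𝓡 n, N; I, M⟯ in 𝓝 f, ∃ k : N × ℝ → M, IsStrip I k g f := fun f =>
    (eventually_exists_isStrip hI f isOpen_univ (Set.subset_univ _)).mono fun g ⟨k, hk, _⟩ => ⟨k, hk⟩
  -- Nearby maps are homotopic, and strips can be reversed and concatenated, so both this class and
  -- its complement are open.
  have hclopen : IsClopen {g : C^∞⟮𝓡 n, N; I, M⟯ | ∃ k, IsStrip I k f g} := by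
    refine ⟨isOpen_compl_iff.1 (isOpen_iff_mem_nhds.2 fun g hg => ?_),
      isOpen_iff_mem_nhds.2 fun g hg => ?_⟩
    · filter_upwards [hev g] with g' ⟨k, hk⟩ ⟨k', hk'⟩
      exact hg ⟨_, hk'.trans hk⟩
    · obtain ⟨k', hk'⟩ := hg
      filter_upwards [hev g] with g' ⟨k, hk⟩
      exact ⟨_, hk'.trans hk.symm⟩
  exact hclopen.connectedComponent_subset ⟨_, isStrip_refl f.contMDiff⟩ hg

end GraphNeighbourhoods

end AffineWinding

end

noncomputable section

namespace AffineWinding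

/-! ### Making a given value regular -/

section Transversality

/-- `D` and `D'` will be the derivatives of one chart at two different points: the two maps are
compared only after passing to coordinates. -/
theorem sup_range_eq_top_of_comp_eq {V U E : Type*} [AddCommGroup V] [Module ℝ V] [AddCommGroup U]
    [Module ℝ U] [AddCommGroup E] [Module ℝ E] {A A' : V →ₗ[ℝ] U} {v v' : U} {D D' : U →ₗ[ℝ] E}
    (hD : Function.Surjective D) (hD' : Function.Injective D') (hA : D ∘ₗ A = D' ∘ₗ A')
    (hv : D v = D' v') (h : Submodule.span ℝ {v} ⊔ A.range = ⊤) :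
    Submodule.span ℝ {v'} ⊔ A'.range = ⊤ := by
  have h1 : (Submodule.span ℝ {v'} ⊔ A'.range).map D' = ⊤ := by
    rw [Submodule.map_sup, Submodule.map_span, Set.image_singleton, ← LinearMap.range_comp, ← hA,
      ← hv, LinearMap.range_comp, ← Set.image_singleton, ← Submodule.map_span, ← Submodule.map_sup, h,
      Submodule.map_top, LinearMap.range_eq_top.2 hD]
  rw [← Submodule.comap_map_eq_of_injective hD' (Submodule.span ℝ {v'} ⊔ A'.range), h1,
    Submodule.comap_top]

variable {n : ℕ} {N : Type*} [TopologicalSpace N] [ChartedSpace (EuclideanSpace ℝ (Fin n)) N]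
  {H : Type*} [TopologicalSpace H]
  {I : ModelWithCorners ℝ (EuclideanSpace ℝ (Fin (n + 1))) H}
  {M : Type*} [TopologicalSpace M] [ChartedSpace H M] [IsManifold I ∞ M]

theorem IsOrientedNhd.bijective {oM : MfdOrientation I M} {p : M} {V : Set M}
    {c : Module.Basis (Fin (n + 1)) ℝ (EuclideanSpace ℝ (Fin (n + 1)))}
    (hV : IsOrientedNhd oM p V c) {y : M} (hy : y ∈ V)
    {D : EuclideanSpace ℝ (Fin (n + 1)) →L[ℝ] EuclideanSpace ℝ (Fin (n + 1))}
    (hD : D = mfderiv I (𝓡 (n + 1)) (extChartAt I p) y) : Function.Bijective D.toLinearMap := by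
  obtain ⟨c', -, hc'⟩ := hV.frame y hy
  let c'' : Module.Basis (Fin (n + 1)) ℝ (EuclideanSpace ℝ (Fin (n + 1))) := c'
  refine bijective_of_basis_apply_eq c'' c fun i => ?_
  subst hD
  exact hc' i

/-- Regularity only depends on the map up to a translation in a chart. -/
theorem isSliceRegular_of_eventually_add {oM : MfdOrientation I M} {p : M} {V : Set M}
    {c : Module.Basis (Fin (n + 1)) ℝ (EuclideanSpace ℝ (Fin (n + 1)))}
    (hV : IsOrientedNhd oM p V c) {k k' : N × ℝ → M}
    (hk : MDifferentiable ((𝓡 n).prod 𝓘(ℝ, ℝ)) I k)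
    (hk' : MDifferentiable ((𝓡 n).prod 𝓘(ℝ, ℝ)) I k') {z : N × ℝ} (hz : k z ∈ V) (hz' : k' z ∈ V)
    {v : EuclideanSpace ℝ (Fin (n + 1))}
    (h : ∀ᶠ a in 𝓝 z, extChartAt I p (k' a) = extChartAt I p (k a) + v)
    (hreg : IsSliceRegular I 𝓘(ℝ, ℝ) realUnit k z) :
    IsSliceRegular I 𝓘(ℝ, ℝ) realUnit k' z := by
  let D : M → EuclideanSpace ℝ (Fin (n + 1)) →L[ℝ] EuclideanSpace ℝ (Fin (n + 1)) := fun y =>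
    mfderiv I (𝓡 (n + 1)) (extChartAt I p) y
  have hψ : ∀ y ∈ V, HasMFDerivAt I (𝓡 (n + 1)) (extChartAt I p) y (D y) := fun y hy =>
    ((contMDiffAt_extChartAt' (n := ∞) (hV.subset_source hy)).mdifferentiableAt
      (by simp)).hasMFDerivAt
  have hL : ∀ κ : N × ℝ → M, MDifferentiable ((𝓡 n).prod 𝓘(ℝ, ℝ)) I κ → κ z ∈ V →
      HasMFDerivAt (𝓡 n) (𝓡 (n + 1)) (fun x => extChartAt I p (κ (x, z.2))) z.1
        ((D (κ z)).comp (sliceLeft I κ z)) := by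
    intro κ hκ hκz
    have h1 : MDifferentiableAt (𝓡 n) I (fun x => κ (x, z.2)) z.1 :=
      (hκ _).comp _ (mdifferentiableAt_id.prodMk mdifferentiableAt_const)
    exact (hψ _ hκz).comp z.1 h1.hasMFDerivAt
  have hR : ∀ κ : N × ℝ → M, MDifferentiable ((𝓡 n).prod 𝓘(ℝ, ℝ)) I κ → κ z ∈ V →
      HasMFDerivAt 𝓘(ℝ, ℝ) (𝓡 (n + 1)) (fun t => extChartAt I p (κ (z.1, t))) z.2
        ((D (κ z)).comp (sliceRightMap I 𝓘(ℝ, ℝ) κ z)) := by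
    intro κ hκ hκz
    have h1 : MDifferentiableAt 𝓘(ℝ, ℝ) I (fun t => κ (z.1, t)) z.2 :=
      (hκ _).comp _ (mdifferentiableAt_const.prodMk mdifferentiableAt_id)
    exact (hψ _ hκz).comp z.2 h1.hasMFDerivAt
  have hT : ∀ e : EuclideanSpace ℝ (Fin (n + 1)), HasMFDerivAt (𝓡 (n + 1)) (𝓡 (n + 1))
      (fun e => e + v) e (ContinuousLinearMap.id ℝ (EuclideanSpace ℝ (Fin (n + 1)))) := fun e =>
    ((hasFDerivAt_id e).add_const v).hasMFDerivAt
  have eL : (D (k z)).comp (sliceLeft I k z) = (D (k' z)).comp (sliceLeft I k' z) := by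
    have h1 : ∀ᶠ x in 𝓝 z.1, extChartAt I p (k' (x, z.2)) = extChartAt I p (k (x, z.2)) + v :=
      (Continuous.tendsto (by fun_prop : Continuous fun x : N => (x, z.2)) z.1).eventually h
    have h2 : HasMFDerivAt (𝓡 n) (𝓡 (n + 1)) (fun x => extChartAt I p (k (x, z.2)) + v) z.1
        ((D (k z)).comp (sliceLeft I k z)) :=
      (hT _).comp z.1 (hL k hk hz)
    exact hasMFDerivAt_unique (h2.congr_of_eventuallyEq h1) (hL k' hk' hz')
  have eR : (D (k z)).comp (sliceRightMap I 𝓘(ℝ, ℝ) k z) =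
      (D (k' z)).comp (sliceRightMap I 𝓘(ℝ, ℝ) k' z) := by
    have h1 : ∀ᶠ t in 𝓝 z.2, extChartAt I p (k' (z.1, t)) = extChartAt I p (k (z.1, t)) + v :=
      (Continuous.tendsto (by fun_prop : Continuous fun t : ℝ => (z.1, t)) z.2).eventually h
    have h2 : HasMFDerivAt 𝓘(ℝ, ℝ) (𝓡 (n + 1)) (fun t => extChartAt I p (k (z.1, t)) + v) z.2
        ((D (k z)).comp (sliceRightMap I 𝓘(ℝ, ℝ) k z)) :=
      (hT _).comp z.2 (hR k hk hz)
    exact hasMFDerivAt_unique (h2.congr_of_eventuallyEq h1) (hR k' hk' hz')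
  refine sup_range_eq_top_of_comp_eq (hV.bijective hz (D := D (k z)) rfl).2
    (hV.bijective hz' (D := D (k' z)) rfl).1 ?_ ?_ hreg
  · exact congrArg ContinuousLinearMap.toLinearMap eL
  · exact congrArg (fun A : ℝ →L[ℝ] EuclideanSpace ℝ (Fin (n + 1)) => A 1) eR

variable [IsManifold (𝓡 n) ∞ N] [CompactSpace N] [T2Space M]

/-- A strip whose ends avoid `p` can be moved, with its ends fixed, to have `p` as a regular
value. -/
theorem IsStrip.exists_isStripRegular (hn : 1 ≤ n) (hI : IsBoundaryModel I)
    (oN : MfdOrientation (𝓡 n) N) (oM : MfdOrientation I M) {k : N × ℝ → M}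
    {f₀ f₁ : C^∞⟮𝓡 n, N; I, M⟯} (hk : IsStrip I k f₀ f₁) {p : M} (hp₀ : p ∉ Set.range f₀)
    (hp₁ : p ∉ Set.range f₁) : ∃ k', IsStrip I k' f₀ f₁ ∧ IsStripRegular I k' p := by
  obtain ⟨V, c, hV, hpV⟩ := exists_isOrientedNhd (by omega) oM p
  -- Displacements supported here cannot move the ends of the strip, nor its stationary parts.
  let V₀ : Set M := V ∩ ((Set.range f₀)ᶜ ∩ (Set.range f₁)ᶜ)
  have hcl : ∀ f : C^∞⟮𝓡 n, N; I, M⟯, IsOpen (Set.range f)ᶜ := fun f =>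
    (isCompact_range f.contMDiff.continuous).isClosed.isOpen_compl
  have hV₀ : IsOpen V₀ := hV.isOpen.inter ((hcl f₀).inter (hcl f₁))
  have hV₀s : V₀ ⊆ (chartAt H p).source := Set.inter_subset_left.trans hV.subset_source
  have hpV₀ : p ∈ V₀ := ⟨hpV, hp₀, hp₁⟩
  let κ : C^∞⟮(𝓡 n).prod 𝓘(ℝ, ℝ), N × ℝ; I, M⟯ := ⟨k, hk.smooth⟩
  have hpush : ∀ {A : Set M} {χ : EuclideanSpace ℝ (Fin (n + 1)) → ℝ}
      {v : EuclideanSpace ℝ (Fin (n + 1))}, IsChartPush I p V₀ A χ v →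
      ∃ k', IsStrip I k' f₀ f₁ ∧ IsPushOf I p V₀ A χ v (fun _ => 1) k k' := by
    intro A χ v hP
    obtain ⟨k', hk'⟩ := hP.exists_isPushOf κ (σ := fun _ => 1) contMDiff_const (fun _ => by simp)
    refine ⟨k', ⟨k'.contMDiff, fun x t ht => ?_, fun x t ht => ?_⟩, hk'⟩
    · have h1 : κ (x, t) = f₀ x := hk.left x t ht
      rw [hk'.eq_of_notMem _ fun hA => (hP.subset hA).2.1 ⟨x, h1.symm⟩, h1]
    · have h1 : κ (x, t) = f₁ x := hk.right x t ht
      rw [hk'.eq_of_notMem _ fun hA => (hP.subset hA).2.2 ⟨x, h1.symm⟩, h1]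
  rcases range_mem_nhds_or hI p with hp | ⟨φ, hφ, hφI, hφp⟩
  · obtain ⟨O, hO, h⟩ := exists_nhds_isChartPush hp hV₀ hV₀s hpV₀
    -- Rather than perturbing the strip generically, a nearby regular value `y` is carried onto `p`;
    -- near the fibre the strip changes by a translation in the chart, which preserves regularity.
    obtain ⟨y, hyO, hy⟩ := AffineWinding.exists_isStripRegular hn oN oM (fun _ : Unit => hk) hO
    obtain ⟨A, χ, v, hyV, -, hP, h⟩ := h y hyO p (mem_of_mem_nhds hO)
    obtain ⟨k', hk', hpush'⟩ := hpush hP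
    obtain ⟨hset, hnear⟩ := h k k' hk.smooth.continuous hpush'
    refine ⟨k', hk', fun z hz hzp => ?_⟩
    have hzy := (hset z).1 hzp
    exact isSliceRegular_of_eventually_add hV hk.mdifferentiable hk'.mdifferentiable
      (hzy ▸ hyV.1) (hzp ▸ hpV) (hnear z hzy) ((hy ()).2.2 z hz hzy)
  · obtain ⟨O, hO, A, χ, v, hP, h⟩ := exists_isChartPush_notMem hφ hφI hφp hV₀ hV₀s hpV₀
    obtain ⟨k', hk', hpush'⟩ := hpush hP
    exact ⟨k', hk', fun z _ hzp => absurd (hzp ▸ mem_of_mem_nhds hO) (h k k' hpush' z)⟩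

end Transversality

/-! ### The subgroup of degrees and the affine winding number -/

section Degrees

variable {n : ℕ} {N : Type*} [TopologicalSpace N] [ChartedSpace (EuclideanSpace ℝ (Fin n)) N]
  [IsManifold (𝓡 n) ∞ N] [T2Space N] [CompactSpace N]
  {H : Type*} [TopologicalSpace H]
  {I : ModelWithCorners ℝ (EuclideanSpace ℝ (Fin (n + 1))) H}
  {M : Type*} [TopologicalSpace M] [ChartedSpace H M] [IsManifold I ∞ M] [T2Space M]
  [ConnectedSpace M] {oN : MfdOrientation (𝓡 n) N} {oM : MfdOrientation I M}
  {𝒩 : Set C^∞⟮𝓡 n, N; I, M⟯}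

theorem HasDegree.signedCount_eq (hn : 1 ≤ n) (hI : IsBoundaryModel I)
    {μ : C^∞⟮(𝓡 n).prod (𝓡 1), N × Circle; I, M⟯} {d : ℤ} (hμ : HasDegree oN oM μ d) {y : M}
    (hy : IsRegularValue μ y) : signedCount oN oM circleUnitVector μ y = d := by
  unfold HasDegree at hμ
  split_ifs at hμ with hM
  · exact hμ.2 y hy
  · obtain ⟨d', hd', hd'0⟩ := exists_degree hn hI oN oM μ
    rw [hd' y hy, hd'0 hM, hμ]

theorem hasDegree_signedCount (hn : 1 ≤ n) (hI : IsBoundaryModel I)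
    {μ : C^∞⟮(𝓡 n).prod (𝓡 1), N × Circle; I, M⟯} {y : M} (hy : IsRegularValue μ y) :
    HasDegree oN oM μ (signedCount oN oM circleUnitVector μ y) := by
  obtain ⟨d, hd, hd0⟩ := exists_degree hn hI oN oM μ
  rw [hd y hy]
  unfold HasDegree
  split_ifs with hM
  · exact ⟨⟨y, hy⟩, hd⟩
  · exact hd0 hM

/-- The signed count of a closed strip is the degree of a special map. -/
theorem IsStrip.stripCount_mem_specialDegrees (hn : 1 ≤ n) (hI : IsBoundaryModel I)
    {k : N × ℝ → M} {f : C^∞⟮𝓡 n, N; I, M⟯} (hf : f ∈ 𝒩) (hk : IsStrip I k f f) {y : M}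
    (hyf : y ∉ Set.range f) (hy : IsStripRegular I k y) :
    stripCount oN oM k y ∈ specialDegrees oN oM 𝒩 := by
  obtain ⟨μ, hμ, h⟩ := hk.exists_circle_count hn oN oM
  obtain ⟨h1, h2, -⟩ := h y hyf
  have hreg := h1.2 hy
  refine ⟨μ, ⟨-1, f, hf, fun x => (hμ x).symm⟩, ?_⟩
  rw [← h2 hreg]
  exact hasDegree_signedCount hn hI hreg

/-- The degree of a special map is the signed count of a closed strip. -/
theorem exists_isStrip_of_mem_specialDegrees (hn : 1 ≤ n) (hI : IsBoundaryModel I) {d : ℤ}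
    (hd : d ∈ specialDegrees oN oM 𝒩) :
    ∃ f ∈ 𝒩, ∃ k, IsStrip I k f f ∧ ∀ y, y ∉ Set.range f → IsStripRegular I k y →
      stripCount oN oM k y = d := by
  obtain ⟨μ, ⟨s, f, hf, hfs⟩, hμ⟩ := hd
  obtain ⟨k, hk, h⟩ := exists_isStrip_of_circle hn oN oM μ s
  have hfe : (fun x => μ (x, s)) = f := funext fun x => (hfs x).symm
  rw [hfe] at hk
  refine ⟨f, hf, k, hk, fun y hyf hy => ?_⟩
  obtain ⟨h1, h2⟩ := h y fun x hx => hyf ⟨x, (hfs x).trans hx⟩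
  rw [← h2 (h1.2 hy), hμ.signedCount_eq hn hI (h1.2 hy)]

/-- Constant strips give zero and reversed strips give negatives. For sums, two closed strips may
have different base maps, but these are joined by a strip because both lie in one component. -/
theorem coe_indeterminacy (hn : 1 ≤ n) (hI : IsBoundaryModel I)
    (h𝒩 : ∃ g, 𝒩 = connectedComponent g) :
    (indeterminacy oN oM 𝒩 : Set ℤ) = specialDegrees oN oM 𝒩 := by
  obtain ⟨g, rfl⟩ := h𝒩
  obtain ⟨p⟩ : Nonempty M := inferInstance
  let S : AddSubgroup ℤ :=
    { carrier := specialDegrees oN oM (connectedComponent g)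
      zero_mem' := by
        have hk := isStrip_refl g.contMDiff
        obtain ⟨y, -, hy⟩ := exists_isStripRegular hn oN oM (fun _ : Unit => hk)
          (Filter.univ_mem (f := 𝓝 p))
        have h0 : stripCount oN oM (fun z : N × ℝ => g z.1) y = 0 := by
          unfold stripCount countOn
          have : {z : N × ℝ | z.2 ∈ Set.Ioo (0 : ℝ) 1 ∧ g z.1 = y} = ∅ :=
            Set.eq_empty_of_forall_notMem fun z hz => (hy ()).1 ⟨z.1, hz.2⟩
          rw [this, finsum_mem_empty]
        rw [← h0]
        exact hk.stripCount_mem_specialDegrees hn hI mem_connectedComponent (hy ()).1 (hy ()).2.2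
      add_mem' := by
        intro d₁ d₂ hd₁ hd₂
        obtain ⟨g₁, hg₁, k₁, hk₁, h₁⟩ := exists_isStrip_of_mem_specialDegrees hn hI hd₁
        obtain ⟨g₂, hg₂, k₂, hk₂, h₂⟩ := exists_isStrip_of_mem_specialDegrees hn hI hd₂
        obtain ⟨h, hh⟩ := exists_isStrip_of_mem_connectedComponent hI
          (show g₂ ∈ connectedComponent g₁ by rwa [← connectedComponent_eq hg₁])
        have hk : ∀ i : Fin 3, IsStrip I (![k₁, k₂, h] i) (![⇑g₁, ⇑g₂, ⇑g₁] i)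
            (![⇑g₁, ⇑g₂, ⇑g₂] i) := by
          intro i
          fin_cases i
          exacts [hk₁, hk₂, hh]
        obtain ⟨y, -, hy⟩ := exists_isStripRegular hn oN oM hk (Filter.univ_mem (f := 𝓝 p))
        have hy₁ : y ∉ Set.range g₁ := (hy 0).1
        have hy₂ : y ∉ Set.range g₂ := (hy 1).1
        have r₁ : IsStripRegular I k₁ y := (hy 0).2.2
        have r₂ : IsStripRegular I k₂ y := (hy 1).2.2
        have r₃ : IsStripRegular I h y := (hy 2).2.2
        have r₄ := hh.isStripRegular_symm.2 r₃
        have r₅ := (hk₂.isStripRegular_trans hh.symm hy₂).2 ⟨r₂, r₄⟩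
        have r₆ := (hh.isStripRegular_trans (hk₂.trans hh.symm) hy₂).2 ⟨r₃, r₅⟩
        -- The second loop is conjugated by `h` to the base map of the first; the counts of `h` and
        -- of its reverse cancel.
        have key := (hk₁.trans (hh.trans (hk₂.trans hh.symm))).stripCount_mem_specialDegrees
          (oN := oN) (oM := oM) hn hI hg₁ hy₁
          ((hk₁.isStripRegular_trans (hh.trans (hk₂.trans hh.symm)) hy₁).2 ⟨r₁, r₆⟩)
        rw [stripCount_trans hn oN oM hk₁ _ hy₁ hy₁ hy₁ r₁ r₆,
          stripCount_trans hn oN oM hh _ hy₁ hy₂ hy₁ r₃ r₅,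
          stripCount_trans hn oN oM hk₂ hh.symm hy₂ hy₂ hy₁ r₂ r₄,
          stripCount_symm hn oN oM hh r₃, h₁ y hy₁ r₁, h₂ y hy₂ r₂, add_neg_cancel_comm_assoc] at key
        · exact key
        · exact hk₂.trans hh.symm
        · exact hh.trans (hk₂.trans hh.symm)
      neg_mem' := by
        intro d hd
        obtain ⟨f, hf, k, hk, h⟩ := exists_isStrip_of_mem_specialDegrees hn hI hd
        obtain ⟨y, -, hy⟩ := exists_isStripRegular hn oN oM (fun _ : Unit => hk)
          (Filter.univ_mem (f := 𝓝 p))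
        rw [← h y (hy ()).1 (hy ()).2.2, ← stripCount_symm hn oN oM hk (hy ()).2.2]
        exact hk.symm.stripCount_mem_specialDegrees hn hI hf (hy ()).1
          (hk.isStripRegular_symm.2 (hy ()).2.2) }
  exact congrArg (fun T : AddSubgroup ℤ => (T : Set ℤ)) (AddSubgroup.closure_eq S)

/-- The signed count of a closed strip vanishes in `ℤ / A`. -/
theorem IsStrip.quot_stripCount_eq_zero (hn : 1 ≤ n) (hI : IsBoundaryModel I)
    {k : N × ℝ → M} {f : C^∞⟮𝓡 n, N; I, M⟯} (hf : f ∈ 𝒩) (hk : IsStrip I k f f) {y : M}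
    (hyf : y ∉ Set.range f) (hy : IsStripRegular I k y) :
    quot oN oM 𝒩 (stripCount oN oM k y) = 0 :=
  (QuotientAddGroup.eq_zero_iff _).2
    (AddSubgroup.subset_closure (hk.stripCount_mem_specialDegrees hn hI hf hyf hy))

/-- Good homotopies with the same ends have the same signed count in `ℤ / A`. -/
theorem IsGoodHomotopy.quot_Delta_eq (hn : 1 ≤ n) (hI : IsBoundaryModel I) {p : M}
    {f₀ f₁ : C^∞⟮𝓡 n, N; I, M⟯} (hf₀ : f₀ ∈ 𝒩)
    {F F' : C^∞⟮(𝓡 n).prod (𝓡∂ 1), N × unitInterval; I, M⟯} (hF : IsGoodHomotopy p F f₀ f₁)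
    (hF' : IsGoodHomotopy p F' f₀ f₁) :
    quot oN oM 𝒩 (Delta oN oM p F) = quot oN oM 𝒩 (Delta oN oM p F') := by
  obtain ⟨k, hk, hp₀, hp₁, hr, hc, -⟩ := hF.exists_isStrip hn oN oM
  obtain ⟨k', hk', -, -, hr', hc', -⟩ := hF'.exists_isStrip hn oN oM
  have hrs := hk'.isStripRegular_symm.2 hr'
  have h := (hk.trans hk'.symm).quot_stripCount_eq_zero (oN := oN) (oM := oM) hn hI hf₀ hp₀
    ((hk.isStripRegular_trans hk'.symm hp₁).2 ⟨hr, hrs⟩)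
  rwa [stripCount_trans hn oN oM hk hk'.symm hp₀ hp₁ hp₀ hr hrs, stripCount_symm hn oN oM hk' hr',
    hc, hc', ← sub_eq_add_neg, map_sub, sub_eq_zero] at h

theorem IsGoodHomotopy.awin_eq (hn : 1 ≤ n) (hI : IsBoundaryModel I) {p : M}
    {f₀ f₁ : C^∞⟮𝓡 n, N; I, M⟯} (hf₀ : f₀ ∈ 𝒩)
    {F : C^∞⟮(𝓡 n).prod (𝓡∂ 1), N × unitInterval; I, M⟯} (hF : IsGoodHomotopy p F f₀ f₁) :
    awin oN oM 𝒩 p f₀ f₁ = quot oN oM 𝒩 (Delta oN oM p F) := by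
  have h : ∃ F, IsGoodHomotopy p F f₀ f₁ := ⟨F, hF⟩
  unfold awin
  rw [dif_pos h]
  exact h.choose_spec.quot_Delta_eq hn hI hf₀ hF

/-- Signed counts are additive under concatenation of good homotopies, in `ℤ / A`. -/
theorem IsGoodHomotopy.quot_Delta_add (hn : 1 ≤ n) (hI : IsBoundaryModel I) {p : M}
    {f₀ f₁ f₂ : C^∞⟮𝓡 n, N; I, M⟯} (hf₀ : f₀ ∈ 𝒩)
    {F G K : C^∞⟮(𝓡 n).prod (𝓡∂ 1), N × unitInterval; I, M⟯} (hF : IsGoodHomotopy p F f₀ f₁)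
    (hG : IsGoodHomotopy p G f₁ f₂) (hK : IsGoodHomotopy p K f₀ f₂) :
    quot oN oM 𝒩 (Delta oN oM p F) + quot oN oM 𝒩 (Delta oN oM p G) =
      quot oN oM 𝒩 (Delta oN oM p K) := by
  obtain ⟨k, hk, hp₀, hp₁, hr, hc, -⟩ := hF.exists_isStrip hn oN oM
  obtain ⟨k', hk', -, hp₂, hr', hc', -⟩ := hG.exists_isStrip hn oN oM
  obtain ⟨l, hl, -, -, hs, hd, -⟩ := hK.exists_isStrip hn oN oM
  have hr₁ := hl.isStripRegular_symm.2 hs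
  have hr₂ := (hk'.isStripRegular_trans hl.symm hp₂).2 ⟨hr', hr₁⟩
  have h := (hk.trans (hk'.trans hl.symm)).quot_stripCount_eq_zero (oN := oN) (oM := oM) hn hI
    hf₀ hp₀ ((hk.isStripRegular_trans (hk'.trans hl.symm) hp₁).2 ⟨hr, hr₂⟩)
  rw [stripCount_trans hn oN oM hk (hk'.trans hl.symm) hp₀ hp₁ hp₀ hr hr₂,
    stripCount_trans hn oN oM hk' hl.symm hp₁ hp₂ hp₀ hr' hr₁, stripCount_symm hn oN oM hl hs,
    hc, hc', hd, ← sub_eq_add_neg, ← add_sub_assoc, map_sub, sub_eq_zero, map_add] at h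
  exact h

/-- Connectedness provides some smooth homotopy; since both ends avoid `p`, it can be made regular
at `p` with its ends fixed. -/
theorem exists_isGoodHomotopy (hn : 1 ≤ n) (hI : IsBoundaryModel I) (oN : MfdOrientation (𝓡 n) N)
    (oM : MfdOrientation I M) {p : M} (h𝒩 : ∃ g, 𝒩 = connectedComponent g)
    {f₀ f₁ : C^∞⟮𝓡 n, N; I, M⟯} (hf₀ : f₀ ∈ offDiscriminant 𝒩 p)
    (hf₁ : f₁ ∈ offDiscriminant 𝒩 p) : ∃ F, IsGoodHomotopy p F f₀ f₁ := by
  obtain ⟨g, rfl⟩ := h𝒩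
  obtain ⟨k, hk⟩ := exists_isStrip_of_mem_connectedComponent hI
    (show f₁ ∈ connectedComponent f₀ by rw [← connectedComponent_eq hf₀.1]; exact hf₁.1)
  obtain ⟨k', hk', hr⟩ := hk.exists_isStripRegular hn hI oN oM hf₀.2 hf₁.2
  obtain ⟨F, hF, -⟩ := hk'.exists_isGoodHomotopy hf₀.2 hf₁.2 hr
  exact ⟨F, hF⟩

theorem awin_sub_awin (hn : 1 ≤ n) (hI : IsBoundaryModel I) {p : M}
    (h𝒩 : ∃ g, 𝒩 = connectedComponent g)
    {ε f₀ f₁ : C^∞⟮𝓡 n, N; I, M⟯} (hε : ε ∈ offDiscriminant 𝒩 p) (hf₀ : f₀ ∈ offDiscriminant 𝒩 p)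
    (hf₁ : f₁ ∈ offDiscriminant 𝒩 p)
    {F : C^∞⟮(𝓡 n).prod (𝓡∂ 1), N × unitInterval; I, M⟯} (hF : IsGoodHomotopy p F f₀ f₁) :
    awin oN oM 𝒩 p ε f₁ - awin oN oM 𝒩 p ε f₀ = quot oN oM 𝒩 (Delta oN oM p F) := by
  obtain ⟨F₀, hF₀⟩ := exists_isGoodHomotopy hn hI oN oM h𝒩 hε hf₀
  obtain ⟨F₁, hF₁⟩ := exists_isGoodHomotopy hn hI oN oM h𝒩 hε hf₁
  rw [hF₀.awin_eq hn hI hε.1, hF₁.awin_eq hn hI hε.1, ← hF₀.quot_Delta_add hn hI hε.1 hF hF₁,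
    add_sub_cancel_left]

/-- A map near `f` is joined to `f` within the complement of `p`. Such a homotopy is vacuously
regular at `p` and has `Δ = 0`, so the difference formula gives equality. -/
theorem isLocallyConstant_awin (hn : 1 ≤ n) (hI : IsBoundaryModel I) {p : M}
    (h𝒩 : ∃ g, 𝒩 = connectedComponent g) {ε : C^∞⟮𝓡 n, N; I, M⟯} (hε : ε ∈ offDiscriminant 𝒩 p) :
    IsLocallyConstant (fun f : offDiscriminant 𝒩 p => awin oN oM 𝒩 p ε f) := by
  refine (IsLocallyConstant.iff_eventually_eq _).2 fun f => ?_
  have hev := eventually_exists_isStrip hI f.1 (W := {p}ᶜ) isOpen_compl_singleton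
    fun y hy h => f.2.2 (h ▸ hy)
  filter_upwards [continuous_subtype_val.continuousAt.eventually hev] with g ⟨k, hk, hkp⟩
  obtain ⟨F, hF, hFk⟩ := hk.exists_isGoodHomotopy g.2.2 f.2.2 fun z _ hz => absurd hz (hkp z)
  have h := awin_sub_awin (oN := oN) (oM := oM) hn hI h𝒩 hε g.2 f.2 hF
  have h0 : Delta oN oM p F = 0 := signedCount_of_forall_ne oN oM fun z hz =>
    hkp (z.1, z.2) ((hFk z).symm.trans hz)
  rw [h0, map_zero, sub_eq_zero] at h
  exact h.symm

end Degrees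

end AffineWinding

end

open AffineWinding in
theorem theorem1p7 {n : ℕ} (hn : 1 ≤ n)
    {N : Type*} [TopologicalSpace N] [ChartedSpace (EuclideanSpace ℝ (Fin n)) N]
    [IsManifold (𝓡 n) ∞ N] [T2Space N] [CompactSpace N] [ConnectedSpace N]
    {H : Type*} [TopologicalSpace H]
    (I : ModelWithCorners ℝ (EuclideanSpace ℝ (Fin (n + 1))) H) (hI : IsBoundaryModel I)
    {M : Type*} [TopologicalSpace M] [ChartedSpace H M]
    [IsManifold I ∞ M] [T2Space M] [SecondCountableTopology M] [ConnectedSpace M]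
    (oN : MfdOrientation (𝓡 n) N) (oM : MfdOrientation I M)
    (𝒩 : Set C^∞⟮𝓡 n, N; I, M⟯) (h𝒩 : ∃ g, 𝒩 = connectedComponent g) (p : M) :
    -- the degrees of the special maps form a subgroup of `ℤ`, and `Δ` is a finite sum
    ((indeterminacy oN oM 𝒩 : Set ℤ) = specialDegrees oN oM 𝒩 ∧
      ∀ F : C^∞⟮(𝓡 n).prod (𝓡∂ 1), N × unitInterval; I, M⟯, IsGood p F → (F ⁻¹' {p}).Finite) ∧
    -- 1: `awin` does not depend on the good homotopy, and is defined on all of `𝒩 ∖ Σ`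
    (∀ ε ∈ offDiscriminant 𝒩 p, ∀ f ∈ offDiscriminant 𝒩 p,
      (∃ F, IsGoodHomotopy p F ε f) ∧
      ∀ F, IsGoodHomotopy p F ε f →
        awin oN oM 𝒩 p ε f = quot oN oM 𝒩 (Delta oN oM p F)) ∧
    -- 2: the difference along a good homotopy, and local constancy
    (∀ ε ∈ offDiscriminant 𝒩 p,
      (∀ f₀ ∈ offDiscriminant 𝒩 p, ∀ f₁ ∈ offDiscriminant 𝒩 p, ∀ F, IsGoodHomotopy p F f₀ f₁ →
        awin oN oM 𝒩 p ε f₁ - awin oN oM 𝒩 p ε f₀ = quot oN oM 𝒩 (Delta oN oM p F)) ∧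
      IsLocallyConstant (fun f : offDiscriminant 𝒩 p => awin oN oM 𝒩 p ε f)) ∧
    -- 3: the change of the preferred map
    (∀ ε ∈ offDiscriminant 𝒩 p, ∀ ε' ∈ offDiscriminant 𝒩 p, ∀ f ∈ offDiscriminant 𝒩 p,
      awin oN oM 𝒩 p ε' f - awin oN oM 𝒩 p ε f = awin oN oM 𝒩 p ε' ε) := by
  refine ⟨⟨coe_indeterminacy hn hI h𝒩, fun F hF => ?_⟩, fun ε hε f hf =>
    ⟨exists_isGoodHomotopy hn hI oN oM h𝒩 hε hf, fun F hF => hF.awin_eq hn hI hε.1⟩,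
    fun ε hε => ⟨fun f₀ hf₀ f₁ hf₁ F hF => awin_sub_awin hn hI h𝒩 hε hf₀ hf₁ hF,
      isLocallyConstant_awin hn hI h𝒩 hε⟩, fun ε hε ε' hε' f hf => ?_⟩
  -- A good map is a good homotopy between its own end slices, so finiteness follows from that of
  -- the associated strip.
  · have hs : ∀ t : unitInterval, ContMDiff (𝓡 n) I ∞ (fun x => F (x, t)) := fun t =>
      F.contMDiff.comp (contMDiff_id.prodMk contMDiff_const)
    have hF' : IsGoodHomotopy p F ⟨_, hs 0⟩ ⟨_, hs 1⟩ := ⟨hF, fun x => rfl, fun x => rfl⟩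
    obtain ⟨k, hk, hp₀, hp₁, hr, -, hfin⟩ := hF'.exists_isStrip hn oN oM
    exact hfin (hk.finite hn oN oM hp₀ hp₁ hr)
  -- A good homotopy from `ε` to `f` computes the winding number relative to `ε`, and also the
  -- increment from `ε` to `f` of the one relative to `ε'`.
  · obtain ⟨F, hF⟩ := exists_isGoodHomotopy hn hI oN oM h𝒩 hε hf
    rw [hF.awin_eq hn hI hε.1, ← awin_sub_awin hn hI h𝒩 hε' hε hf hF, sub_sub_cancel]
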